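/- Let $k$ be a field, let $C$ be a smooth projective geometrically integral curve over $k$ of genus $g$, let $D$ be a divisor on $C$ with $\deg D>2g-2$ and $\deg D>0$, and let $r\ge 1$ be an integer. The vector space $\bigoplus_{i=1}^r H^0(C,\mathcal O(iD))$ is finite-dimensional; let $B$ be the corresponding affine space over $k$ (the Hitchin base for meromorphic Higgs bundles of rank $r$ with values in $\mathcal O(D)$). Let $p:\mathcal C_B\to B$ be the universal spectral curve, whose fibre over $b=(b_1,\dots,b_r)$ is the closed subscheme of the total space $\pi:\operatorname{Tot}(\mathcal O(D))\to C$ cut out by the section $$P_b(t)=t^r+b_1t^{r-1}+\dots+b_r$$ of $\pi^*\mathcal O(rD)$, with $t$ the tautological section of $\pi^*\mathcal O(D)$. Let $V\subset B$ be the set of points over which the geometric fibre of $p$ is non-reduced. Then $V$ is closed in $B$ and has codimension at least $2$ (that is, $\dim\mathcal O_{B,v}\ge 2$ for every $v\in V$; $V$ may be empty). -/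

import Mathlib

open AlgebraicGeometry CategoryTheory Limits TensorProduct Polynomial
universe u

/-- The local rings of a smooth algebra of relative dimension one over a field are regular of
dimension at most one. -/
theorem isPrincipal_maximalIdeal_of_smooth {k A : Type u} [Field k] [CommRing A] [Algebra k A]
    [Algebra.IsStandardSmoothOfRelativeDimension 1 k A] (q : Ideal A) [q.IsPrime] :
    (IsLocalRing.maximalIdeal (Localization.AtPrime q)).IsPrincipal := by
  classical
  obtain ⟨ι, σ, _, _, P, hP⟩ :=
    (inferInstance : Algebra.IsStandardSmoothOfRelativeDimension 1 k A).out
  have : Fintype ι := Fintype.ofFinite _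
  have : Fintype σ := Fintype.ofFinite _
  have hcard : Fintype.card ((Set.range P.map)ᶜ : Set ι) = 1 := by
    have := hP
    simp only [Algebra.Presentation.dimension, Nat.card_eq_fintype_card] at this
    rw [Fintype.card_compl_set, Set.card_range_of_injective P.map_inj, this]
  obtain ⟨i, hi⟩ := Fintype.card_eq_one_iff.mp hcard
  let x : A := P.val i
  let _ : Algebra k[X] A := (Polynomial.aeval x).toAlgebra
  have : IsScalarTower k k[X] A := .of_algebraMap_eq' (Polynomial.aeval x).comp_algebraMap.symm
  have hx : algebraMap k[X] A Polynomial.X = x := Polynomial.aeval_X x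
  have : Algebra.FormallyUnramified k[X] A := by
    rw [Algebra.formallyUnramified_iff]
    refine subsingleton_of_forall_eq 0 fun w ↦ ?_
    obtain ⟨w, rfl⟩ := KaehlerDifferential.map_surjective k k[X] A w
    have hw : w ∈ Submodule.span A (Set.range P.basisKaehler) := by
      rw [P.basisKaehler.span_eq]; trivial
    induction hw using Submodule.span_induction with
    | mem w hw =>
      obtain ⟨j, rfl⟩ := hw
      obtain rfl := hi j
      rw [P.basisKaehler_apply, KaehlerDifferential.map_D]
      change KaehlerDifferential.D k[X] A (algebraMap A A x) = 0
      rw [← hx]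
      simp
    | zero => simp
    | add _ _ _ _ h₁ h₂ => rw [map_add, h₁, h₂, add_zero]
    | smul a _ _ h => rw [map_smul, h, smul_zero]
  have : Algebra.IsStandardSmooth k A :=
    Algebra.IsStandardSmoothOfRelativeDimension.isStandardSmooth 1
  let p := q.under k[X]
  let _ := Localization.AtPrime.algebraOfLiesOver p q
  have : Algebra.EssFiniteType k (Localization.AtPrime q) :=
    have := Algebra.EssFiniteType.of_isLocalization (Localization.AtPrime q) q.primeCompl
    .comp k A _
  have : IsScalarTower k k[X] (Localization.AtPrime q) := inferInstance
  have : Algebra.EssFiniteType k[X] (Localization.AtPrime q) :=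
    Algebra.EssFiniteType.of_comp k k[X] _
  have : Algebra.EssFiniteType (Localization.AtPrime p) (Localization.AtPrime q) :=
    Algebra.EssFiniteType.of_comp k[X] _ _
  have : Algebra.FormallyUnramified (Localization.AtPrime p) (Localization.AtPrime q) :=
    Algebra.FormallyUnramified.of_restrictScalars k[X] _ _
  rw [← Algebra.FormallyUnramified.map_maximalIdeal (R := Localization.AtPrime p)
    (S := Localization.AtPrime q), ← Localization.AtPrime.map_eq_maximalIdeal]
  have : p.IsPrincipal := IsPrincipalIdealRing.principal p
  infer_instance

/-- The morphism out of a glued scheme induced by a compatible family of morphisms out of the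
pieces. -/
noncomputable def descGlued {X : Scheme.{u}} {𝒰 : X.OpenCover} [Category 𝒰.I₀]
    [𝒰.LocallyDirected] [Small.{u} 𝒰.I₀] [Quiver.IsThin 𝒰.I₀] (d : 𝒰.RelativeGluingData)
    (c : Cocone d.functor) : d.glued ⟶ c.pt :=
  colimit.desc _ c

/-- A smooth projective curve over a field `k`: a geometrically integral `k`-scheme which is proper
and smooth of relative dimension one (a proper curve over a field is projective). -/
structure SmoothProjectiveCurve (k : Type u) [Field k] where
  scheme : Scheme.{u}
  π : scheme ⟶ Spec (.of k)
  [isProper : IsProper π]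
  [smooth : SmoothOfRelativeDimension 1 π]
  [geometricallyIntegral : GeometricallyIntegral π]

namespace SmoothProjectiveCurve

variable {k : Type u} [Field k] (C : SmoothProjectiveCurve k)

attribute [instance] isProper smooth geometricallyIntegral

instance : IsIntegral C.scheme := GeometricallyIntegral.isIntegral_of_subsingleton C.π

instance : IsLocallyNoetherian C.scheme := LocallyOfFiniteType.isLocallyNoetherian C.π

theorem isDiscreteValuationRing_stalk (x : C.scheme) (hx : Order.coheight x = 1) :
    IsDiscreteValuationRing (C.scheme.presheaf.stalk x) := by
  have hdim := ringKrullDim_stalk_eq_coheight x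
  rw [hx] at hdim
  have hf : ¬ IsField (C.scheme.presheaf.stalk x) := fun h ↦ by
    rw [ringKrullDim_eq_zero_of_isField h] at hdim
    simp at hdim
  refine ((IsDiscreteValuationRing.TFAE _ hf).out 4 0).mp ?_
  obtain ⟨U, hU, V, hV, hxV, e, h⟩ :=
    SmoothOfRelativeDimension.exists_isStandardSmoothOfRelativeDimension (n := 1) (f := C.π) x
  have hUtop : U = ⊤ := by
    rw [eq_top_iff]
    intro y _
    rw [Subsingleton.elim y (C.π x)]
    exact e hxV
  subst hUtop
  have hfield : IsField Γ(Spec (.of k), ⊤) :=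
    (Scheme.ΓSpecIso (.of k)).commRingCatIsoToRingEquiv.toMulEquiv.isField (Field.toIsField k)
  let _ := hfield.toField
  algebraize [(C.π.appLE ⊤ V e).hom]
  let q := (hV.primeIdealOf ⟨x, hxV⟩).asIdeal
  have hq := isPrincipal_maximalIdeal_of_smooth (k := Γ(Spec (.of k), ⊤)) q
  let _ := TopCat.Presheaf.algebra_section_stalk C.scheme.presheaf (U := V) ⟨x, hxV⟩
  have := hV.isLocalization_stalk ⟨x, hxV⟩
  let φ : Localization.AtPrime q ≃+* C.scheme.presheaf.stalk x :=
    (IsLocalization.algEquiv q.primeCompl (Localization.AtPrime q)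
      (C.scheme.presheaf.stalk x)).toRingEquiv
  have hφ : IsLocalRing.maximalIdeal (C.scheme.presheaf.stalk x) =
      (IsLocalRing.maximalIdeal (Localization.AtPrime q)).map φ := by
    ext y
    rw [← Ideal.comap_symm, Ideal.mem_comap, IsLocalRing.mem_maximalIdeal,
      IsLocalRing.mem_maximalIdeal, mem_nonunits_iff, mem_nonunits_iff, MulEquiv.isUnit_map]
  obtain ⟨a, ha⟩ := hq
  rw [hφ, ha]
  exact ⟨φ a, by rw [Ideal.submodule_span_eq, Ideal.map_span, Set.image_singleton]⟩

/-- The prime divisors of a curve: its points of codimension one, i.e. its closed points. -/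
def PrimeDivisor : Type u := {x : C.scheme // Order.coheight x = 1}

/-- The (Weil) divisors of a curve. -/
abbrev Divisor : Type u := C.PrimeDivisor →₀ ℤ

variable {C} in
/-- The degree over `k` of a divisor: `deg (∑ n_x x) = ∑ n_x [κ(x) : k]`. -/
noncomputable def Divisor.degree (D : C.Divisor) : ℤ :=
  D.sum fun x n ↦ n * C.π.residueDegree x.1

/-- The function field `K(C)`. -/
def FunctionField : Type u := C.scheme.functionField

noncomputable instance : Field C.FunctionField := inferInstanceAs (Field C.scheme.functionField)

/-- The inclusion of `k` in the function field. -/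
noncomputable def constants : k →+* C.FunctionField :=
  (C.scheme.presheaf.germ ⊤ (genericPoint C.scheme) trivial).hom.comp
    (C.π.appTop.hom.comp (Scheme.ΓSpecIso (.of k)).inv.hom)

noncomputable instance : Algebra k C.FunctionField := C.constants.toAlgebra

/-- The order of vanishing of a rational function at a closed point. -/
noncomputable def ord (f : C.FunctionField) (x : C.PrimeDivisor) : ℤ :=
  Scheme.ord (X := C.scheme) f x.1

theorem ord_mul {f g : C.FunctionField} (hf : f ≠ 0) (hg : g ≠ 0) (x : C.PrimeDivisor) :
    C.ord (f * g) x = C.ord f x + C.ord g x :=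
  Scheme.ord_mul (X := C.scheme) hf hg

theorem ord_add {f g : C.FunctionField} (h : f + g ≠ 0) (x : C.PrimeDivisor) :
    min (C.ord f x) (C.ord g x) ≤ C.ord (f + g) x :=
  have := C.isDiscreteValuationRing_stalk x.1 x.2
  Scheme.ord_add (X := C.scheme) h

theorem ord_germ {U : C.scheme.Opens} (hU : genericPoint C.scheme ∈ U) {f : Γ(C.scheme, U)} (hf : IsUnit f)
    (x : C.PrimeDivisor) (hx : x.1 ∈ U) :
    C.ord (C.scheme.presheaf.germ U (genericPoint C.scheme) hU f) x = 0 :=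
  have : Nonempty U := ⟨⟨_, hU⟩⟩
  Scheme.ord_of_isUnit hf hx

theorem ord_algebraMap {c : k} (hc : c ≠ 0) (x : C.PrimeDivisor) :
    C.ord (algebraMap k C.FunctionField c) x = 0 :=
  C.ord_germ (U := ⊤) trivial
    (((IsUnit.mk0 c hc).map (Scheme.ΓSpecIso (.of k)).inv.hom).map C.π.appTop.hom) x trivial

/-- The sections of `𝒪(D)` over an open `U`, as a subspace of the function field: `0` and the
rational functions `f` with `div f + D ≥ 0` on `U`. -/
noncomputable def sections (D : C.Divisor) (U : C.scheme.Opens) : Submodule k C.FunctionField where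
  carrier := {f | f ≠ 0 → ∀ x : C.PrimeDivisor, x.1 ∈ U → 0 ≤ C.ord f x + D x}
  zero_mem' h := absurd rfl h
  add_mem' {f g} hf hg h x hx := by
    by_cases hf0 : f = 0
    · subst hf0; rw [zero_add] at h ⊢; exact hg h x hx
    by_cases hg0 : g = 0
    · subst hg0; rw [add_zero] at h ⊢; exact hf h x hx
    have h₁ := hf hf0 x hx
    have h₂ := hg hg0 x hx
    have h₃ := C.ord_add h x
    rcases min_le_iff.mp h₃ with h₄ | h₄ <;> linarith
  smul_mem' c f hf h x hx := by
    rw [Algebra.smul_def] at h ⊢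
    have hc : c ≠ 0 := by rintro rfl; simp at h
    have hf0 : f ≠ 0 := right_ne_zero_of_mul h
    rw [C.ord_mul (left_ne_zero_of_mul h) hf0, C.ord_algebraMap hc, zero_add]
    exact hf hf0 x hx

/-- The local ring of `C` at a closed point, as a subspace of the function field. -/
noncomputable def localRing (x : C.PrimeDivisor) : Submodule k C.FunctionField where
  carrier := {f | f ≠ 0 → 0 ≤ C.ord f x}
  zero_mem' h := absurd rfl h
  add_mem' {f g} hf hg h := by
    by_cases hf0 : f = 0
    · subst hf0; rw [zero_add] at h ⊢; exact hg h
    by_cases hg0 : g = 0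
    · subst hg0; rw [add_zero] at h ⊢; exact hf h
    exact (le_min (hf hf0) (hg hg0)).trans (C.ord_add h x)
  smul_mem' c f hf h := by
    rw [Algebra.smul_def] at h ⊢
    have hc : c ≠ 0 := by rintro rfl; simp at h
    have hf0 : f ≠ 0 := right_ne_zero_of_mul h
    rw [C.ord_mul (left_ne_zero_of_mul h) hf0, C.ord_algebraMap hc, zero_add]
    exact hf hf0

/-- The families `(f_x)` of rational functions indexed by the closed points such that `f_x` is regular
at `x` for all but finitely many `x`. -/
noncomputable def adeles : Submodule k (C.PrimeDivisor → C.FunctionField) where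
  carrier := {α | {x | α x ∉ C.localRing x}.Finite}
  zero_mem' := by simp
  add_mem' {α β} hα hβ := (hα.union hβ).subset fun x hx ↦ by
    by_contra hc
    simp only [Set.mem_union, not_or] at hc
    exact hx (add_mem (not_not.mp hc.1) (not_not.mp hc.2))
  smul_mem' c α hα := hα.subset fun x hx hc ↦ hx (Submodule.smul_mem _ c hc)

/-- The cohomology group `H¹(C, 𝒪)`, computed by the flasque resolution
`0 → 𝒪 → K(C) → ⨁ₓ K(C) / 𝒪ₓ → 0`: the cokernel of `K(C) → ⨁ₓ K(C) / 𝒪ₓ`. -/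
abbrev H1 : Type u :=
  C.adeles ⧸ (Submodule.pi Set.univ C.localRing ⊔
    LinearMap.range (LinearMap.pi fun _ : C.PrimeDivisor ↦
      (LinearMap.id : C.FunctionField →ₗ[k] C.FunctionField))).comap C.adeles.subtype

/-- The genus `dim H¹(C, 𝒪)`. -/
noncomputable def genus : ℕ := Module.finrank k C.H1

variable {C}

theorem sections_mono (D : C.Divisor) {U V : C.scheme.Opens} (h : U ≤ V) :
    C.sections D V ≤ C.sections D U :=
  fun _ hf hf0 x hx ↦ hf hf0 x (h hx)

theorem mul_mem_sections {D E : C.Divisor} {U : C.scheme.Opens} {f g : C.FunctionField}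
    (hf : f ∈ C.sections D U) (hg : g ∈ C.sections E U) : f * g ∈ C.sections (D + E) U := by
  intro h x hx
  have hf0 := left_ne_zero_of_mul h
  have hg0 := right_ne_zero_of_mul h
  have h₁ := hf hf0 x hx
  have h₂ := hg hg0 x hx
  rw [C.ord_mul hf0 hg0, Finsupp.add_apply]
  linarith

theorem germ_mem_sections {U : C.scheme.Opens} (hU : genericPoint C.scheme ∈ U) (f : Γ(C.scheme, U)) :
    (C.scheme.presheaf.germ U (genericPoint C.scheme) hU f : C.FunctionField) ∈ C.sections 0 U := by
  intro h x hx
  have : Nonempty U := ⟨⟨_, hU⟩⟩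
  have hf : f ≠ 0 := by rintro rfl; exact h (map_zero _)
  have h₁ := Scheme.ord_le_smul (X := C.scheme) hx hf 1
  have h₂ : Scheme.ord (X := C.scheme) 1 x.1 = 0 := by
    rw [← map_one (C.scheme.presheaf.germ U (genericPoint C.scheme) hU).hom]
    exact Scheme.ord_of_isUnit isUnit_one hx
  rw [h₂, Algebra.smul_def, mul_one] at h₁
  change 0 ≤ C.ord _ x + 0
  rw [add_zero]
  exact h₁

theorem one_mem_sections (U : C.scheme.Opens) : (1 : C.FunctionField) ∈ C.sections 0 U :=
  sections_mono 0 le_top <| by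
    have := germ_mem_sections (C := C) (U := ⊤) trivial 1
    rwa [map_one] at this

variable (C) in
/-- `S ⊗ K(C)`, which contains the sections over `Spec S × U` of the pull-back of each `𝒪(D)`. -/
def RelFunctionField (S : Type u) [CommRing S] [Algebra k S] : Type u :=
  S ⊗[k] C.FunctionField

variable (S : Type u) [CommRing S] [Algebra k S]

noncomputable instance : CommRing (C.RelFunctionField S) :=
  inferInstanceAs (CommRing (S ⊗[k] C.FunctionField))

noncomputable instance : Algebra S (C.RelFunctionField S) :=
  inferInstanceAs (Algebra S (S ⊗[k] C.FunctionField))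

/-- The inclusion of `K(C)` in `S ⊗ K(C)`. -/
noncomputable def relMap : C.FunctionField →+* C.RelFunctionField S :=
  (Algebra.TensorProduct.includeRight : C.FunctionField →ₐ[k] S ⊗[k] C.FunctionField).toRingHom

/-- The sections over `Spec S × U`, for `U` affine, of the pull-back of `𝒪(D)` to `Spec S × C`: the
image of `S ⊗ Γ(U, 𝒪(D))` in `S ⊗ K(C)`. -/
noncomputable def relSections (D : C.Divisor) (U : C.scheme.Opens) :
    Submodule S (C.RelFunctionField S) :=
  Submodule.span S (relMap S '' (C.sections D U : Set C.FunctionField))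

variable {S}

theorem relMap_mem {D : C.Divisor} {U : C.scheme.Opens} {f : C.FunctionField}
    (hf : f ∈ C.sections D U) : relMap S f ∈ relSections S D U :=
  Submodule.subset_span ⟨f, hf, rfl⟩

theorem relSections_mono (D : C.Divisor) {U V : C.scheme.Opens} (h : U ≤ V) :
    relSections S D V ≤ relSections S D U :=
  Submodule.span_mono (Set.image_mono (sections_mono D h))

theorem mul_mem_relSections {D E : C.Divisor} {U : C.scheme.Opens} {f g : C.RelFunctionField S}
    (hf : f ∈ relSections S D U) (hg : g ∈ relSections S E U) :
    f * g ∈ relSections S (D + E) U := by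
  have key : relSections S D U * relSections S E U ≤ relSections S (D + E) U := by
    unfold relSections
    rw [Submodule.span_mul_span, Submodule.span_le]
    rintro _ ⟨_, ⟨a, ha, rfl⟩, _, ⟨b, hb, rfl⟩, rfl⟩
    exact Submodule.subset_span ⟨a * b, mul_mem_sections ha hb, map_mul _ _ _⟩
  exact key (Submodule.mul_mem_mul hf hg)

theorem one_mem_relSections (U : C.scheme.Opens) :
    (1 : C.RelFunctionField S) ∈ relSections S (0 : C.Divisor) U := by
  simpa using relMap_mem (S := S) (one_mem_sections (C := C) U)

variable (S) in
/-- The sections of `π^* 𝒪(mD)` over `Spec S × Tot(𝒪(D))|_U`, for `π` the projection of `Tot(𝒪(D))`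
to `C`. As `π_* π^* 𝒪(mD) = ⨁ₙ 𝒪((m - n)D) tⁿ` with `t` the tautological section of `π^* 𝒪(D)`, they
are the polynomials in `t` whose `n`-th coefficient is a section of `𝒪((m - n)D)`. -/
noncomputable def totSections (D : C.Divisor) (m : ℤ) (U : C.scheme.Opens) :
    Submodule S (C.RelFunctionField S)[X] where
  carrier := {p | ∀ n : ℕ, p.coeff n ∈ relSections S ((m - n) • D) U}
  zero_mem' n := by simp
  add_mem' hp hq n := by rw [coeff_add]; exact add_mem (hp n) (hq n)
  smul_mem' c p hp n := by rw [coeff_smul]; exact Submodule.smul_mem _ c (hp n)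

theorem totSections_mono (D : C.Divisor) (m : ℤ) {U V : C.scheme.Opens} (h : U ≤ V) :
    totSections S D m V ≤ totSections S D m U :=
  fun _ hp n ↦ relSections_mono _ h (hp n)

theorem mul_mem_totSections {D : C.Divisor} {l m : ℤ} {U : C.scheme.Opens}
    {p q : (C.RelFunctionField S)[X]} (hp : p ∈ totSections S D l U)
    (hq : q ∈ totSections S D m U) : p * q ∈ totSections S D (l + m) U := by
  intro n
  rw [coeff_mul]
  refine Submodule.sum_mem _ fun ij h ↦ ?_
  have := mul_mem_relSections (hp ij.1) (hq ij.2)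
  rw [← add_smul] at this
  replace h := Finset.HasAntidiagonal.mem_antidiagonal.mp h
  convert this using 3
  rw [← h]; push_cast; ring

theorem C_mem_totSections {D : C.Divisor} {U : C.scheme.Opens} {f : C.RelFunctionField S}
    (hf : f ∈ relSections S (0 : C.Divisor) U) : Polynomial.C f ∈ totSections S D 0 U := by
  intro n
  rw [coeff_C]
  split_ifs with h
  · subst h; simpa using hf
  · exact zero_mem _

variable (S) in
/-- The ring of functions on `Spec S × Tot(𝒪(D))|_U`. -/
noncomputable def totAlgebra (D : C.Divisor) (U : C.scheme.Opens) :
    Subalgebra S (C.RelFunctionField S)[X] where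
  __ := totSections S D 0 U
  mul_mem' hp hq := by simpa using mul_mem_totSections hp hq
  algebraMap_mem' s := by
    have : (Polynomial.C (s • (1 : C.RelFunctionField S))) ∈ totSections S D 0 U :=
      C_mem_totSections (Submodule.smul_mem _ s (one_mem_relSections U))
    rwa [← Algebra.algebraMap_eq_smul_one] at this

theorem mem_totAlgebra {D : C.Divisor} {U : C.scheme.Opens} {p : (C.RelFunctionField S)[X]} :
    p ∈ totAlgebra S D U ↔ p ∈ totSections S D 0 U := Iff.rfl

theorem totAlgebra_mono (D : C.Divisor) {U V : C.scheme.Opens} (h : V ≤ U) :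
    totAlgebra S D U ≤ totAlgebra S D V :=
  fun _ hp ↦ mem_totAlgebra.mpr (totSections_mono D 0 h (mem_totAlgebra.mp hp))

/-- The Hitchin base `⨁_{i = 1}^r H⁰(C, 𝒪(iD))`. -/
abbrev HitchinBase (D : C.Divisor) (r : ℕ) : Type u :=
  ∀ i : Fin r, C.sections (((i : ℤ) + 1) • D) ⊤

variable {D : C.Divisor} {r : ℕ}

/-- The coefficient `b_{i + 1}`, in `S ⊗ H⁰(C, 𝒪((i + 1)D))`, of an `S`-valued point `b` of the
Hitchin base. -/
noncomputable def charCoeff (b : S ⊗[k] HitchinBase D r) (i : Fin r) : C.RelFunctionField S :=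
  ((C.sections (((i : ℤ) + 1) • D) ⊤).subtype ∘ₗ LinearMap.proj i).baseChange S b

/-- The characteristic polynomial `P_b(t) = t^r + b_1 t^{r - 1} + ⋯ + b_r`, a section of `π^* 𝒪(rD)`. -/
noncomputable def charPoly (b : S ⊗[k] HitchinBase D r) : (C.RelFunctionField S)[X] :=
  X ^ r + ∑ i : Fin r, Polynomial.C (charCoeff b i) * X ^ (r - (i + 1 : ℕ))

theorem charCoeff_mem (b : S ⊗[k] HitchinBase D r) (i : Fin r) (U : C.scheme.Opens) :
    charCoeff b i ∈ relSections S (((i : ℤ) + 1) • D) U := by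
  induction b using TensorProduct.induction_on with
  | zero =>
    have : charCoeff (0 : S ⊗[k] HitchinBase D r) i = 0 := map_zero _
    rw [this]; exact zero_mem _
  | add x y hx hy =>
    have : charCoeff (x + y) i = charCoeff x i + charCoeff y i := map_add _ _ _
    rw [this]; exact add_mem hx hy
  | tmul s f =>
    have : charCoeff (s ⊗ₜ[k] f) i = s • relMap S (f i : C.FunctionField) := by
      change s ⊗ₜ[k] (f i : C.FunctionField) = s • ((1 : S) ⊗ₜ[k] (f i : C.FunctionField))
      rw [TensorProduct.smul_tmul', smul_eq_mul, mul_one]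
    rw [this]
    exact Submodule.smul_mem _ s (relMap_mem (sections_mono _ le_top (f i).2))

theorem C_mul_X_pow_mem_totSections {m : ℤ} {n : ℕ} {U : C.scheme.Opens}
    {f : C.RelFunctionField S} (hf : f ∈ relSections S ((m - n) • D) U) :
    Polynomial.C f * X ^ n ∈ totSections S D m U := by
  intro j
  rw [coeff_C_mul_X_pow]
  split_ifs with h
  · subst h; exact hf
  · exact zero_mem _

theorem charPoly_mem (b : S ⊗[k] HitchinBase D r) (U : C.scheme.Opens) :
    charPoly b ∈ totSections S D r U := by
  refine add_mem ?_ (Submodule.sum_mem _ fun i _ ↦ C_mul_X_pow_mem_totSections ?_)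
  · have : (1 : C.RelFunctionField S) ∈ relSections S (((r : ℤ) - (r : ℕ)) • D) U := by
      simpa using one_mem_relSections (S := S) (C := C) U
    simpa using C_mul_X_pow_mem_totSections this
  · convert charCoeff_mem b i U using 2
    have := i.2
    congr 1
    rw [Nat.cast_sub (by lia)]
    push_cast
    ring

/-- The ideal of functions on `Spec S × Tot(𝒪(D))|_U` vanishing on the spectral curve `P_b = 0`: the
product of `P_b` with the sections of `π^* 𝒪(-rD)`. Over the empty set it is the unit ideal. -/
noncomputable def spectralIdeal (b : S ⊗[k] HitchinBase D r) (U : C.scheme.Opens) :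
    Ideal (totAlgebra S D U) where
  carrier := {p | U ≠ ⊥ → ∃ q ∈ totSections S D (-r) U, (p : _) = charPoly b * q}
  zero_mem' _ := ⟨0, zero_mem _, by simp⟩
  add_mem' hp hp' hU := by
    obtain ⟨q, hq, h⟩ := hp hU
    obtain ⟨q', hq', h'⟩ := hp' hU
    exact ⟨q + q', add_mem hq hq', by rw [Subalgebra.coe_add, h, h', mul_add]⟩
  smul_mem' a p hp hU := by
    obtain ⟨q, hq, h⟩ := hp hU
    refine ⟨a * q, by simpa using mul_mem_totSections a.2 hq, ?_⟩
    rw [smul_eq_mul, Subalgebra.coe_mul, h]; ring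

theorem mem_spectralIdeal (b : S ⊗[k] HitchinBase D r) {U : C.scheme.Opens}
    {p : totAlgebra S D U} : p ∈ spectralIdeal b U ↔ (U ≠ ⊥ →
      ∃ q ∈ totSections S D (-r) U, (p : (C.RelFunctionField S)[X]) = charPoly b * q) := Iff.rfl

/-- The ring of functions on the part of the spectral curve over an affine open `U`. -/
def spectralAlgebra (b : S ⊗[k] HitchinBase D r) (U : C.scheme.Opens) : Type u :=
  totAlgebra S D U ⧸ spectralIdeal b U

noncomputable instance (b : S ⊗[k] HitchinBase D r) (U : C.scheme.Opens) :
    CommRing (spectralAlgebra b U) :=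
  inferInstanceAs (CommRing (totAlgebra S D U ⧸ spectralIdeal b U))

noncomputable instance (b : S ⊗[k] HitchinBase D r) (U : C.scheme.Opens) :
    Algebra S (spectralAlgebra b U) :=
  inferInstanceAs (Algebra S (totAlgebra S D U ⧸ spectralIdeal b U))

/-- The restriction of functions from `Spec S × Tot(𝒪(D))|_U` to the spectral curve. -/
noncomputable def spectralMk (b : S ⊗[k] HitchinBase D r) (U : C.scheme.Opens) :
    totAlgebra S D U →ₐ[S] spectralAlgebra b U :=
  Ideal.Quotient.mkₐ S (spectralIdeal b U)

theorem spectralMk_surjective (b : S ⊗[k] HitchinBase D r) (U : C.scheme.Opens) :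
    Function.Surjective (spectralMk b U) :=
  Ideal.Quotient.mk_surjective

theorem spectralMk_eq_iff (b : S ⊗[k] HitchinBase D r) {U : C.scheme.Opens} (hU : U ≠ ⊥)
    {p p' : totAlgebra S D U} : spectralMk b U p = spectralMk b U p' ↔
      ∃ q ∈ totSections S D (-r) U, ((p - p' : totAlgebra S D U) : _) = charPoly b * q :=
  (Ideal.Quotient.eq.trans (mem_spectralIdeal b)).trans ⟨fun h ↦ h hU, fun h _ ↦ h⟩

theorem genericPoint_mem {U : C.scheme.Opens} (hU : U ≠ ⊥) : genericPoint C.scheme ∈ U := by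
  rw [← SetLike.mem_coe, (genericPoint_spec C.scheme).mem_open_set_iff U.isOpen, Set.univ_inter]
  exact (TopologicalSpace.Opens.ne_bot_iff_nonempty U).mp hU

theorem finite_notMem_basicOpen {U : C.scheme.Opens} (hU : IsAffineOpen U) {f : Γ(C.scheme, U)}
    (hf : f ≠ 0) :
    {x : C.PrimeDivisor | x.1 ∈ U ∧ x.1 ∉ C.scheme.basicOpen f}.Finite := by
  have hne : Nonempty U := by
    by_contra h
    have : U = ⊥ := by
      by_contra h'
      exact h ⟨⟨_, genericPoint_mem h'⟩⟩
    subst this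
    exact hf (Subsingleton.elim _ _)
  have : IsNoetherianRing Γ(C.scheme, U) :=
    IsLocallyNoetherian.component_noetherian ⟨U, hU⟩
  have : IsDomain Γ(C.scheme, U) := inferInstance
  classical
  let φ : C.PrimeDivisor → Ideal Γ(C.scheme, U) := fun x ↦
    if h : x.1 ∈ U then (hU.primeIdealOf ⟨x.1, h⟩).asIdeal else ⊥
  refine Set.Finite.of_finite_image
    ((Ideal.finite_minimalPrimes_of_isNoetherianRing _ (Ideal.span {f})).subset ?_) (f := φ) ?_
  · rintro _ ⟨x, ⟨hx, hxf⟩, rfl⟩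
    simp only [φ, dif_pos hx]
    set p := hU.primeIdealOf ⟨x.1, hx⟩ with hp
    have hfp : f ∈ p.asIdeal := by
      by_contra h
      apply hxf
      have h' : p ∈ PrimeSpectrum.basicOpen f := h
      rw [← hU.fromSpec_preimage_basicOpen] at h'
      have h'' : hU.fromSpec p ∈ C.scheme.basicOpen f := h'
      rwa [hp, hU.fromSpec_primeIdealOf] at h''
    have hheight : p.asIdeal.height = 1 := by
      let _ := TopCat.Presheaf.algebra_section_stalk C.scheme.presheaf (U := U) ⟨x.1, hx⟩
      have := hU.isLocalization_stalk ⟨x.1, hx⟩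
      have h₁ := IsLocalization.AtPrime.ringKrullDim_eq_height p.asIdeal
        (C.scheme.presheaf.stalk x.1)
      have h₂ := ringKrullDim_stalk_eq_coheight x.1
      rw [x.2] at h₂
      rw [h₂] at h₁
      exact_mod_cast h₁.symm
    refine ⟨⟨p.isPrime, by rwa [Ideal.span_singleton_le_iff_mem]⟩, ?_⟩
    rintro q ⟨hq, hfq⟩ hqp
    by_contra hpq
    have hlt : q < p.asIdeal := lt_of_le_not_ge hqp hpq
    have hq0 : ⊥ < q := bot_lt_iff_ne_bot.mpr fun h ↦ hf <| by
      rw [h, Ideal.span_singleton_le_iff_mem] at hfq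
      simpa using hfq
    have h₁ := Ideal.height_add_one_le_of_lt_of_isPrime hlt
    have h₂ := Ideal.height_add_one_le_of_lt_of_isPrime hq0
    rw [hheight] at h₁
    have h₃ : (1 : ℕ∞) + 1 ≤ 1 := by
      refine le_trans ?_ h₁
      gcongr
      exact le_trans (by simp) h₂
    exact absurd h₃ (by decide)
  · rintro x ⟨hx, -⟩ y ⟨hy, -⟩ h
    simp only [φ, dif_pos hx, dif_pos hy] at h
    have h' := PrimeSpectrum.ext h
    have := congrArg hU.fromSpec h'
    rw [hU.fromSpec_primeIdealOf, hU.fromSpec_primeIdealOf] at this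
    exact Subtype.ext this

theorem one_le_ord_germ {U : C.scheme.Opens} (hU : genericPoint C.scheme ∈ U)
    {f : Γ(C.scheme, U)} (hf : f ≠ 0) (x : C.PrimeDivisor) (hx : x.1 ∈ U)
    (hxf : x.1 ∉ C.scheme.basicOpen f) :
    1 ≤ C.ord (C.scheme.presheaf.germ U (genericPoint C.scheme) hU f) x := by
  have : Nonempty U := ⟨⟨_, hU⟩⟩
  have hf0 : C.scheme.germToFunctionField U f ≠ 0 := by
    rw [Ne, map_eq_zero_iff _ (Scheme.germToFunctionField_injective _ U)]
    exact hf
  have h₀ : 0 ≤ C.ord (C.scheme.presheaf.germ U (genericPoint C.scheme) hU f) x := by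
    simpa using germ_mem_sections hU f hf0 x hx
  rcases h₀.lt_or_eq with h | h
  · exact h
  exfalso
  apply hxf
  have : IsDiscreteValuationRing _ := C.isDiscreteValuationRing_stalk x.1 x.2
  have : Ring.KrullDimLE 1 (C.scheme.presheaf.stalk x.1) := krullDimLE_of_coheight_le x.2.le
  rw [Scheme.mem_basicOpen _ _ _ hx]
  have h₁ := (Scheme.ord_eq_iff x.2 hf0).mp h.symm
  rw [← Scheme.algebraMap_germ_eq_germToFunctionField _ hx] at h₁
  exact Ring.isUnit_iff_ordFrac_one_of_isDiscreteValuationRing.mpr h₁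

/-- The germ at the generic point. -/
noncomputable def germHom (U : C.scheme.Opens) (hη : genericPoint C.scheme ∈ U) :
    Γ(C.scheme, U) →+* C.FunctionField :=
  (C.scheme.presheaf.germ U (genericPoint C.scheme) hη).hom

theorem exists_pow_mul_mem_sections (D : C.Divisor) {U : C.scheme.Opens} (hU : IsAffineOpen U)
    (hη : genericPoint C.scheme ∈ U) {f : Γ(C.scheme, U)} (hf : f ≠ 0) {g : C.FunctionField}
    (hg : g ∈ C.sections D (C.scheme.basicOpen f)) :
    ∃ N : ℕ, ∀ n ≥ N,
      germHom U hη f ^ n * g ∈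
        C.sections D U := by
  set φ : C.FunctionField := germHom U hη f with hφ
  have hfin := finite_notMem_basicOpen hU hf
  obtain ⟨N, hN⟩ := (hfin.image fun x ↦ (-(C.ord g x + D x)).toNat).bddAbove
  refine ⟨N, fun n hn h x hx ↦ ?_⟩
  have hg0 := right_ne_zero_of_mul h
  have hφn := left_ne_zero_of_mul h
  have hord : ∀ m : ℕ, φ ^ m ≠ 0 → C.ord (φ ^ m) x = m * C.ord φ x := by
    intro m hm
    induction m with
    | zero =>
      have := C.ord_algebraMap (c := 1) one_ne_zero x
      rw [map_one] at this
      simpa using this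
    | succ m ih =>
      rw [pow_succ] at hm ⊢
      rw [C.ord_mul (left_ne_zero_of_mul hm) (right_ne_zero_of_mul hm),
        ih (left_ne_zero_of_mul hm)]
      push_cast; ring
  rw [C.ord_mul hφn hg0, hord n hφn]
  by_cases hxf : x.1 ∈ C.scheme.basicOpen f
  · have h₁ := hg hg0 x hxf
    by_cases hφ0 : φ = 0
    · rcases n with _ | n
      · simpa using h₁
      · simp [hφ0] at hφn
    have h₂ : 0 ≤ C.ord φ x := by
      have h := germ_mem_sections hη f hφ0 x hx
      rw [Finsupp.coe_zero, Pi.zero_apply, add_zero] at h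
      exact h
    have : 0 ≤ (n : ℤ) * C.ord φ x := by positivity
    linarith
  · have h₁ := hN ⟨x, ⟨hx, hxf⟩, rfl⟩
    have h₂ : 1 ≤ C.ord φ x := one_le_ord_germ hη hf x hx hxf
    have h₃ : (n : ℤ) * 1 ≤ (n : ℤ) * C.ord φ x := by gcongr
    simp only [Int.toNat_le] at h₁
    have : (N : ℤ) ≤ n := by exact_mod_cast hn
    linarith

theorem exists_pow_mul_mem_relSections (D : C.Divisor) {U : C.scheme.Opens} (hU : IsAffineOpen U)
    (hη : genericPoint C.scheme ∈ U) {f : Γ(C.scheme, U)} (hf : f ≠ 0) {g : C.RelFunctionField S}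
    (hg : g ∈ relSections S D (C.scheme.basicOpen f)) :
    ∃ N : ℕ, ∀ n ≥ N,
      relMap S (germHom U hη f) ^ n * g ∈
        relSections S D U := by
  induction hg using Submodule.span_induction with
  | mem g hg =>
    obtain ⟨g, hg, rfl⟩ := hg
    obtain ⟨N, hN⟩ := exists_pow_mul_mem_sections D hU hη hf hg
    refine ⟨N, fun n hn ↦ ?_⟩
    have := relMap_mem (S := S) (hN n hn)
    rwa [map_mul, map_pow] at this
  | zero => exact ⟨0, fun n _ ↦ by simp⟩
  | add x y _ _ hx hy =>
    obtain ⟨N, hN⟩ := hx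
    obtain ⟨M, hM⟩ := hy
    refine ⟨max N M, fun n hn ↦ ?_⟩
    rw [mul_add]
    exact add_mem (hN n (le_of_max_le_left hn)) (hM n (le_of_max_le_right hn))
  | smul s x _ hx =>
    obtain ⟨N, hN⟩ := hx
    refine ⟨N, fun n hn ↦ ?_⟩
    rw [mul_smul_comm]
    exact Submodule.smul_mem _ s (hN n hn)

theorem exists_pow_mul_mem_totSections (D : C.Divisor) (m : ℤ) {U : C.scheme.Opens}
    (hU : IsAffineOpen U) (hη : genericPoint C.scheme ∈ U) {f : Γ(C.scheme, U)} (hf : f ≠ 0)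
    {p : (C.RelFunctionField S)[X]} (hp : p ∈ totSections S D m (C.scheme.basicOpen f)) :
    ∃ N : ℕ, ∀ n ≥ N,
      Polynomial.C (relMap S (germHom U hη f)) ^ n * p ∈
        totSections S D m U := by
  choose N hN using fun j ↦ exists_pow_mul_mem_relSections _ hU hη hf (hp j)
  refine ⟨p.support.sup N, fun n hn j ↦ ?_⟩
  rw [← Polynomial.C_pow, coeff_C_mul]
  by_cases hj : j ∈ p.support
  · exact hN j n ((Finset.le_sup hj).trans hn)
  · rw [notMem_support_iff.mp hj, mul_zero]; exact zero_mem _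

/-- The pull-back of functions on `U` to `Spec S × Tot(𝒪(D))|_U`. -/
noncomputable def totFunctions (S : Type u) [CommRing S] [Algebra k S] (D : C.Divisor)
    (U : C.scheme.Opens) (hη : genericPoint C.scheme ∈ U) :
    Γ(C.scheme, U) →+* totAlgebra S D U :=
  (Polynomial.C.comp ((relMap S).comp (germHom U hη))).codRestrict (totAlgebra S D U)
    fun f ↦ mem_totAlgebra.mpr (C_mem_totSections (relMap_mem (germ_mem_sections hη f)))

theorem coe_totFunctions (U : C.scheme.Opens) (hη : genericPoint C.scheme ∈ U)
    (f : Γ(C.scheme, U)) :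
    (totFunctions S D U hη f : (C.RelFunctionField S)[X]) =
      Polynomial.C (relMap S (germHom U hη f)) := rfl

theorem subsingleton_spectralAlgebra (b : S ⊗[k] HitchinBase D r) :
    Subsingleton (spectralAlgebra b ⊥) :=
  Ideal.Quotient.subsingleton_iff.mpr <| (Ideal.eq_top_iff_one _).mpr fun h ↦ absurd rfl h

open scoped Classical in
/-- The pull-back of functions on `U` to the spectral curve. -/
noncomputable def spectralStructureMap (b : S ⊗[k] HitchinBase D r) (U : C.scheme.Opens) :
    Γ(C.scheme, U) →+* spectralAlgebra b U :=
  if hU : U = ⊥ then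
    have : Subsingleton (spectralAlgebra b U) := hU ▸ subsingleton_spectralAlgebra b
    { toFun := fun _ ↦ 0
      map_one' := Subsingleton.elim _ _
      map_mul' := fun _ _ ↦ Subsingleton.elim _ _
      map_zero' := rfl
      map_add' := fun _ _ ↦ Subsingleton.elim _ _ }
  else (spectralMk b U).toRingHom.comp (totFunctions S D U (genericPoint_mem hU))

theorem spectralStructureMap_apply (b : S ⊗[k] HitchinBase D r) {U : C.scheme.Opens}
    (hU : U ≠ ⊥) (f : Γ(C.scheme, U)) :
    spectralStructureMap b U f = spectralMk b U (totFunctions S D U (genericPoint_mem hU) f) := by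
  rw [spectralStructureMap, dif_neg hU, RingHom.comp_apply]
  rfl

/-- The restriction of functions from `Tot(𝒪(D))|_U` to `Tot(𝒪(D))|_V`. -/
noncomputable def totRestrict (S : Type u) [CommRing S] [Algebra k S] (D : C.Divisor)
    {U V : C.scheme.Opens} (h : V ≤ U) : totAlgebra S D U →ₐ[S] totAlgebra S D V :=
  Subalgebra.inclusion (totAlgebra_mono D h)

theorem coe_totRestrict {U V : C.scheme.Opens} (h : V ≤ U) (p : totAlgebra S D U) :
    (totRestrict S D h p : (C.RelFunctionField S)[X]) = p :=
  Subalgebra.coe_inclusion (totAlgebra_mono D h) p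

/-- The restriction of functions on the spectral curve from `U` to `V`. -/
noncomputable def spectralRestrict (b : S ⊗[k] HitchinBase D r) {U V : C.scheme.Opens}
    (h : V ≤ U) : spectralAlgebra b U →ₐ[S] spectralAlgebra b V :=
  Ideal.quotientMapₐ (spectralIdeal b V) (totRestrict S D h) fun p hp ↦
    Ideal.mem_comap.mpr <| (mem_spectralIdeal b).mpr fun hV ↦ by
      obtain ⟨q, hq, e⟩ := (mem_spectralIdeal b).mp hp (ne_bot_of_le_ne_bot hV h)
      exact ⟨q, totSections_mono D _ h hq, (coe_totRestrict h p).trans e⟩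

theorem spectralRestrict_mk (b : S ⊗[k] HitchinBase D r) {U V : C.scheme.Opens}
    (h : V ≤ U) (p : totAlgebra S D U) :
    spectralRestrict b h (spectralMk b U p) = spectralMk b V (totRestrict S D h p) :=
  Ideal.quotient_map_mkₐ (spectralIdeal b V) (totRestrict S D h) _

theorem spectralRestrict_self (b : S ⊗[k] HitchinBase D r) {U : C.scheme.Opens}
    (h : U ≤ U) (z : spectralAlgebra b U) : spectralRestrict b h z = z := by
  obtain ⟨p, rfl⟩ := spectralMk_surjective b U z
  rw [spectralRestrict_mk]
  exact congrArg _ (Subtype.ext (coe_totRestrict h p))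

theorem spectralRestrict_spectralRestrict (b : S ⊗[k] HitchinBase D r) {U V W : C.scheme.Opens}
    (h : V ≤ U) (h' : W ≤ V) (h'' : W ≤ U) (z : spectralAlgebra b U) :
    spectralRestrict b h'' z = spectralRestrict b h' (spectralRestrict b h z) := by
  obtain ⟨p, rfl⟩ := spectralMk_surjective b U z
  rw [spectralRestrict_mk, spectralRestrict_mk, spectralRestrict_mk]
  refine congrArg _ (Subtype.ext ?_)
  rw [coe_totRestrict, coe_totRestrict, coe_totRestrict]

/-- The quasi-coherent algebra of functions on the spectral curve, on the affine opens of `C`. -/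
noncomputable def spectralPresheaf (b : S ⊗[k] HitchinBase D r) :
    C.scheme.AffineZariskiSiteᵒᵖ ⥤ CommRingCat.{u} where
  obj U := .of (spectralAlgebra b U.unop.toOpens)
  map i := CommRingCat.ofHom
    (spectralRestrict b (Scheme.AffineZariskiSite.toOpens_mono i.unop.le)).toRingHom
  map_id _ := CommRingCat.hom_ext <| RingHom.ext fun z ↦ spectralRestrict_self b _ z
  map_comp _ _ := CommRingCat.hom_ext <| RingHom.ext fun z ↦
    spectralRestrict_spectralRestrict b _ _ _ z

theorem spectralRestrict_structureMap (b : S ⊗[k] HitchinBase D r) {U V : C.scheme.Opens}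
    (h : V ≤ U) (f : Γ(C.scheme, U)) :
    spectralRestrict b h (spectralStructureMap b U f) =
      spectralStructureMap b V (C.scheme.presheaf.map (homOfLE h).op f) := by
  by_cases hV : V = ⊥
  · subst hV
    exact (subsingleton_spectralAlgebra b).elim _ _
  have hU : U ≠ ⊥ := ne_bot_of_le_ne_bot hV h
  rw [spectralStructureMap_apply b hU, spectralStructureMap_apply b hV, spectralRestrict_mk]
  congr 1
  refine Subtype.ext ?_
  rw [coe_totRestrict, coe_totFunctions, coe_totFunctions]
  congr 2
  exact (C.scheme.presheaf.germ_res_apply (homOfLE h) _ (genericPoint_mem hV) f).symm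

/-- The structure of `𝒪_C`-algebra on the functions on the spectral curve. -/
noncomputable def spectralStructure (b : S ⊗[k] HitchinBase D r) :
    (Scheme.AffineZariskiSite.toOpensFunctor C.scheme).op ⋙ C.scheme.presheaf ⟶
      spectralPresheaf b where
  app U := CommRingCat.ofHom (spectralStructureMap b U.unop.toOpens)
  naturality _ _ _ := CommRingCat.hom_ext <| RingHom.ext fun f ↦
    (spectralRestrict_structureMap b _ f).symm

theorem isLocalization_spectralRestrict (b : S ⊗[k] HitchinBase D r) {U : C.scheme.Opens}
    (hU : IsAffineOpen U) (f : Γ(C.scheme, U)) :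
    letI := (spectralRestrict b (C.scheme.basicOpen_le f)).toRingHom.toAlgebra
    IsLocalization.Away (spectralStructureMap b U f)
      (spectralAlgebra b (C.scheme.basicOpen f)) := by
  set V := C.scheme.basicOpen f with hV
  have hVU : V ≤ U := C.scheme.basicOpen_le f
  let _ : Algebra (spectralAlgebra b U) (spectralAlgebra b V) :=
    (spectralRestrict b hVU).toRingHom.toAlgebra
  have hmap : ∀ z, algebraMap (spectralAlgebra b U) (spectralAlgebra b V) z =
    spectralRestrict b hVU z := fun _ ↦ rfl
  by_cases hU0 : U = ⊥
  · have hV0 : V = ⊥ := eq_bot_iff.mpr (hU0 ▸ hVU)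
    have : Subsingleton (spectralAlgebra b U) := hU0 ▸ subsingleton_spectralAlgebra b
    have : Subsingleton (spectralAlgebra b V) := hV0 ▸ subsingleton_spectralAlgebra b
    exact ⟨⟨fun _ ↦ isUnit_of_subsingleton _, fun z ↦ ⟨(0, 1), Subsingleton.elim _ _⟩,
      fun _ ↦ ⟨1, Subsingleton.elim _ _⟩⟩⟩
  have hη := genericPoint_mem hU0
  by_cases hf : f = 0
  · have hV0 : V = ⊥ := by simp [V, hf]
    have : Subsingleton (spectralAlgebra b V) := hV0 ▸ subsingleton_spectralAlgebra b
    exact ⟨⟨fun _ ↦ isUnit_of_subsingleton _, fun z ↦ ⟨(0, 1), Subsingleton.elim _ _⟩,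
      fun _ ↦ ⟨⟨spectralStructureMap b U f, Submonoid.mem_powers _⟩, by simp [hf]⟩⟩⟩
  have hV0 : V ≠ ⊥ := by
    have : Nonempty U := ⟨⟨_, hη⟩⟩
    rwa [hV, Ne, basicOpen_eq_bot_iff]
  have hstr := spectralStructureMap_apply b hU0 f
  refine ⟨⟨?_, ?_, fun {x y} hxy ↦ ?_⟩⟩
  · rintro ⟨_, n, rfl⟩
    rw [hmap, map_pow, spectralRestrict_structureMap]
    exact ((RingedSpace.isUnit_res_basicOpen C.scheme.toRingedSpace f).map
      (spectralStructureMap b V)).pow n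
  · intro z
    obtain ⟨p, rfl⟩ := spectralMk_surjective b V z
    obtain ⟨N, hN⟩ := exists_pow_mul_mem_totSections D 0 hU hη hf p.2
    refine ⟨(spectralMk b U ⟨_, hN N le_rfl⟩, ⟨spectralStructureMap b U f ^ N, N, rfl⟩), ?_⟩
    rw [hmap, hmap, map_pow, hstr, spectralRestrict_mk, spectralRestrict_mk, ← map_pow, ← map_mul]
    congr 1
    refine Subtype.ext ?_
    rw [Subalgebra.coe_mul, Subalgebra.coe_pow, coe_totRestrict, coe_totRestrict,
      coe_totFunctions, mul_comm]
  · obtain ⟨p, rfl⟩ := spectralMk_surjective b U x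
    obtain ⟨p', rfl⟩ := spectralMk_surjective b U y
    rw [hmap, hmap, spectralRestrict_mk, spectralRestrict_mk, spectralMk_eq_iff b hV0] at hxy
    obtain ⟨q, hq, h⟩ := hxy
    obtain ⟨N, hN⟩ := exists_pow_mul_mem_totSections D (-r) hU hη hf hq
    refine ⟨⟨spectralStructureMap b U f ^ N, N, rfl⟩, ?_⟩
    change spectralStructureMap b U f ^ N * _ = spectralStructureMap b U f ^ N * _
    rw [hstr, ← map_pow, ← map_mul, ← map_mul, spectralMk_eq_iff b hU0]
    refine ⟨_, hN N le_rfl, ?_⟩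
    rw [← mul_sub, Subalgebra.coe_mul, Subalgebra.coe_pow, coe_totFunctions, mul_left_comm, ← h]
    rfl

theorem spectralStructure_coequifibered (b : S ⊗[k] HitchinBase D r) :
    (spectralStructure b).Coequifibered := by
  rw [Scheme.AffineZariskiSite.coequifibered_iff_forall_isLocalizationAway]
  rintro ⟨U, hU⟩ f
  exact isLocalization_spectralRestrict b hU f

/-- The affine pieces of the spectral curve, with their gluing. -/
noncomputable def spectralGluing (b : S ⊗[k] HitchinBase D r) :
    (Scheme.AffineZariskiSite.directedCover C.scheme).RelativeGluingData :=
  Scheme.AffineZariskiSite.relativeGluingData (spectralStructure_coequifibered b)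

/-- The spectral curve of an `S`-valued point `b` of the Hitchin base: the closed subscheme `P_b = 0`
of `Spec S × Tot(𝒪(D))`, glued from the spectra of its rings of functions over the affine opens of
`C`. -/
noncomputable def spectralCurve (b : S ⊗[k] HitchinBase D r) : Scheme.{u} :=
  (spectralGluing b).glued

/-- The projection of a spectral curve to `C`. -/
noncomputable def spectralCurveToCurve (b : S ⊗[k] HitchinBase D r) :
    spectralCurve b ⟶ C.scheme :=
  (spectralGluing b).toBase

theorem algebraMap_comp_spectralPresheaf_map (b : S ⊗[k] HitchinBase D r)
    {U V : C.scheme.AffineZariskiSite} (i : U ⟶ V) :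
    CommRingCat.ofHom (algebraMap S (spectralAlgebra b V.toOpens)) ≫
      (spectralPresheaf b).map i.op =
    CommRingCat.ofHom (algebraMap S (spectralAlgebra b U.toOpens)) :=
  CommRingCat.hom_ext (RingHom.ext fun s ↦ (spectralRestrict b _).commutes s)

/-- The projections to `Spec S` of the affine pieces of a spectral curve. -/
noncomputable def spectralCocone (b : S ⊗[k] HitchinBase D r) :
    Cocone (spectralGluing b).functor where
  pt := Spec (.of S)
  ι :=
    { app := fun U ↦ Spec.map (CommRingCat.ofHom
        (algebraMap S (spectralAlgebra b (Scheme.AffineZariskiSite.toOpens U))))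
      naturality := fun _ _ i ↦
        (Spec.map_comp _ _).symm.trans ((congrArg Spec.map
          (algebraMap_comp_spectralPresheaf_map b i)).trans (Category.comp_id _).symm) }

/-- The projection of a spectral curve to `Spec S`. -/
noncomputable def spectralCurveToBase (b : S ⊗[k] HitchinBase D r) :
    spectralCurve b ⟶ Spec (.of S) :=
  descGlued (spectralGluing b) (spectralCocone b)

/-- A basis `e` of the Hitchin base identifies it, as a variety, with `Spec k[X_1, …, X_N]`; this is
its universal point `∑ X_j e_j`. -/
noncomputable def universalPoint {N : ℕ} (e : Module.Basis (Fin N) k (HitchinBase D r)) :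
    MvPolynomial (Fin N) k ⊗[k] HitchinBase D r :=
  ∑ j, MvPolynomial.X j ⊗ₜ[k] e j

/-- The universal spectral curve over the Hitchin base. -/
noncomputable def universalSpectralCurve {N : ℕ}
    (e : Module.Basis (Fin N) k (HitchinBase D r)) :
    spectralCurve (universalPoint e) ⟶ Spec (.of (MvPolynomial (Fin N) k)) :=
  spectralCurveToBase (universalPoint e)

/-- The points of the Hitchin base over which the fibre of the universal spectral curve is
non-reduced, as a geometric fibre. -/
def nonReducedLocus {N : ℕ} (e : Module.Basis (Fin N) k (HitchinBase D r)) :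
    Set (Spec (.of (MvPolynomial (Fin N) k)) : Scheme.{u}) :=
  {s | ¬ GeometricallyReduced ((universalSpectralCurve e).fiberToSpecResidueField s)}

end SmoothProjectiveCurve

/-- The codimension of a subset of a scheme: the smallest codimension of one of its points (the
codimension of a point is the Krull dimension of its local ring); `⊤` for the empty set. -/
noncomputable def schemeCodimension {X : Scheme.{u}} (V : Set X) : ℕ∞ :=
  ⨅ x ∈ V, Order.coheight x

/-!
A characteristic polynomial `P` of degree `r` over an extension `F` of `k` defines a non-reduced
spectral curve if and only if `P = Q²R` with `Q` of positive degree `m` and `Q`, `R` again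
characteristic polynomials. The non-reduced locus is therefore the union, over `1 ≤ m ≤ r / 2`, of
the images of the morphisms `(Q, R) ↦ Q²R` from the product of the Hitchin bases of ranks `m` and
`r - 2m` (`exists_nonReducedLocus_eq`).

These morphisms are integral, so that their images are closed: the coefficients of a monic factor
are integral over those of the product, and integral closure commutes with the base change to
`K(C)`, the function field being a localization of a smooth algebra (`isIntegral_of_charCoeff`).
Their images have codimension at least two by a dimension count. With `h(i) = dim H⁰(C, 𝒪(iD))`,
Riemann's inequality gives `h(1) ≥ 1` and `h(2) ≥ 2`, so that `h` is nondecreasing and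
`∑_{i ≤ m} h(i) + ∑_{i ≤ r - 2m} h(i) + 2 ≤ ∑_{i ≤ r} h(i)`
(`finrank_hitchinBase_add_two_le`); and the kernel of a homomorphism of polynomial rings
`k[X_1, …, X_N] → k[Y_1, …, Y_M]` with `M + 2 ≤ N` has height at least two, since the polynomial ring is factorial (`MvPolynomial.two_le_height_ker`).

If the spectral curve is not reduced, `P` is not squarefree over the fraction field of `F ⊗ K(C)`,
which gives the factorization `P = Q²R` there. Gauss's lemma over the rings `F ⊗ 𝒪_{C, x}`, which are
integrally closed because `C` is smooth and geometrically integral, shows that `Q` and `R` have no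
more poles than allowed (`mem_totSections_of_dvd`). Conversely `QR` is a nilpotent function on the
spectral curve, wherever `D` is trivial (`not_isReduced_spectralAlgebra`). To pass from the
universal spectral curve to its geometric fibres, one divides by the monic polynomial `P`: the
functions on the spectral curve over an affine open set are uniquely polynomials of degree less than
`r` in `t`, so that their formation commutes with base change (`exists_ringEquiv_spectralAlgebra`).

Riemann's inequality is obtained from the adeles. The function field is finite over `k(t)` for a
coordinate `t`, strong approximation away from the poles of `t` shows that `H¹(C, 𝒪(E))` vanishes
for some `E` (`exists_forall_sub_mem`), and adding a point to a divisor changes the Euler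
characteristic by the degree of the point (`cohomology_add_single`). The finiteness of `H⁰(C, 𝒪)` is
that of the proper direct image of the structure sheaf.
-/

/-! ### Orders of vanishing -/

namespace SmoothProjectiveCurve

section Orders

variable {k : Type u} [Field k] {C : SmoothProjectiveCurve k}

noncomputable instance (x : C.scheme) : Algebra (C.scheme.presheaf.stalk x) C.FunctionField :=
  inferInstanceAs (Algebra (C.scheme.presheaf.stalk x) C.scheme.functionField)

instance (x : C.scheme) : IsFractionRing (C.scheme.presheaf.stalk x) C.FunctionField :=
  inferInstanceAs (IsFractionRing (C.scheme.presheaf.stalk x) C.scheme.functionField)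

instance (x : C.PrimeDivisor) : IsDiscreteValuationRing (C.scheme.presheaf.stalk x.1) :=
  C.isDiscreteValuationRing_stalk x.1 x.2

theorem ord_eq_iff_ordFrac (x : C.PrimeDivisor) {f : C.FunctionField} (hf : f ≠ 0) (n : ℤ) :
    C.ord f x = n ↔
      Ring.ordFrac (C.scheme.presheaf.stalk x.1) f =
        ((Multiplicative.ofAdd n : Multiplicative ℤ) : WithZero (Multiplicative ℤ)) :=
  Scheme.ord_eq_iff (X := C.scheme) x.2 hf

theorem le_ord_iff_ordFrac (x : C.PrimeDivisor) {f : C.FunctionField} (hf : f ≠ 0) (n : ℤ) :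
    n ≤ C.ord f x ↔
      ((Multiplicative.ofAdd n : Multiplicative ℤ) : WithZero (Multiplicative ℤ)) ≤
        Ring.ordFrac (C.scheme.presheaf.stalk x.1) f :=
  Scheme.le_ord_iff (X := C.scheme) x.2 hf

theorem ord_one (x : C.PrimeDivisor) : C.ord (1 : C.FunctionField) x = 0 := by
  simpa using C.ord_algebraMap (one_ne_zero (α := k)) x

theorem ord_inv {f : C.FunctionField} (hf : f ≠ 0) (x : C.PrimeDivisor) :
    C.ord f⁻¹ x = - C.ord f x := by
  have h := C.ord_mul hf (inv_ne_zero hf) x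
  rw [mul_inv_cancel₀ hf, ord_one] at h
  linarith

theorem ord_pow {f : C.FunctionField} (hf : f ≠ 0) (n : ℕ) (x : C.PrimeDivisor) :
    C.ord (f ^ n) x = n * C.ord f x := by
  induction n with
  | zero => simp [ord_one]
  | succ n ih => rw [pow_succ, C.ord_mul (pow_ne_zero n hf) hf, ih]; push_cast; ring

theorem ord_zpow {f : C.FunctionField} (hf : f ≠ 0) (n : ℤ) (x : C.PrimeDivisor) :
    C.ord (f ^ n) x = n * C.ord f x := by
  obtain ⟨m, rfl | rfl⟩ := n.eq_nat_or_neg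
  · rw [zpow_natCast, ord_pow hf]
  · rw [zpow_neg, ord_inv (zpow_ne_zero _ hf), zpow_natCast, ord_pow hf]; ring

variable (C) in
/-- The functions vanishing to order at least `n` at `x`, that is `𝔪_x ^ n`; they include `0`, whose
`ord` has a junk value. -/
noncomputable def vanishing (x : C.PrimeDivisor) (n : ℤ) : Submodule k C.FunctionField where
  carrier := {f | f ≠ 0 → n ≤ C.ord f x}
  zero_mem' h := absurd rfl h
  add_mem' {f g} hf hg h := by
    by_cases hf0 : f = 0
    · subst hf0; rw [zero_add] at h ⊢; exact hg h
    by_cases hg0 : g = 0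
    · subst hg0; rw [add_zero] at h ⊢; exact hf h
    exact (le_min (hf hf0) (hg hg0)).trans (C.ord_add h x)
  smul_mem' c f hf h := by
    rw [Algebra.smul_def] at h ⊢
    have hc : c ≠ 0 := by rintro rfl; simp at h
    have hf0 : f ≠ 0 := right_ne_zero_of_mul h
    rw [C.ord_mul (left_ne_zero_of_mul h) hf0, C.ord_algebraMap hc, zero_add]
    exact hf hf0

theorem mem_vanishing {x : C.PrimeDivisor} {n : ℤ} {f : C.FunctionField} :
    f ∈ C.vanishing x n ↔ (f ≠ 0 → n ≤ C.ord f x) := Iff.rfl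

theorem mem_vanishing_ord (x : C.PrimeDivisor) (f : C.FunctionField) :
    f ∈ C.vanishing x (C.ord f x) := fun _ ↦ le_rfl

theorem mem_sections_iff {D : C.Divisor} {U : C.scheme.Opens} {f : C.FunctionField} :
    f ∈ C.sections D U ↔ ∀ x : C.PrimeDivisor, x.1 ∈ U → f ∈ C.vanishing x (-D x) :=
  ⟨fun h x hx hf ↦ by linarith [h hf x hx], fun h hf x hx ↦ by linarith [h x hx hf]⟩

theorem vanishing_anti (x : C.PrimeDivisor) {m n : ℤ} (h : m ≤ n) :
    C.vanishing x n ≤ C.vanishing x m := fun _ hf hf0 ↦ h.trans (hf hf0)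

theorem mul_mem_vanishing {x : C.PrimeDivisor} {m n : ℤ} {f g : C.FunctionField}
    (hf : f ∈ C.vanishing x m) (hg : g ∈ C.vanishing x n) : f * g ∈ C.vanishing x (m + n) := by
  intro h
  rw [C.ord_mul (left_ne_zero_of_mul h) (right_ne_zero_of_mul h)]
  exact add_le_add (hf (left_ne_zero_of_mul h)) (hg (right_ne_zero_of_mul h))

theorem pow_mem_vanishing {x : C.PrimeDivisor} {m : ℤ} {f : C.FunctionField}
    (hf : f ∈ C.vanishing x m) (n : ℕ) : f ^ n ∈ C.vanishing x (n * m) := by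
  intro h
  rcases eq_or_ne n 0 with rfl | hn
  · simp [ord_one]
  have hf0 : f ≠ 0 := by rintro rfl; simp [hn] at h
  rw [ord_pow hf0]
  exact mul_le_mul_of_nonneg_left (hf hf0) (by positivity)

theorem pow_mem_vanishing_zero {x : C.PrimeDivisor} {f : C.FunctionField}
    (hf : f ∈ C.vanishing x 0) (n : ℕ) : f ^ n ∈ C.vanishing x 0 := by
  simpa using pow_mem_vanishing hf n

theorem mul_mem_vanishing_iff {x : C.PrimeDivisor} {n : ℤ} {f g : C.FunctionField} (hf : f ≠ 0) :
    f * g ∈ C.vanishing x n ↔ g ∈ C.vanishing x (n - C.ord f x) := by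
  constructor
  · intro h hg
    have := h (mul_ne_zero hf hg)
    rw [C.ord_mul hf hg] at this
    linarith
  · intro h
    simpa using mul_mem_vanishing (mem_vanishing_ord x f) h

/-- The order of a sum is that of a term whose order is strictly smallest. -/
theorem ord_add_eq {x : C.PrimeDivisor} {f g : C.FunctionField} (hf : f ≠ 0)
    (hg : g ∈ C.vanishing x (C.ord f x + 1)) : f + g ≠ 0 ∧ C.ord (f + g) x = C.ord f x := by
  have h : f + g ≠ 0 := fun h ↦ by
    have := neg_mem hg
    rw [neg_eq_of_add_eq_zero_left h] at this
    linarith [this hf]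
  refine ⟨h, le_antisymm ?_ ?_⟩
  · by_contra! hlt
    have h₁ : f + g ∈ C.vanishing x (C.ord f x + 1) := fun _ ↦ hlt
    have := sub_mem h₁ hg
    rw [add_sub_cancel_right] at this
    linarith [this hf]
  · exact add_mem (mem_vanishing_ord x f) (vanishing_anti x (by linarith) hg) h

/-- The functions without a pole at `x` are the elements of the local ring of `x`. -/
theorem mem_vanishing_zero_iff {x : C.PrimeDivisor} {f : C.FunctionField} :
    f ∈ C.vanishing x 0 ↔
      f ∈ Set.range (algebraMap (C.scheme.presheaf.stalk x.1) C.FunctionField) := by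
  by_cases hf : f = 0
  · subst hf; exact ⟨fun _ ↦ ⟨0, map_zero _⟩, fun _ ↦ zero_mem _⟩
  constructor
  · intro h
    rcases ValuationRing.isInteger_or_isInteger (C.scheme.presheaf.stalk x.1) f with h₁ | ⟨b, hb⟩
    · exact h₁
    have hb0 : b ≠ 0 := by rintro rfl; simp at hb; exact hf hb.symm
    have h₂ : C.ord f⁻¹ x = 0 := by
      refine le_antisymm (by rw [ord_inv hf]; linarith [h hf]) ?_
      rw [le_ord_iff_ordFrac x (inv_ne_zero hf), ← hb]
      exact Ring.ordFrac_ge_one_of_ne_zero hb0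
    have h₃ := (ord_eq_iff_ordFrac x (inv_ne_zero hf) 0).mp h₂
    rw [← hb] at h₃
    obtain ⟨u, rfl⟩ := Ring.isUnit_iff_ordFrac_one_of_isDiscreteValuationRing.mpr h₃
    refine ⟨(u⁻¹ : (C.scheme.presheaf.stalk x.1)ˣ), ?_⟩
    rw [← inv_inv f, ← hb]
    exact eq_inv_of_mul_eq_one_left (by rw [← map_mul, Units.inv_mul, map_one])
  · rintro ⟨a, rfl⟩ _
    rw [le_ord_iff_ordFrac x hf]
    exact Ring.ordFrac_ge_one_of_ne_zero (by rintro rfl; simp at hf)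

theorem algebraMap_mem_vanishing_one_iff {x : C.PrimeDivisor} {a : C.scheme.presheaf.stalk x.1} :
    algebraMap _ C.FunctionField a ∈ C.vanishing x 1 ↔
      a ∈ IsLocalRing.maximalIdeal (C.scheme.presheaf.stalk x.1) := by
  by_cases ha : a = 0
  · subst ha; simp
  have ha' : algebraMap _ C.FunctionField a ≠ 0 := by simpa using ha
  rw [IsLocalRing.mem_maximalIdeal, mem_nonunits_iff,
    Ring.isUnit_iff_ordFrac_one_of_isDiscreteValuationRing (K := C.FunctionField)]
  have h₁ : 0 ≤ C.ord (algebraMap _ C.FunctionField a) x := mem_vanishing_zero_iff.mpr ⟨a, rfl⟩ ha'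
  have h₂ := ord_eq_iff_ordFrac x ha' 0
  have h₃ : ((Multiplicative.ofAdd (0 : ℤ) : Multiplicative ℤ) :
      WithZero (Multiplicative ℤ)) = 1 := rfl
  rw [h₃] at h₂
  rw [← h₂, mem_vanishing]
  exact ⟨fun h ↦ by linarith [h ha'], fun h _ ↦ by lia⟩

theorem exists_ord_eq (x : C.PrimeDivisor) (n : ℤ) :
    ∃ f : C.FunctionField, f ≠ 0 ∧ C.ord f x = n := by
  obtain ⟨ϖ, hϖ⟩ := IsDiscreteValuationRing.exists_irreducible (C.scheme.presheaf.stalk x.1)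
  have h0 : algebraMap _ C.FunctionField ϖ ≠ 0 := by simpa using hϖ.ne_zero
  have h₁ : C.ord (algebraMap _ C.FunctionField ϖ) x = 1 :=
    (ord_eq_iff_ordFrac x h0 1).mpr (Ring.ordFrac_irreducible hϖ)
  exact ⟨_, zpow_ne_zero n h0, by rw [ord_zpow h0, h₁, mul_one]⟩

end Orders

end SmoothProjectiveCurve

/-! ### Local structure of the curve -/

namespace SmoothProjectiveCurve

section LocalStructure

variable {k : Type u} [Field k] {C : SmoothProjectiveCurve k}

/-- The structure of `k`-algebra on the functions on an open subset. -/
noncomputable instance (U : C.scheme.Opens) : Algebra k Γ(C.scheme, U) :=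
  ((C.π.appLE ⊤ U le_top).hom.comp (Scheme.ΓSpecIso (.of k)).inv.hom).toAlgebra

/-- The structure of `k`-algebra on a local ring of the curve. -/
noncomputable instance (x : C.scheme) : Algebra k (C.scheme.presheaf.stalk x) :=
  ((C.scheme.presheaf.germ ⊤ x trivial).hom.comp
    (algebraMap k Γ(C.scheme, ⊤))).toAlgebra

theorem algebraMap_sections (U : C.scheme.Opens) : algebraMap k Γ(C.scheme, U) =
    (C.π.appLE ⊤ U le_top).hom.comp (Scheme.ΓSpecIso (.of k)).inv.hom := rfl

theorem algebraMap_sections_eq_map {U V : C.scheme.Opens} (h : V ≤ U) :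
    algebraMap k Γ(C.scheme, V) = (C.scheme.presheaf.map (homOfLE h).op).hom.comp
      (algebraMap k Γ(C.scheme, U)) := by
  rw [algebraMap_sections, algebraMap_sections, ← RingHom.comp_assoc]
  congr 1
  exact congrArg CommRingCat.Hom.hom
    (Scheme.Hom.appLE_map (f := C.π) (U := ⊤) (V := U) le_top (homOfLE h).op).symm

theorem germ_algebraMap {U : C.scheme.Opens} (x : C.scheme) (hx : x ∈ U) (c : k) :
    C.scheme.presheaf.germ U x hx (algebraMap k Γ(C.scheme, U) c) =
      algebraMap k (C.scheme.presheaf.stalk x) c := by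
  rw [algebraMap_sections_eq_map (le_top : U ≤ ⊤)]
  exact C.scheme.presheaf.germ_res_apply (homOfLE le_top) x hx _

theorem algebraMap_functionField :
    algebraMap k C.FunctionField =
      (C.scheme.presheaf.germ ⊤ (genericPoint C.scheme) trivial).hom.comp
        (algebraMap k Γ(C.scheme, ⊤)) := by
  have : C.π.appLE ⊤ ⊤ le_top = C.π.appTop := C.π.appLE_eq_app
  rw [algebraMap_sections, this]
  rfl

instance (x : C.scheme) : IsScalarTower k (C.scheme.presheaf.stalk x) C.FunctionField := by
  refine .of_algebraMap_eq' ?_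
  rw [algebraMap_functionField]
  ext c
  have : Nonempty (⊤ : C.scheme.Opens) := ⟨⟨x, trivial⟩⟩
  exact (Scheme.algebraMap_germ_eq_germToFunctionField (X := C.scheme) (U := ⊤) (x := x)
    trivial _).symm

instance : CompactSpace C.scheme :=
  (quasiCompact_iff_compactSpace (Y := Spec (.of k)) C.π).mp inferInstance

/-- Every point of the curve has an affine neighbourhood whose ring of functions is standard smooth
of relative dimension one over `k`. -/
theorem exists_isStandardSmooth (x : C.scheme) : ∃ V : C.scheme.Opens, IsAffineOpen V ∧ x ∈ V ∧
    Algebra.IsStandardSmoothOfRelativeDimension 1 k Γ(C.scheme, V) := by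
  obtain ⟨U, hU, V, hV, hxV, e, h⟩ :=
    SmoothOfRelativeDimension.exists_isStandardSmoothOfRelativeDimension (n := 1) (f := C.π) x
  obtain rfl : U = ⊤ := by
    rw [eq_top_iff]
    intro y _
    rw [Subsingleton.elim y (C.π x)]
    exact e hxV
  refine ⟨V, hV, hxV, ?_⟩
  have h' := h.comp (RingHom.IsStandardSmoothOfRelativeDimension.equiv
    (Scheme.ΓSpecIso (.of k)).symm.commRingCatIsoToRingEquiv)
  exact h'

theorem isPrincipal_maximalIdeal_stalk (x : C.scheme) :
    (IsLocalRing.maximalIdeal (C.scheme.presheaf.stalk x)).IsPrincipal := by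
  obtain ⟨V, hV, hxV, _⟩ := exists_isStandardSmooth x
  let q := (hV.primeIdealOf ⟨x, hxV⟩).asIdeal
  have hq := isPrincipal_maximalIdeal_of_smooth (k := k) q
  let _ := TopCat.Presheaf.algebra_section_stalk C.scheme.presheaf (U := V) ⟨x, hxV⟩
  have := hV.isLocalization_stalk ⟨x, hxV⟩
  let φ : Localization.AtPrime q ≃+* C.scheme.presheaf.stalk x :=
    (IsLocalization.algEquiv q.primeCompl (Localization.AtPrime q)
      (C.scheme.presheaf.stalk x)).toRingEquiv
  have hφ : IsLocalRing.maximalIdeal (C.scheme.presheaf.stalk x) =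
      (IsLocalRing.maximalIdeal (Localization.AtPrime q)).map φ := by
    ext y
    rw [← Ideal.comap_symm, Ideal.mem_comap, IsLocalRing.mem_maximalIdeal,
      IsLocalRing.mem_maximalIdeal, mem_nonunits_iff, mem_nonunits_iff, MulEquiv.isUnit_map]
  obtain ⟨a, ha⟩ := hq
  rw [hφ, ha]
  exact ⟨φ a, by rw [Ideal.submodule_span_eq, Ideal.map_span, Set.image_singleton]⟩

/-- The points of the curve have codimension at most one, by Krull's principal ideal theorem. -/
theorem coheight_le_one (x : C.scheme) : Order.coheight x ≤ 1 := by
  have h := ringKrullDim_stalk_eq_coheight x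
  have hp := isPrincipal_maximalIdeal_stalk x
  rw [← IsLocalRing.maximalIdeal_height_eq_ringKrullDim] at h
  have : (IsLocalRing.maximalIdeal (C.scheme.presheaf.stalk x)).height ≤ 1 :=
    Ideal.height_le_one_of_isPrincipal_of_mem_minimalPrimes
      (IsLocalRing.maximalIdeal (C.scheme.presheaf.stalk x)) _
      ⟨⟨inferInstance, le_rfl⟩, fun _ h _ ↦ h.2⟩
  rw [← WithBot.coe_le_coe] at this ⊢
  exact h ▸ this

theorem eq_of_specializes {x : C.PrimeDivisor} {y : C.scheme} (h : x.1 ⤳ y) : x.1 = y := by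
  by_contra hne
  have hlt : y < x.1 := lt_of_le_not_ge (Scheme.le_iff_specializes.mpr h)
    fun h' ↦ hne (h.antisymm (Scheme.le_iff_specializes.mp h')).eq
  have := (Order.coheight_add_one_le hlt).trans (coheight_le_one y)
  rw [x.2] at this
  exact absurd this (by decide)

theorem isClosed_primeDivisor (x : C.PrimeDivisor) : IsClosed {x.1} := by
  rw [← closure_subset_iff_isClosed]
  intro y hy
  exact (eq_of_specializes (specializes_iff_mem_closure.mpr hy)).symm

theorem exists_eq_div {U : C.scheme.Opens} (hU : IsAffineOpen U)
    (hη : genericPoint C.scheme ∈ U) (f : C.FunctionField) :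
    ∃ a b : Γ(C.scheme, U), b ≠ 0 ∧ f = germHom U hη a / germHom U hη b := by
  have : Nonempty U := ⟨⟨_, hη⟩⟩
  have := functionField_isFractionRing_of_isAffineOpen C.scheme U hU
  obtain ⟨a, b, hb, h⟩ := IsFractionRing.div_surjective (A := Γ(C.scheme, U))
    (K := C.scheme.functionField) f
  exact ⟨a, b, nonZeroDivisors.ne_zero hb, h.symm⟩

theorem germHom_injective (U : C.scheme.Opens) (hη : genericPoint C.scheme ∈ U) :
    Function.Injective (germHom U hη) :=
  have : Nonempty U := ⟨⟨_, hη⟩⟩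
  Scheme.germToFunctionField_injective _ U

theorem ord_germHom_eq_zero {U : C.scheme.Opens} (hη : genericPoint C.scheme ∈ U)
    {a : Γ(C.scheme, U)} (ha : a ≠ 0) {x : C.PrimeDivisor} (hx : x.1 ∈ C.scheme.basicOpen a) :
    C.ord (germHom U hη a) x = 0 := by
  have : Nonempty U := ⟨⟨_, hη⟩⟩
  have hη' : genericPoint C.scheme ∈ C.scheme.basicOpen a :=
    genericPoint_mem (by rwa [Ne, basicOpen_eq_bot_iff])
  have h := C.ord_germ hη' (RingedSpace.isUnit_res_basicOpen C.scheme.toRingedSpace a) x hx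
  have e : C.scheme.presheaf.germ _ _ hη' _ = germHom U hη a :=
    C.scheme.presheaf.germ_res_apply (homOfLE (C.scheme.basicOpen_le a)) _ hη' a
  exact (congrArg (C.ord · x) e).symm.trans h

/-- A rational function has finitely many zeros and poles: it is a quotient of regular functions on
each member of a finite affine cover. -/
theorem finite_ord_ne_zero (f : C.FunctionField) : {x | C.ord f x ≠ 0}.Finite := by
  by_cases hf : f = 0
  · subst hf
    have : ∀ x, C.ord (0 : C.FunctionField) x = 0 := fun x ↦
      congrFun (Scheme.ord_zero (X := C.scheme)) x.1
    simp [this]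
  have key : ∀ y : C.scheme, ∃ U : C.scheme.Opens, y ∈ U ∧
      {x : C.PrimeDivisor | x.1 ∈ U ∧ C.ord f x ≠ 0}.Finite := by
    intro y
    obtain ⟨_, ⟨U, hU, rfl⟩, hyU, -⟩ :=
      C.scheme.isBasis_affineOpens.exists_subset_of_mem_open (Set.mem_univ y) isOpen_univ
    have hη : genericPoint C.scheme ∈ U := genericPoint_mem (by rintro rfl; exact hyU)
    obtain ⟨a, b, hb, rfl⟩ := exists_eq_div hU hη f
    have ha : a ≠ 0 := by rintro rfl; simp at hf
    refine ⟨U, hyU,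
      ((finite_notMem_basicOpen hU ha).union (finite_notMem_basicOpen hU hb)).subset ?_⟩
    rintro x ⟨hx, hxf⟩
    by_contra hc
    simp only [Set.mem_union, Set.mem_ofPred_eq, hx, true_and, not_or, not_not] at hc
    have h₁ : germHom U hη a ≠ 0 := by simpa using (germHom_injective U hη).ne ha
    have h₂ : germHom U hη b ≠ 0 := by simpa using (germHom_injective U hη).ne hb
    apply hxf
    rw [div_eq_mul_inv, C.ord_mul h₁ (inv_ne_zero h₂), ord_inv h₂, ord_germHom_eq_zero hη ha hc.1,
      ord_germHom_eq_zero hη hb hc.2]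
    simp
  choose U hyU hfin using key
  obtain ⟨t, ht⟩ := isCompact_univ.elim_finite_subcover (fun y ↦ (U y : Set C.scheme))
    (fun y ↦ (U y).isOpen) (fun y _ ↦ Set.mem_iUnion.mpr ⟨y, hyU y⟩)
  refine (t.finite_toSet.biUnion fun y _ ↦ hfin y).subset fun x hx ↦ ?_
  obtain ⟨y, hy, hxy⟩ := Set.mem_iUnion₂.mp (ht (Set.mem_univ x.1))
  exact Set.mem_iUnion₂.mpr ⟨y, hy, hxy, hx⟩

theorem finite_notMem_vanishing (f : C.FunctionField) : {x | f ∉ C.vanishing x 0}.Finite :=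
  (finite_ord_ne_zero f).subset fun _ hx h ↦ hx fun _ ↦ h.ge

/-- On a separated integral scheme, an inclusion of local rings in the function field comes from a
specialization. -/
theorem specializes_of_stalk_le {x y : C.scheme} (hr : ∀ a : C.scheme.presheaf.stalk x,
    ∃ b : C.scheme.presheaf.stalk y,
      algebraMap _ C.FunctionField b = algebraMap _ C.FunctionField a) :
    y ⤳ x := by
  have hinj : Function.Injective (algebraMap (C.scheme.presheaf.stalk y) C.FunctionField) :=
    IsFractionRing.injective _ _
  choose φ hφ using hr
  let φ' : C.scheme.presheaf.stalk x →+* C.scheme.presheaf.stalk y :=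
    { toFun := φ
      map_one' := hinj (by rw [hφ, map_one, map_one])
      map_zero' := hinj (by rw [hφ, map_zero, map_zero])
      map_mul' a b := hinj (by rw [hφ, map_mul, map_mul, hφ, hφ])
      map_add' a b := hinj (by rw [hφ, map_add, map_add, hφ, hφ]) }
  have hφ' : (algebraMap (C.scheme.presheaf.stalk y) C.FunctionField).comp φ' =
      algebraMap (C.scheme.presheaf.stalk x) C.FunctionField := RingHom.ext hφ
  obtain ⟨Φ, hΦ⟩ : ∃ Φ : C.scheme.presheaf.stalk x ⟶ C.scheme.presheaf.stalk y,
      Φ.hom = φ' := ⟨CommRingCat.ofHom φ', rfl⟩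
  obtain ⟨ψ, hψ⟩ : ∃ ψ : ∀ z : C.scheme, C.scheme.presheaf.stalk z ⟶ .of C.FunctionField,
      ∀ z, (ψ z).hom = algebraMap (C.scheme.presheaf.stalk z) C.FunctionField :=
    ⟨fun z ↦ CommRingCat.ofHom (algebraMap (C.scheme.presheaf.stalk z) C.FunctionField),
      fun _ ↦ rfl⟩
  have hΦψ : Φ ≫ ψ y = ψ x := CommRingCat.hom_ext (by rw [CommRingCat.hom_comp, hΦ, hψ, hψ, hφ'])
  -- the two morphisms from `Spec 𝒪_y` to the curve agree on the dense subscheme `Spec K(C)`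
  have hι : IsDominant (Spec.map (ψ y)) :=
    ⟨(PrimeSpectrum.denseRange_comap_iff_ker_le_nilRadical (ψ y).hom).mpr
      (((RingHom.injective_iff_ker_eq_bot _).mp (by rw [hψ]; exact hinj)).le.trans bot_le)⟩
  have hfg : ∀ z : C.scheme, Spec.map (ψ z) ≫ C.scheme.fromSpecStalk z =
      C.scheme.fromSpecStalk (genericPoint C.scheme) := fun z ↦ by
    rw [← Scheme.SpecMap_stalkSpecializes_fromSpecStalk (X := C.scheme)
      ((genericPoint_spec C.scheme).specializes (y := z) trivial)]
    congr 2
    exact CommRingCat.hom_ext (hψ z)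
  have heq : Spec.map (ψ y) ≫ Spec.map Φ ≫ C.scheme.fromSpecStalk x =
      Spec.map (ψ y) ≫ C.scheme.fromSpecStalk y := by
    rw [← Category.assoc, ← Spec.map_comp, hΦψ, hfg, hfg]
  have hk : (Spec.map Φ ≫ C.scheme.fromSpecStalk x) ≫ C.π = C.scheme.fromSpecStalk y ≫ C.π := by
    have : (Spec (.of k)).IsSeparated := inferInstance
    refine ext_of_isDominant (Spec.map (ψ y)) ?_
    rw [← Category.assoc, heq, Category.assoc]
  have := ext_of_isDominant_of_isSeparated C.π hk (Spec.map (ψ y)) heq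
  have hy := C.scheme.fromSpecStalk_closedPoint (x := y)
  rw [← this] at hy
  exact C.scheme.range_fromSpecStalk.le ⟨_, hy⟩

/-- The local rings of distinct closed points are incomparable, as the curve is separated and has
dimension one. -/
theorem exists_mem_localRing_notMem {x y : C.PrimeDivisor} (hxy : x ≠ y) :
    ∃ f, f ∈ C.vanishing x 0 ∧ f ∉ C.vanishing y 0 := by
  by_contra! h
  refine hxy (Subtype.ext (eq_of_specializes (specializes_of_stalk_le fun a ↦ ?_)).symm)
  exact mem_vanishing_zero_iff.mp (h _ (mem_vanishing_zero_iff.mpr ⟨a, rfl⟩))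

end LocalStructure

end SmoothProjectiveCurve

/-! ### Residue fields and graded pieces -/

namespace SmoothProjectiveCurve
variable {k : Type u} [Field k] {C : SmoothProjectiveCurve k}

/-- The residue field of the point of `Spec k` under `x` is `k`. -/
noncomputable def baseToResidueField (x : C.scheme) :
    CommRingCat.of k ⟶ (Spec (.of k)).residueField (C.π x) :=
  (Scheme.ΓSpecIso (.of k)).inv ≫ (Spec (.of k)).presheaf.germ ⊤ (C.π x) trivial ≫
    (Spec (.of k)).residue (C.π x)

theorem baseToResidueField_comp (x : C.scheme) :
    (baseToResidueField x ≫ C.π.residueFieldMap x).hom =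
      algebraMap k (IsLocalRing.ResidueField (C.scheme.presheaf.stalk x)) := by
  have h : baseToResidueField x ≫ C.π.residueFieldMap x =
      ((Scheme.ΓSpecIso (.of k)).inv ≫ C.π.appTop) ≫ C.scheme.presheaf.germ ⊤ x trivial ≫
        C.scheme.residue x := by
    rw [baseToResidueField, Category.assoc, Category.assoc, Scheme.residue_residueFieldMap,
      Category.assoc]
    exact congrArg (_ ≫ ·) (C.π.germ_stalkMap_assoc ⊤ x (TopologicalSpace.Opens.mem_top _)
      (C.scheme.residue x))
  have e : C.π.appLE ⊤ ⊤ le_top = C.π.appTop := C.π.appLE_eq_app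
  rw [h, ← e]
  rfl

theorem bijective_baseToResidueField (x : C.scheme) :
    Function.Bijective (baseToResidueField x).hom := by
  refine ⟨RingHom.injective _, ?_⟩
  let p : PrimeSpectrum k := C.π x
  have : p.asIdeal.IsMaximal := by
    rw [Ideal.eq_bot_of_prime p.asIdeal]
    exact Ideal.bot_isMaximal
  have h := (ConcreteCategory.bijective_of_isIso
    (Scheme.Spec.residueFieldIso (.of k) (C.π x)).inv).surjective.comp
    (Ideal.algebraMap_residueField_surjective p.asIdeal)
  have e := congrArg CommRingCat.Hom.hom
    (Scheme.Spec.algebraMap_residueFieldIso_inv (.of k) (C.π x))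
  change Function.Surjective (CommRingCat.Hom.hom ((Scheme.ΓSpecIso (.of k)).inv ≫ _ ≫ _))
  rw [← e]
  exact h

/-- The residue field of a closed point is finite over `k`, by the Nullstellensatz. -/
theorem finite_residueField (x : C.PrimeDivisor) :
    Module.Finite k (IsLocalRing.ResidueField (C.scheme.presheaf.stalk x.1)) := by
  have := isClosed_singleton_iff_isClosedImmersion.mp (isClosed_primeDivisor x)
  have h : IsFinite (C.scheme.fromSpecResidueField x.1 ≫ C.π) :=
    isFinite_iff_locallyOfFiniteType_of_jacobsonSpace.mpr inferInstance
  have e : C.scheme.fromSpecResidueField x.1 ≫ C.π =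
      Spec.map (baseToResidueField x.1 ≫ C.π.residueFieldMap x.1) := by
    rw [Spec.map_comp, ← Scheme.Hom.SpecMap_residueFieldMap_fromSpecResidueField]
    congr 1
    rw [← Scheme.Spec.map_residueFieldIso_inv_eq_fromSpecResidueField, ← Spec.map_comp,
      Scheme.Spec.algebraMap_residueFieldIso_inv]
    rfl
  rw [e, IsFinite.SpecMap_iff, baseToResidueField_comp] at h
  exact h

/-- The dimension of the residue field over `k` is its degree over the residue field of the base. -/
theorem finrank_residueField (x : C.scheme) :
    Module.finrank k (IsLocalRing.ResidueField (C.scheme.presheaf.stalk x)) =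
      C.π.residueDegree x := by
  unfold Scheme.Hom.residueDegree
  algebraize [(C.π.residueFieldMap x).hom]
  refine Algebra.finrank_eq_of_equiv_equiv (RingEquiv.ofBijective _
    (bijective_baseToResidueField x)) (RingEquiv.refl _) ?_
  exact baseToResidueField_comp x

variable (C) in
/-- The successive quotient `𝔪_x ^ n / 𝔪_x ^ (n + 1)`. -/
abbrev GradedPiece (x : C.PrimeDivisor) (n : ℤ) : Type u :=
  C.vanishing x n ⧸ (C.vanishing x (n + 1)).submoduleOf (C.vanishing x n)

/-- Multiplication by a function of order `n` at `x`. -/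
theorem exists_gradedPieceEquiv (x : C.PrimeDivisor) (n : ℤ) :
    Nonempty (C.GradedPiece x 0 ≃ₗ[k] C.GradedPiece x n) := by
  obtain ⟨f, hf, hfx⟩ := exists_ord_eq x n
  have hmem : ∀ m : ℤ, ∀ g, f * g ∈ C.vanishing x (n + m) ↔ g ∈ C.vanishing x m := fun m g ↦ by
    rw [mul_mem_vanishing_iff hf, hfx, add_sub_cancel_left]
  let μ : C.vanishing x 0 →ₗ[k] C.GradedPiece x n :=
    (Submodule.mkQ _).comp (((LinearMap.mulLeft k f).comp (C.vanishing x 0).subtype).codRestrict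
      (C.vanishing x n) fun g ↦ by simpa using (hmem 0 g).mpr g.2)
  have hμ : Function.Surjective μ := by
    intro y
    obtain ⟨⟨y, hy⟩, rfl⟩ := Submodule.mkQ_surjective _ y
    refine ⟨⟨f⁻¹ * y, (hmem 0 _).mp (by simpa [mul_inv_cancel_left₀ hf] using hy)⟩, ?_⟩
    refine congrArg (Submodule.mkQ _) (Subtype.ext ?_)
    exact mul_inv_cancel_left₀ hf y
  have hk : (C.vanishing x (0 + 1)).submoduleOf (C.vanishing x 0) = LinearMap.ker μ := by
    ext g
    rw [LinearMap.mem_ker]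
    change (g : C.FunctionField) ∈ C.vanishing x (0 + 1) ↔ _
    rw [zero_add, ← hmem]
    exact (Submodule.Quotient.mk_eq_zero
      ((C.vanishing x (n + 1)).submoduleOf (C.vanishing x n))
      (x := ⟨f * g, by simpa using (hmem 0 g).mpr g.2⟩)).symm
  exact ⟨(Submodule.quotEquivOfEq _ _ hk).trans (μ.quotKerEquivOfSurjective hμ)⟩

/-- The graded piece of degree zero is the residue field. -/
theorem exists_gradedPieceZeroEquiv (x : C.PrimeDivisor) :
    Nonempty (IsLocalRing.ResidueField (C.scheme.presheaf.stalk x.1) ≃ₗ[k] C.GradedPiece x 0) := by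
  let μ : C.scheme.presheaf.stalk x.1 →ₗ[k] C.GradedPiece x 0 :=
    (Submodule.mkQ _).comp ((IsScalarTower.toAlgHom k (C.scheme.presheaf.stalk x.1)
      C.FunctionField).toLinearMap.codRestrict
      (C.vanishing x 0) fun g ↦ mem_vanishing_zero_iff.mpr ⟨g, rfl⟩)
  have hμ : Function.Surjective μ := by
    intro y
    obtain ⟨⟨y, hy⟩, rfl⟩ := Submodule.mkQ_surjective _ y
    obtain ⟨a, rfl⟩ := mem_vanishing_zero_iff.mp hy
    exact ⟨a, rfl⟩
  let ρ := (IsScalarTower.toAlgHom k (C.scheme.presheaf.stalk x.1)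
    (IsLocalRing.ResidueField (C.scheme.presheaf.stalk x.1))).toLinearMap
  have hρ : Function.Surjective ρ := IsLocalRing.residue_surjective
  have hk : LinearMap.ker ρ = LinearMap.ker μ := by
    ext g
    rw [LinearMap.mem_ker, LinearMap.mem_ker]
    refine (IsLocalRing.residue_eq_zero_iff g).trans ?_
    rw [← algebraMap_mem_vanishing_one_iff]
    exact (Submodule.Quotient.mk_eq_zero
      ((C.vanishing x (0 + 1)).submoduleOf (C.vanishing x 0))
      (x := ⟨algebraMap _ _ g, mem_vanishing_zero_iff.mpr ⟨g, rfl⟩⟩)).symm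
  exact ⟨(ρ.quotKerEquivOfSurjective hρ).symm.trans ((Submodule.quotEquivOfEq _ _ hk).trans
      (μ.quotKerEquivOfSurjective hμ))⟩

instance finite_gradedPiece (x : C.PrimeDivisor) (n : ℤ) : Module.Finite k (C.GradedPiece x n) := by
  obtain ⟨e⟩ := exists_gradedPieceZeroEquiv x
  obtain ⟨e'⟩ := exists_gradedPieceEquiv x n
  have := finite_residueField x
  exact Module.Finite.equiv (e.trans e')

theorem finrank_gradedPiece (x : C.PrimeDivisor) (n : ℤ) :
    Module.finrank k (C.GradedPiece x n) = C.π.residueDegree x.1 := by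
  obtain ⟨e⟩ := exists_gradedPieceZeroEquiv x
  obtain ⟨e'⟩ := exists_gradedPieceEquiv x n
  rw [← finrank_residueField, (e.trans e').finrank_eq]

/-- A function regular at `x` satisfies a polynomial equation modulo `𝔪_x`. -/
theorem exists_irreducible_aeval_mem_vanishing {x : C.PrimeDivisor} {f : C.FunctionField}
    (hf : f ∈ C.vanishing x 0) :
    ∃ p : k[X], Irreducible p ∧ aeval f p ∈ C.vanishing x 1 := by
  obtain ⟨a, rfl⟩ := mem_vanishing_zero_iff.mp hf
  have := finite_residueField x
  let a' := IsLocalRing.residue (C.scheme.presheaf.stalk x.1) a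
  have ha' : IsIntegral k a' := IsIntegral.of_finite k a'
  refine ⟨minpoly k a', minpoly.irreducible ha', ?_⟩
  rw [aeval_algebraMap_apply, algebraMap_mem_vanishing_one_iff, ← IsLocalRing.residue_eq_zero_iff]
  have h := minpoly.aeval k a'
  change aeval (algebraMap (C.scheme.presheaf.stalk x.1) (IsLocalRing.ResidueField _) a) _ = 0 at h
  rw [aeval_algebraMap_apply] at h
  exact h

end SmoothProjectiveCurve

/-! ### The function field as a finite extension of `k(t)` -/

/-- The fraction field of a domain which is standard smooth of relative dimension one over a field
is a finite extension of a simple one: it is unramified over the field generated by a coordinate. -/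
theorem exists_finite_adjoin_of_smooth {k A K : Type u} [Field k] [CommRing A] [Algebra k A]
    [Algebra.IsStandardSmoothOfRelativeDimension 1 k A] [Field K] [Algebra k K] [Algebra A K]
    [IsScalarTower k A K] [IsFractionRing A K] :
    ∃ t : K, Module.Finite (IntermediateField.adjoin k {t}) K := by
  classical
  obtain ⟨ι, σ, _, _, P, hP⟩ :=
    (inferInstance : Algebra.IsStandardSmoothOfRelativeDimension 1 k A).out
  have : Fintype ι := Fintype.ofFinite _
  have : Fintype σ := Fintype.ofFinite _
  have hcard : Fintype.card ((Set.range P.map)ᶜ : Set ι) = 1 := by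
    have := hP
    simp only [Algebra.Presentation.dimension, Nat.card_eq_fintype_card] at this
    rw [Fintype.card_compl_set, Set.card_range_of_injective P.map_inj, this]
  obtain ⟨i, hi⟩ := Fintype.card_eq_one_iff.mp hcard
  let x : A := P.val i
  have : Algebra.IsStandardSmooth k A :=
    Algebra.IsStandardSmoothOfRelativeDimension.isStandardSmooth 1
  let t : K := algebraMap A K x
  let E := IntermediateField.adjoin k {t}
  have htE : t ∈ E := IntermediateField.mem_adjoin_simple_self k t
  have : Algebra.EssFiniteType k K :=
    have := Algebra.EssFiniteType.of_isLocalization K (nonZeroDivisors A)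
    .comp k A _
  have : Algebra.EssFiniteType E K := Algebra.EssFiniteType.of_comp k E K
  have : Algebra.FormallyUnramified E K := by
    rw [Algebra.formallyUnramified_iff]
    refine subsingleton_of_forall_eq 0 fun w ↦ ?_
    have hA : ∀ a : A, KaehlerDifferential.D E K (algebraMap A K a) = 0 := by
      intro a
      let δ : Derivation k A (Ω[K⁄E]) :=
        ((KaehlerDifferential.D E K).restrictScalars k).compAlgebraMap A
      have hδ : δ.liftKaehlerDifferential = 0 := by
        refine P.basisKaehler.ext fun j ↦ ?_
        obtain rfl := hi j
        rw [P.basisKaehler_apply, Derivation.liftKaehlerDifferential_comp_D]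
        change KaehlerDifferential.D E K (algebraMap E K ⟨t, htE⟩) = 0
        rw [Derivation.map_algebraMap]
      have := δ.liftKaehlerDifferential_comp_D a
      rw [hδ] at this
      exact this.symm
    have hK : ∀ a : K, KaehlerDifferential.D E K a = 0 := by
      intro a
      obtain ⟨a, b, hb, rfl⟩ := IsFractionRing.div_surjective (A := A) a
      rw [Derivation.leibniz_div, hA, hA]
      simp
    have hw : Submodule.span K (Set.range (KaehlerDifferential.D E K)) ≤ ⊥ :=
      Submodule.span_le.mpr (by rintro _ ⟨a, rfl⟩; exact hK a)
    rw [KaehlerDifferential.span_range_derivation] at hw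
    exact (Submodule.mem_bot K).mp (hw trivial)
  exact ⟨t, Algebra.FormallyUnramified.finite_of_free _ _⟩

namespace SmoothProjectiveCurve

variable {k : Type u} [Field k] {C : SmoothProjectiveCurve k}

/-- Constants have no poles. -/
theorem mem_vanishing_zero_of_isIntegral {f : C.FunctionField} (hf : IsIntegral k f)
    (x : C.PrimeDivisor) : f ∈ C.vanishing x 0 := by
  rw [mem_vanishing_zero_iff]
  exact IsIntegrallyClosed.isIntegral_iff.mp
    (hf.tower_top (A := C.scheme.presheaf.stalk x.1))

theorem transcendental_of_ord_ne_zero {f : C.FunctionField}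
    {x : C.PrimeDivisor} (h : C.ord f x ≠ 0) : Transcendental k f := by
  intro halg
  by_cases hf : f = 0
  · exact h (hf ▸ congrFun (Scheme.ord_zero (X := C.scheme)) x.1)
  have h₁ := mem_vanishing_zero_of_isIntegral halg.isIntegral x hf
  have h₂ := mem_vanishing_zero_of_isIntegral (halg.inv).isIntegral x (inv_ne_zero hf)
  rw [ord_inv hf] at h₂
  lia

/-- The inclusion of the functions on a nonempty open subset in the function field. -/
noncomputable abbrev sectionsAlgebra (U : C.scheme.Opens) [Nonempty U] :
    Algebra Γ(C.scheme, U) C.FunctionField :=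
  inferInstanceAs (Algebra Γ(C.scheme, U) C.scheme.functionField)

/-- The function field is finite over `k(t)` for some `t`. If `t` were algebraic over `k`, so would
be a uniformizer at `x`. -/
theorem exists_finite_adjoin (x : C.PrimeDivisor) : ∃ t : C.FunctionField, Transcendental k t ∧
    Module.Finite (IntermediateField.adjoin k {t}) C.FunctionField := by
  obtain ⟨V, hV, hxV, _⟩ := exists_isStandardSmooth x.1
  have : Nonempty V := ⟨⟨_, hxV⟩⟩
  let _ := sectionsAlgebra V
  have : IsFractionRing Γ(C.scheme, V) C.FunctionField :=
    functionField_isFractionRing_of_isAffineOpen C.scheme V hV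
  have : IsScalarTower k Γ(C.scheme, V) C.FunctionField := by
    refine .of_algebraMap_eq fun c ↦ ?_
    rw [IsScalarTower.algebraMap_apply k (C.scheme.presheaf.stalk x.1) C.FunctionField,
      ← germ_algebraMap (U := V) x.1 hxV]
    exact Scheme.algebraMap_germ_eq_germToFunctionField (X := C.scheme) (U := V) hxV _
  obtain ⟨t, ht⟩ := exists_finite_adjoin_of_smooth (k := k) (A := Γ(C.scheme, V))
    (K := C.FunctionField)
  refine ⟨t, fun halg ↦ ?_, ht⟩
  have := IntermediateField.adjoin.finiteDimensional halg.isIntegral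
  have := Module.Finite.trans (R := k) (IntermediateField.adjoin k {t}) C.FunctionField
  obtain ⟨f, -, hf⟩ := exists_ord_eq x 1
  exact transcendental_of_ord_ne_zero (f := f) (x := x) (by rw [hf]; exact one_ne_zero)
    (IsIntegral.of_finite k f).isAlgebraic

end SmoothProjectiveCurve

/-! ### Weak approximation -/

namespace SmoothProjectiveCurve

variable {k : Type u} [Field k] {C : SmoothProjectiveCurve k}

open Classical in
/-- The absolute value `f ↦ 2 ^ (- ord_x f)`, used to apply the approximation theorem for
inequivalent absolute values. -/
noncomputable def absVal (x : C.PrimeDivisor) : AbsoluteValue C.FunctionField ℝ where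
  toFun f := if f = 0 then 0 else (2 : ℝ) ^ (- C.ord f x)
  map_mul' f g := by
    by_cases hf : f = 0
    · simp [hf]
    by_cases hg : g = 0
    · simp [hg]
    rw [if_neg (mul_ne_zero hf hg), if_neg hf, if_neg hg, C.ord_mul hf hg, neg_add,
      zpow_add₀ two_ne_zero]
  nonneg' f := by
    split_ifs
    exacts [le_rfl, by positivity]
  eq_zero' f := by
    split_ifs with h
    · simp [h]
    · simp only [h, iff_false]
      positivity
  add_le' f g := by
    by_cases hf : f = 0
    · simp [hf]
    by_cases hg : g = 0
    · simp [hg]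
    by_cases hfg : f + g = 0
    · rw [if_pos hfg]
      split_ifs
      positivity
    rw [if_neg hfg, if_neg hf, if_neg hg]
    have hf' : 0 < (2 : ℝ) ^ (- C.ord f x) := by positivity
    have hg' : 0 < (2 : ℝ) ^ (- C.ord g x) := by positivity
    rcases min_le_iff.mp (C.ord_add hfg x) with h | h
    · have := zpow_le_zpow_right₀ (a := (2 : ℝ)) one_le_two (neg_le_neg h)
      linarith
    · have := zpow_le_zpow_right₀ (a := (2 : ℝ)) one_le_two (neg_le_neg h)
      linarith

theorem absVal_apply {x : C.PrimeDivisor} {f : C.FunctionField} (hf : f ≠ 0) :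
    absVal x f = (2 : ℝ) ^ (- C.ord f x) := if_neg hf

theorem absVal_le_iff {x : C.PrimeDivisor} {f : C.FunctionField} {n : ℤ} :
    absVal x f ≤ (2 : ℝ) ^ (- n) ↔ f ∈ C.vanishing x n := by
  by_cases hf : f = 0
  · subst hf
    simp only [map_zero, zero_mem, iff_true]
    positivity
  rw [absVal_apply hf, zpow_le_zpow_iff_right₀ one_lt_two, neg_le_neg_iff]
  exact ⟨fun h _ ↦ h, fun h ↦ h hf⟩

/-- Weak approximation: a function can be prescribed to any order at finitely many points. -/
theorem exists_sub_mem_vanishing (T : Finset C.PrimeDivisor) (β : C.PrimeDivisor → C.FunctionField)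
    (n : ℤ) : ∃ a : C.FunctionField, ∀ x ∈ T, a - β x ∈ C.vanishing x n := by
  have hnt : ∀ x : T, (absVal x.1).IsNontrivial := fun x ↦ by
    obtain ⟨f, hf, hfx⟩ := exists_ord_eq x.1 1
    refine ⟨f, hf, ?_⟩
    rw [absVal_apply hf, hfx]
    norm_num
  have hne : Pairwise fun x y : T ↦ ¬ (absVal x.1).IsEquiv (absVal y.1) := fun x y hxy h ↦ by
    obtain ⟨f, hfx, hfy⟩ := exists_mem_localRing_notMem (Subtype.coe_ne_coe.mpr hxy)
    rw [← absVal_le_iff, neg_zero, zpow_zero] at hfx hfy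
    exact hfy (h.le_one_iff.mp hfx)
  obtain ⟨a, ha⟩ := (AbsoluteValue.denseRange_algebraMap_pi hnt hne).exists_dist_lt
    (fun x ↦ WithAbs.toAbs _ (β x.1)) (ε := (2 : ℝ) ^ (- n)) (by positivity)
  refine ⟨a, fun x hx ↦ absVal_le_iff.mp ?_⟩
  have h := (dist_le_pi_dist _ _ (⟨x, hx⟩ : T)).trans ha.le
  rw [dist_eq_norm, ← neg_sub, norm_neg] at h
  exact h

end SmoothProjectiveCurve

/-! ### Strong approximation -/

namespace SmoothProjectiveCurve

variable {k : Type u} [Field k] {C : SmoothProjectiveCurve k}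

theorem exists_nat_forall_le {ι : Type*} (T : Finset ι) (ν : ι → ℤ) :
    ∃ M : ℕ, ∀ x ∈ T, ν x ≤ M := by
  classical
  obtain ⟨M, hM⟩ := (T.image ν).exists_le
  exact ⟨M.toNat, fun x hx ↦ (hM _ (Finset.mem_image_of_mem ν hx)).trans (Int.self_le_toNat M)⟩

theorem aeval_mem_vanishing {x : C.PrimeDivisor} {t : C.FunctionField} (ht : t ∈ C.vanishing x 0)
    (p : k[X]) : aeval t p ∈ C.vanishing x 0 := by
  rw [aeval_eq_sum_range]
  exact sum_mem fun i _ ↦ Submodule.smul_mem _ _ (pow_mem_vanishing_zero ht i)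

theorem aeval_mem_vanishing_one_of_dvd {x : C.PrimeDivisor} {t : C.FunctionField}
    (ht : t ∈ C.vanishing x 0) {p q : k[X]} (hp : aeval t p ∈ C.vanishing x 1) (h : p ∣ q) :
    aeval t q ∈ C.vanishing x 1 := by
  obtain ⟨c, rfl⟩ := h
  rw [map_mul, ← add_zero (1 : ℤ)]
  exact mul_mem_vanishing hp (aeval_mem_vanishing ht c)

theorem pow_mul_mem_vanishing {x : C.PrimeDivisor} {f g : C.FunctionField} {M : ℕ} {n : ℤ}
    (hf : f ∈ C.vanishing x 1) (hM : n - C.ord g x ≤ M) : f ^ M * g ∈ C.vanishing x n :=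
  vanishing_anti x (by linarith)
    (mul_mem_vanishing (pow_mem_vanishing hf M) (mem_vanishing_ord x g))

/-- The poles of a function in a finite set of points where `t` is regular can be removed by a
polynomial in `t`, prime to any given polynomial in `t` which is invertible at these points. -/
theorem exists_aeval_mul_mem_vanishing {t : C.FunctionField} (T : Finset C.PrimeDivisor)
    (hT : ∀ x ∈ T, t ∈ C.vanishing x 0) (a : C.FunctionField) (P : k[X])
    (hP : ∀ x ∈ T, aeval t P ∉ C.vanishing x 1) :
    ∃ Q : k[X], Q ≠ 0 ∧ IsCoprime Q P ∧ ∀ x ∈ T, aeval t Q * a ∈ C.vanishing x 0 := by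
  classical
  choose! p hp hpx using fun x (hx : t ∈ C.vanishing x 0) ↦
    exists_irreducible_aeval_mem_vanishing (k := k) hx
  obtain ⟨M, hM⟩ := exists_nat_forall_le T fun x ↦ 0 - C.ord a x
  refine ⟨(∏ x ∈ T, p x) ^ M, pow_ne_zero _ (Finset.prod_ne_zero_iff.mpr
    fun x hx ↦ (hp x (hT x hx)).ne_zero), IsCoprime.pow_left (IsCoprime.prod_left fun x hx ↦ ?_),
    fun x hx ↦ ?_⟩
  · rw [(hp x (hT x hx)).coprime_iff_not_dvd]
    exact fun h ↦ hP x hx (aeval_mem_vanishing_one_of_dvd (hT x hx) (hpx x (hT x hx)) h)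
  · rw [map_pow]
    exact pow_mul_mem_vanishing (aeval_mem_vanishing_one_of_dvd (hT x hx) (hpx x (hT x hx))
      (Finset.dvd_prod_of_mem p hx)) (hM x hx)

/-- Strong approximation: a family of functions, almost all regular, is congruent to a single
function modulo regular functions at all the points where `t` is regular. -/
theorem exists_forall_sub_mem_vanishing {t : C.FunctionField} (ht : Transcendental k t)
    (α : C.PrimeDivisor → C.FunctionField) (hα : {x | α x ∉ C.vanishing x 0}.Finite) :
    ∃ g : C.FunctionField, ∀ x, t ∈ C.vanishing x 0 → α x - g ∈ C.vanishing x 0 := by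
  classical
  have hne : ∀ P : k[X], P ≠ 0 → aeval t P ≠ 0 := fun P hP h ↦
    hP ((transcendental_iff.mp ht) P h)
  choose! p hp hpx using fun x (hx : t ∈ C.vanishing x 0) ↦
    exists_irreducible_aeval_mem_vanishing (k := k) hx
  let T₁ : Finset C.PrimeDivisor := hα.toFinset.filter fun x ↦ t ∈ C.vanishing x 0
  have hT₁ : ∀ x ∈ T₁, t ∈ C.vanishing x 0 := fun x hx ↦ (Finset.mem_filter.mp hx).2
  -- a polynomial in `t` which vanishes at the poles of `α` among the points where `t` is regular
  let P : k[X] := ∏ x ∈ T₁, p x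
  have hP0 : P ≠ 0 := Finset.prod_ne_zero_iff.mpr fun x hx ↦ (hp x (hT₁ x hx)).ne_zero
  set w := aeval t P with hw
  have hw0 : w ≠ 0 := hne P hP0
  obtain ⟨M, hM⟩ := exists_nat_forall_le T₁ fun x ↦ 0 - C.ord (α x) x
  let T₂ : Finset C.PrimeDivisor :=
    (finite_ord_ne_zero w).toFinset.filter fun x ↦ t ∈ C.vanishing x 0
  have hT₂ : ∀ x, x ∈ T₂ ↔ t ∈ C.vanishing x 0 ∧ w ∈ C.vanishing x 1 := fun x ↦ by
    simp only [T₂, Finset.mem_filter, Set.Finite.mem_toFinset, Set.mem_ofPred_eq]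
    constructor
    · rintro ⟨h₁, h₂⟩
      have : 0 ≤ C.ord w x := aeval_mem_vanishing h₂ P hw0
      exact ⟨h₂, fun _ ↦ by lia⟩
    · rintro ⟨h₁, h₂⟩
      exact ⟨by have := h₂ hw0; lia, h₁⟩
  obtain ⟨N, hN⟩ := exists_nat_forall_le T₂ fun x ↦ M * C.ord w x
  -- a first approximation at the zeros of `w`
  obtain ⟨a, ha⟩ := exists_sub_mem_vanishing T₂ (fun x ↦ w ^ M * α x) N
  let T₃ : Finset C.PrimeDivisor := (finite_notMem_vanishing a).toFinset.filter
    fun x ↦ t ∈ C.vanishing x 0 ∧ x ∉ T₂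
  have hT₃ : ∀ x ∈ T₃, t ∈ C.vanishing x 0 ∧ x ∉ T₂ := fun x hx ↦ (Finset.mem_filter.mp hx).2
  -- the other poles of `a` are removed without changing it much at the zeros of `w`
  obtain ⟨Q, -, hQP, hQ⟩ := exists_aeval_mul_mem_vanishing T₃ (fun x hx ↦ (hT₃ x hx).1) a P
    (fun x hx h ↦ (hT₃ x hx).2 ((hT₂ x).mpr ⟨(hT₃ x hx).1, h⟩))
  obtain ⟨M', hM'⟩ := exists_nat_forall_le T₂ fun x ↦ N - C.ord a x
  obtain ⟨c, d, hcd⟩ := hQP.pow_right (n := M')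
  set a' := aeval t (c * Q) * a with ha'
  have haa' : a - a' = aeval t d * (w ^ M' * a) := by
    have h := congrArg (aeval t) hcd
    rw [map_add, map_mul, map_mul, map_one, map_pow, ← hw] at h
    rw [ha', map_mul]
    linear_combination (-a) * h
  -- now `a'` approximates `w ^ M α` to the order of `w ^ M`, which is what division by it needs
  refine ⟨(w ^ M)⁻¹ * a', fun x hx ↦ ?_⟩
  have hwM : w ^ M ≠ 0 := pow_ne_zero _ hw0
  have hmain : w ^ M * α x - a' ∈ C.vanishing x (C.ord (w ^ M) x) := by
    rw [ord_pow hw0]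
    by_cases hx₂ : x ∈ T₂
    · refine vanishing_anti x (hN x hx₂) ?_
      have h₁ : aeval t d * (w ^ M' * a) ∈ C.vanishing x N := by
        rw [← zero_add (N : ℤ)]
        exact mul_mem_vanishing (aeval_mem_vanishing hx d)
          (pow_mul_mem_vanishing ((hT₂ x).mp hx₂).2 (hM' x hx₂))
      have := add_mem (neg_mem (ha x hx₂)) h₁
      rw [← haa'] at this
      convert this using 1
      ring
    · have hwx : C.ord w x = 0 := by
        by_contra h
        exact hx₂ (Finset.mem_filter.mpr ⟨by simpa using h, hx⟩)
      rw [hwx, mul_zero]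
      have hw' : w ∈ C.vanishing x 0 := aeval_mem_vanishing hx P
      have hαx : α x ∈ C.vanishing x 0 := by
        by_contra h
        have hx₁ : x ∈ T₁ := Finset.mem_filter.mpr ⟨by simpa using h, hx⟩
        exact hx₂ ((hT₂ x).mpr ⟨hx, aeval_mem_vanishing_one_of_dvd hx (hpx x hx)
          (Finset.dvd_prod_of_mem p hx₁)⟩)
      refine sub_mem (by simpa using mul_mem_vanishing (pow_mem_vanishing_zero hw' M) hαx) ?_
      rw [ha', map_mul, mul_assoc]
      have : aeval t Q * a ∈ C.vanishing x 0 := by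
        by_cases hx₃ : x ∈ T₃
        · exact hQ x hx₃
        · have : a ∈ C.vanishing x 0 := by
            by_contra h
            exact hx₃ (Finset.mem_filter.mpr ⟨by simpa using h, hx, hx₂⟩)
          simpa using mul_mem_vanishing (aeval_mem_vanishing hx Q) this
      simpa using mul_mem_vanishing (aeval_mem_vanishing hx c) this
  have := (mul_mem_vanishing_iff (n := C.ord (w ^ M) x) (x := x) hwM (g := α x - (w ^ M)⁻¹ * a')).mp
    (by rwa [mul_sub, mul_inv_cancel_left₀ hwM])
  rwa [sub_self] at this

theorem aeval_mem_vanishing_of_natDegree_le {x : C.PrimeDivisor} {t : C.FunctionField}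
    (ht : t ∉ C.vanishing x 0) {p : k[X]} {n : ℕ} (hp : p.natDegree ≤ n) :
    aeval t p ∈ C.vanishing x (n * C.ord t x) := by
  have ht' : C.ord t x < 0 := by
    by_contra! h
    exact ht fun _ ↦ h
  rw [aeval_eq_sum_range' (Nat.lt_succ_of_le hp)]
  refine sum_mem fun i hi ↦ Submodule.smul_mem _ _ (vanishing_anti x ?_
    (pow_mem_vanishing (mem_vanishing_ord x t) i))
  have : (i : ℤ) ≤ n := by exact_mod_cast Nat.lt_succ_iff.mp (Finset.mem_range.mp hi)
  nlinarith

theorem ord_aeval_of_notMem {x : C.PrimeDivisor} {t : C.FunctionField}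
    (ht : t ∉ C.vanishing x 0) {p : k[X]} (hp : p ≠ 0) :
    aeval t p ≠ 0 ∧ C.ord (aeval t p) x = p.natDegree * C.ord t x := by
  have ht' : C.ord t x < 0 := by
    by_contra! h
    exact ht fun _ ↦ h
  have ht0 : t ≠ 0 := by rintro rfl; exact ht (zero_mem _)
  have hlc : algebraMap k C.FunctionField p.leadingCoeff ≠ 0 := by simpa using hp
  have htn : t ^ p.natDegree ≠ 0 := pow_ne_zero _ ht0
  have hord : C.ord (algebraMap k C.FunctionField p.leadingCoeff * t ^ p.natDegree) x =
      p.natDegree * C.ord t x := by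
    rw [C.ord_mul hlc htn, C.ord_algebraMap (leadingCoeff_ne_zero.mpr hp), ord_pow ht0, zero_add]
  have hsplit : aeval t p = algebraMap k C.FunctionField p.leadingCoeff * t ^ p.natDegree +
      aeval t p.eraseLead := by
    have h := congrArg (aeval t) p.eraseLead_add_C_mul_X_pow.symm
    rwa [map_add, map_mul, aeval_C, map_pow, aeval_X, add_comm] at h
  rw [hsplit, ← hord]
  refine ord_add_eq (mul_ne_zero hlc htn) ?_
  by_cases h : p.eraseLead = 0
  · rw [h, map_zero]; exact zero_mem _
  have hdeg : p.eraseLead.natDegree < p.natDegree := by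
    rcases p.eraseLead_natDegree_lt_or_eraseLead_eq_zero with h' | h'
    exacts [h', absurd h' h]
  refine vanishing_anti x ?_ (aeval_mem_vanishing_of_natDegree_le ht le_rfl)
  rw [hord]
  have : (p.eraseLead.natDegree : ℤ) + 1 ≤ p.natDegree := by exact_mod_cast hdeg
  nlinarith

/-- A rational function in `t` is the sum of a polynomial in `t` and of a function regular at the
poles of `t`. -/
theorem exists_eq_aeval_add {t c : C.FunctionField} (hc : c ∈ IntermediateField.adjoin k {t}) :
    ∃ (q : k[X]) (f : C.FunctionField), c = aeval t q + f ∧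
      ∀ x, t ∉ C.vanishing x 0 → f ∈ C.vanishing x 0 := by
  obtain ⟨r, w, rfl⟩ := (IntermediateField.mem_adjoin_simple_iff k c).mp hc
  by_cases hw : aeval t w = 0
  · exact ⟨0, 0, by simp [hw], fun _ _ ↦ zero_mem _⟩
  have hw0 : w ≠ 0 := by rintro rfl; simp at hw
  refine ⟨r / w, aeval t (r % w) / aeval t w, ?_, fun x hx ↦ ?_⟩
  · conv_lhs => rw [← EuclideanDomain.div_add_mod r w]
    rw [map_add, map_mul, add_div, mul_div_cancel_left₀ _ hw]
  · have ht' : C.ord t x < 0 := by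
      by_contra! h
      exact hx fun _ ↦ h
    have h := (mul_mem_vanishing_iff (n := C.ord (aeval t w) x) (x := x)
      (g := aeval t (r % w) / aeval t w) hw).mp ?_
    · rwa [sub_self] at h
    rw [mul_div_cancel₀ _ hw, (ord_aeval_of_notMem hx hw0).2]
    refine aeval_mem_vanishing_of_natDegree_le hx ?_
    by_cases h0 : r % w = 0
    · simp [h0]
    · exact natDegree_le_natDegree (EuclideanDomain.mod_lt r hw0).le

/-- Every function is the sum of a function regular away from the poles of `t` and of a function
with poles of bounded order `s` at the poles of `t`: the coordinates in a basis over `k(t)` are sums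
of polynomials in `t` and of functions regular at the poles of `t`. -/
theorem exists_eq_add_of_finite {t : C.FunctionField} (ht : Transcendental k t)
    [Module.Finite (IntermediateField.adjoin k {t}) C.FunctionField] :
    ∃ s : ℕ, ∀ f : C.FunctionField, ∃ f₀ f₁ : C.FunctionField, f = f₀ + f₁ ∧
      (∀ x, t ∈ C.vanishing x 0 → f₀ ∈ C.vanishing x 0) ∧
      (∀ x, t ∉ C.vanishing x 0 → f₁ ∈ C.vanishing x (-s)) := by
  classical
  have hne : ∀ P : k[X], P ≠ 0 → aeval t P ≠ 0 := fun P hP h ↦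
    hP ((transcendental_iff.mp ht) P h)
  let y := Module.finBasis (IntermediateField.adjoin k {t}) C.FunctionField
  have hq : ∀ j, ∃ q : k[X], q ≠ 0 ∧ ∀ x, t ∈ C.vanishing x 0 →
      aeval t q * y j ∈ C.vanishing x 0 := fun j ↦ by
    obtain ⟨q, hq, -, h⟩ := exists_aeval_mul_mem_vanishing
      ((finite_notMem_vanishing (y j)).toFinset.filter fun x ↦ t ∈ C.vanishing x 0)
      (fun x hx ↦ (Finset.mem_filter.mp hx).2) (y j) (1 : k[X])
      (fun x _ h ↦ by
        have := h (by simp)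
        simp [ord_one] at this)
    refine ⟨q, hq, fun x hx ↦ ?_⟩
    by_cases hy : y j ∈ C.vanishing x 0
    · simpa using mul_mem_vanishing (aeval_mem_vanishing hx q) hy
    · exact h x (Finset.mem_filter.mpr ⟨by simpa using hy, hx⟩)
  choose q hq0 hq using hq
  obtain ⟨s, hs⟩ := exists_nat_forall_le ((finite_notMem_vanishing t).toFinset ×ˢ Finset.univ)
    fun xj ↦ - C.ord (aeval t (q xj.2) * y xj.2) xj.1
  refine ⟨s, fun f ↦ ?_⟩
  have hc : ∀ j, (y.repr f j : C.FunctionField) / aeval t (q j) ∈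
      IntermediateField.adjoin k {t} := fun j ↦ div_mem (y.repr f j).2
        ((IntermediateField.algebra_adjoin_le_adjoin k _) (aeval_mem_adjoin_singleton k t))
  choose p g hpg hg using fun j ↦ exists_eq_aeval_add (hc j)
  refine ⟨∑ j, aeval t (p j) * (aeval t (q j) * y j), ∑ j, g j * (aeval t (q j) * y j), ?_,
    fun x hx ↦ sum_mem fun j _ ↦ ?_, fun x hx ↦ sum_mem fun j _ ↦ ?_⟩
  · rw [← Finset.sum_add_distrib]
    conv_lhs => rw [← y.sum_repr f]
    refine Finset.sum_congr rfl fun j _ ↦ ?_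
    rw [← add_mul, ← hpg, ← mul_assoc, div_mul_cancel₀ _ (hne _ (hq0 j))]
    rfl
  · simpa using mul_mem_vanishing (aeval_mem_vanishing hx (p j)) (hq j x hx)
  · refine vanishing_anti x ?_ (mul_mem_vanishing (hg j x hx) (mem_vanishing_ord x _))
    have := hs (x, j) (by simpa using hx)
    linarith

/-- Some divisor `E` bounds the poles of every adele up to a function, that is `H¹(C, 𝒪(E)) = 0`.
The poles of the adele outside those of `t` are removed by strong approximation; at the poles of
`t`, weak approximation gives a function which has to be made regular elsewhere, at the cost of
poles of bounded order. -/
theorem exists_forall_sub_mem (x₀ : C.PrimeDivisor) : ∃ E : C.Divisor,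
    ∀ α : C.PrimeDivisor → C.FunctionField, {x | α x ∉ C.vanishing x 0}.Finite →
      ∃ g : C.FunctionField, ∀ x, α x - g ∈ C.vanishing x (-E x) := by
  classical
  obtain ⟨t, ht, _⟩ := exists_finite_adjoin x₀
  obtain ⟨s, hs⟩ := exists_eq_add_of_finite ht
  refine ⟨Finsupp.onFinset (finite_notMem_vanishing t).toFinset
    (fun x ↦ if t ∈ C.vanishing x 0 then 0 else (s : ℤ)) (fun x h ↦ by simp at h ⊢; exact h.1),
    fun α hα ↦ ?_⟩
  obtain ⟨g₁, hg₁⟩ := exists_forall_sub_mem_vanishing ht α hα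
  obtain ⟨h, hh⟩ := exists_sub_mem_vanishing (finite_notMem_vanishing t).toFinset
    (fun x ↦ α x - g₁) 0
  obtain ⟨h₀, h₁, rfl, hh₀, hh₁⟩ := hs h
  refine ⟨g₁ + h₀, fun x ↦ ?_⟩
  rw [Finsupp.onFinset_apply]
  split_ifs with hx
  · rw [← sub_sub, neg_zero]
    exact sub_mem (hg₁ x hx) (hh₀ x hx)
  · have e : α x - (g₁ + h₀) = h₁ - (h₀ + h₁ - (α x - g₁)) := by ring
    rw [e]
    exact sub_mem (hh₁ x hx) (vanishing_anti x (by simp) (hh x (by simpa using hx)))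

end SmoothProjectiveCurve

/-! ### Cohomology of divisors -/

section EulerCharacteristic

variable {k W K : Type*} [Field k] [AddCommGroup W] [Module k W] [AddCommGroup K] [Module k K]

theorem finite_of_finite_ker (f : K →ₗ[k] W) [Module.Finite k (LinearMap.ker f)]
    [Module.Finite k (LinearMap.range f)] : Module.Finite k K :=
  have := Module.Finite.equiv f.quotKerEquivRange.symm
  .of_submodule_quotient (LinearMap.ker f)

variable {Q : Type*} [AddCommGroup Q] [Module k Q]

/-- For subspaces `A ≤ A'` of `W` with quotient `Q` and a map `δ : K → W`, the exact sequence
`0 → δ⁻¹A → δ⁻¹A' → Q → W/(A + δK) → W/(A' + δK) → 0`, in terms of dimensions. -/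
theorem finite_and_finrank_of_le (δ : K →ₗ[k] W) {A A' : Submodule k W} (h : A ≤ A')
    (q : A' →ₗ[k] Q) (hq : Function.Surjective q) (hqA : ∀ a, q a = 0 ↔ (a : W) ∈ A)
    [Module.Finite k Q] :
    (Module.Finite k (A.comap δ) ↔ Module.Finite k (A'.comap δ)) ∧
    (Module.Finite k (W ⧸ (A ⊔ LinearMap.range δ)) ↔
      Module.Finite k (W ⧸ (A' ⊔ LinearMap.range δ))) ∧
    (Module.Finite k (A'.comap δ) → Module.Finite k (W ⧸ (A ⊔ LinearMap.range δ)) →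
      Module.finrank k (A'.comap δ) + Module.finrank k (W ⧸ (A ⊔ LinearMap.range δ)) =
      Module.finrank k (A.comap δ) + Module.finrank k (W ⧸ (A' ⊔ LinearMap.range δ)) +
        Module.finrank k Q) := by
  have hc : A.comap δ ≤ A'.comap δ := Submodule.comap_mono h
  let φ : A'.comap δ →ₗ[k] Q := q ∘ₗ δ.restrict (p := A'.comap δ) (q := A') fun _ hx ↦ hx
  -- the connecting map `Q → W/(A + δK)`
  obtain ⟨β, hβq⟩ : ∃ β : Q →ₗ[k] W ⧸ (A ⊔ LinearMap.range δ), ∀ a : A',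
      β (q a) = (A ⊔ LinearMap.range δ).mkQ a := by
    refine ⟨(LinearMap.ker q).liftQ ((A ⊔ LinearMap.range δ).mkQ ∘ₗ A'.subtype) (fun a ha ↦ ?_) ∘ₗ
      (q.quotKerEquivOfSurjective hq).symm.toLinearMap, fun a ↦ ?_⟩
    · exact (Submodule.Quotient.mk_eq_zero (A ⊔ LinearMap.range δ)).mpr
        (Submodule.mem_sup_left ((hqA a).mp ha))
    · have : (q.quotKerEquivOfSurjective hq).symm (q a) = (LinearMap.ker q).mkQ a :=
        (LinearEquiv.symm_apply_eq _).mpr rfl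
      rw [LinearMap.comp_apply, LinearEquiv.coe_coe, this]
      rfl
  let γ : (W ⧸ (A ⊔ LinearMap.range δ)) →ₗ[k] W ⧸ (A' ⊔ LinearMap.range δ) :=
    Submodule.factor (sup_le_sup_right h _)
  have hγ : Function.Surjective γ := Submodule.factor_surjective _
  have hφ : LinearMap.ker φ = LinearMap.range (Submodule.inclusion hc) := by
    ext x
    rw [LinearMap.mem_ker, Submodule.range_inclusion]
    exact hqA _
  have hβ : LinearMap.ker β = LinearMap.range φ := by
    ext x
    obtain ⟨a, rfl⟩ := hq x
    rw [LinearMap.mem_ker, hβq]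
    refine (Submodule.Quotient.mk_eq_zero (A ⊔ LinearMap.range δ)).trans ?_
    rw [Submodule.mem_sup]
    constructor
    · rintro ⟨y, hy, _, ⟨z, rfl⟩, e⟩
      have hz : δ z ∈ A' := by
        rw [← sub_eq_of_eq_add' e.symm]; exact sub_mem a.2 (h hy)
      refine ⟨⟨z, hz⟩, ?_⟩
      rw [← sub_eq_zero]
      change q ⟨δ z, hz⟩ - q a = 0
      rw [← map_sub, hqA, AddSubgroupClass.coe_sub, ← e]
      simpa using hy
    · rintro ⟨z, hz⟩
      have hz : q (⟨δ z, z.2⟩ - a) = 0 := by rw [map_sub, sub_eq_zero]; exact hz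
      rw [hqA] at hz
      exact ⟨a - δ z, by simpa using neg_mem hz, δ z, ⟨z, rfl⟩, by simp⟩
  have hγβ : LinearMap.ker γ = LinearMap.range β := by
    ext x
    obtain ⟨a, rfl⟩ := Submodule.mkQ_surjective _ x
    rw [LinearMap.mem_ker]
    refine (Submodule.Quotient.mk_eq_zero (A' ⊔ LinearMap.range δ)).trans ?_
    rw [Submodule.mem_sup]
    constructor
    · rintro ⟨y, hy, z, hz, rfl⟩
      refine ⟨q ⟨y, hy⟩, (hβq _).trans
        ((Submodule.Quotient.eq (A ⊔ LinearMap.range δ)).mpr ?_)⟩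
      exact Submodule.mem_sup_right (by simpa using hz)
    · rintro ⟨y, hy⟩
      obtain ⟨y, rfl⟩ := hq y
      rw [hβq] at hy
      have := (Submodule.Quotient.eq (A ⊔ LinearMap.range δ)).mp hy
      change (y : W) - a ∈ _ at this
      obtain ⟨c, hc', d, hd, e⟩ := Submodule.mem_sup.mp this
      refine ⟨y - c, sub_mem y.2 (h hc'), -d, neg_mem hd, ?_⟩
      change (y : W) - c + -d = a
      rw [← sub_eq_add_neg, sub_sub, e, sub_sub_cancel]
  have hfφ : Module.Finite k (LinearMap.range φ) := inferInstance
  have hL : Module.Finite k (A.comap δ) ↔ Module.Finite k (A'.comap δ) := by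
    constructor
    · intro _
      have : Module.Finite k (LinearMap.ker φ) := by rw [hφ]; infer_instance
      exact finite_of_finite_ker φ
    · intro _
      exact Module.Finite.of_injective _ (Submodule.inclusion_injective hc)
  have hH : Module.Finite k (W ⧸ (A ⊔ LinearMap.range δ)) ↔
      Module.Finite k (W ⧸ (A' ⊔ LinearMap.range δ)) := by
    constructor
    · intro _
      exact Module.Finite.of_surjective γ hγ
    · intro _
      have : Module.Finite k (LinearMap.ker γ) := by rw [hγβ]; infer_instance
      exact finite_of_finite_ker γ
  refine ⟨hL, hH, fun h₁ h₂ ↦ ?_⟩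
  have := hL.mpr h₁
  have := hH.mp h₂
  have e₁ := φ.finrank_range_add_finrank_ker
  have e₂ := β.finrank_range_add_finrank_ker
  have e₃ := γ.finrank_range_add_finrank_ker
  rw [hφ, LinearMap.finrank_range_of_inj (Submodule.inclusion_injective hc)] at e₁
  rw [hβ] at e₂
  rw [hγβ, LinearMap.range_eq_top.mpr hγ, finrank_top] at e₃
  lia

end EulerCharacteristic

namespace SmoothProjectiveCurve

variable {k : Type u} [Field k] {C : SmoothProjectiveCurve k}

theorem mem_adeles {α : C.PrimeDivisor → C.FunctionField} :
    α ∈ C.adeles ↔ {x | α x ∉ C.vanishing x 0}.Finite := Iff.rfl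

variable (C) in
/-- The diagonal inclusion of the function field in the adeles. -/
noncomputable def diagonal : C.FunctionField →ₗ[k] C.adeles :=
  (LinearMap.pi fun _ ↦ LinearMap.id).codRestrict C.adeles fun f ↦ finite_notMem_vanishing f

/-- The adeles `α` with `ord_x α_x + E x ≥ 0` for all `x`. -/
noncomputable def boundedAdeles (E : C.Divisor) : Submodule k C.adeles :=
  (Submodule.pi Set.univ fun x ↦ C.vanishing x (-E x)).comap C.adeles.subtype

theorem mem_boundedAdeles {E : C.Divisor} {α : C.adeles} :
    α ∈ boundedAdeles E ↔ ∀ x, α.1 x ∈ C.vanishing x (-E x) := by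
  simp [boundedAdeles, Submodule.mem_pi]

theorem comap_diagonal_boundedAdeles (E : C.Divisor) :
    (boundedAdeles E).comap C.diagonal = C.sections E ⊤ := by
  ext f
  rw [Submodule.mem_comap, mem_boundedAdeles, mem_sections_iff]
  exact ⟨fun h x _ ↦ h x, fun h x ↦ h x trivial⟩

/-- The cohomology group `H¹(C, 𝒪(E))`, as the quotient of the adeles by the functions and the
adeles bounded by `E`. -/
abbrev divisorH1 (E : C.Divisor) : Type u :=
  C.adeles ⧸ (boundedAdeles E ⊔ LinearMap.range C.diagonal)

theorem genus_eq : C.genus = Module.finrank k (divisorH1 (0 : C.Divisor)) := by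
  have : (Submodule.pi Set.univ C.localRing ⊔
      LinearMap.range (LinearMap.pi fun _ : C.PrimeDivisor ↦
        (LinearMap.id : C.FunctionField →ₗ[k] C.FunctionField))).comap C.adeles.subtype =
      boundedAdeles (0 : C.Divisor) ⊔ LinearMap.range C.diagonal := by
    ext α
    rw [Submodule.mem_comap, Submodule.mem_sup, Submodule.mem_sup]
    constructor
    · rintro ⟨a, ha, _, ⟨f, rfl⟩, e⟩
      refine ⟨α - C.diagonal f, mem_boundedAdeles.mpr fun x ↦ ?_, _, ⟨f, rfl⟩, by simp⟩
      have : (α - C.diagonal f).1 x = a x := by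
        have := congrFun e x
        change a x + f = α.1 x at this
        change α.1 x - f = a x
        rw [← this]; ring
      rw [this, Finsupp.coe_zero, Pi.zero_apply, neg_zero]
      exact Submodule.mem_pi.mp ha x trivial
    · rintro ⟨a, ha, _, ⟨f, rfl⟩, e⟩
      refine ⟨a.1, Submodule.mem_pi.mpr fun x _ ↦ ?_, _, ⟨f, rfl⟩, congrArg Subtype.val e⟩
      have := mem_boundedAdeles.mp ha x
      rwa [Finsupp.coe_zero, Pi.zero_apply, neg_zero] at this
  exact (Submodule.quotEquivOfEq _ _ this).finrank_eq

theorem mem_adeles_of_forall_mem {E : C.Divisor} {α : C.PrimeDivisor → C.FunctionField}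
    (h : ∀ x, α x ∈ C.vanishing x (-E x)) : α ∈ C.adeles := by
  refine mem_adeles.mpr (E.support.finite_toSet.subset fun x hx ↦ ?_)
  by_contra h'
  have : E x = 0 := by simpa using h'
  refine hx ?_
  have := h x
  rwa [‹E x = 0›, neg_zero] at this

open scoped Classical in
/-- Allowing one more pole at `x` enlarges the bounded adeles by a graded piece at `x`. -/
theorem boundedAdeles_add_single (E : C.Divisor) (x : C.PrimeDivisor) :
    boundedAdeles E ≤ boundedAdeles (E + Finsupp.single x 1) ∧
    ∃ q : boundedAdeles (E + Finsupp.single x 1) →ₗ[k] C.GradedPiece x (-E x - 1),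
      Function.Surjective q ∧ ∀ α, q α = 0 ↔ α.1 ∈ boundedAdeles E := by
  have hle : boundedAdeles E ≤ boundedAdeles (E + Finsupp.single x 1) := fun α hα ↦
    mem_boundedAdeles.mpr fun y ↦ vanishing_anti y (by
      rw [Finsupp.add_apply, Finsupp.single_apply]; split_ifs <;> lia) (mem_boundedAdeles.mp hα y)
  refine ⟨hle, ?_⟩
  have hx : -(E + Finsupp.single x 1 : C.Divisor) x = -E x - 1 := by
    rw [Finsupp.add_apply, Finsupp.single_eq_same]; ring
  have hy : ∀ y, y ≠ x → -(E + Finsupp.single x 1 : C.Divisor) y = -E y := fun y hy ↦ by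
    rw [Finsupp.add_apply, Finsupp.single_eq_of_ne hy, add_zero]
  let ev : boundedAdeles (E + Finsupp.single x 1) →ₗ[k] C.vanishing x (-E x - 1) :=
    (LinearMap.proj x ∘ₗ C.adeles.subtype ∘ₗ (boundedAdeles (E + Finsupp.single x 1)).subtype)
      |>.codRestrict _ fun α ↦ hx ▸ mem_boundedAdeles.mp α.2 x
  let q : boundedAdeles (E + Finsupp.single x 1) →ₗ[k] C.GradedPiece x (-E x - 1) :=
    ((C.vanishing x (-E x - 1 + 1)).submoduleOf (C.vanishing x (-E x - 1))).mkQ ∘ₗ ev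
  have hker : ∀ α, q α = 0 ↔ α.1 ∈ boundedAdeles E := fun α ↦ by
    refine (Submodule.Quotient.mk_eq_zero
      ((C.vanishing x (-E x - 1 + 1)).submoduleOf (C.vanishing x (-E x - 1)))).trans ?_
    change α.1.1 x ∈ C.vanishing x (-E x - 1 + 1) ↔ α.1 ∈ boundedAdeles E
    rw [mem_boundedAdeles, sub_add_cancel]
    refine ⟨fun h y ↦ ?_, fun h ↦ h x⟩
    by_cases hyx : y = x
    · subst hyx; exact h
    · rw [← hy y hyx]; exact mem_boundedAdeles.mp α.2 y
  have hsurj : Function.Surjective q := by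
    refine (Submodule.mkQ_surjective _).comp fun f ↦ ?_
    have hmem : ∀ y, (Pi.single x f.1 : C.PrimeDivisor → C.FunctionField) y ∈
        C.vanishing y (-(E + Finsupp.single x 1 : C.Divisor) y) := fun y ↦ by
      by_cases hyx : y = x
      · subst hyx; rw [Pi.single_eq_same, hx]; exact f.2
      · rw [Pi.single_eq_of_ne hyx]; exact zero_mem _
    exact ⟨⟨⟨_, mem_adeles_of_forall_mem hmem⟩, mem_boundedAdeles.mpr hmem⟩,
      Subtype.ext (Pi.single_eq_same (M := fun _ ↦ C.FunctionField) x f.1)⟩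
  exact ⟨q, hsurj, hker⟩

theorem degree_add (D E : C.Divisor) : (D + E).degree = D.degree + E.degree :=
  Finsupp.sum_add_index' (fun _ ↦ by simp) fun _ _ _ ↦ by ring

theorem degree_zero : (0 : C.Divisor).degree = 0 := Finsupp.sum_zero_index

theorem degree_single (x : C.PrimeDivisor) (n : ℤ) :
    Divisor.degree (Finsupp.single x n : C.Divisor) = n * C.π.residueDegree x.1 :=
  Finsupp.sum_single_index (by simp)

theorem degree_zsmul (n : ℤ) (D : C.Divisor) : (n • D).degree = n * D.degree :=
  map_zsmul (AddMonoidHom.mk' (Divisor.degree (C := C)) degree_add) n D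

/-- Adding a point to a divisor `E` preserves the finiteness of the cohomology of `𝒪(E)` and changes
its Euler characteristic by the degree of the point. -/
theorem cohomology_add_single (E : C.Divisor) (x : C.PrimeDivisor) :
    (Module.Finite k (C.sections E ⊤) ↔
      Module.Finite k (C.sections (E + Finsupp.single x 1) ⊤)) ∧
    (Module.Finite k (divisorH1 E) ↔ Module.Finite k (divisorH1 (E + Finsupp.single x 1))) ∧
    (Module.Finite k (C.sections E ⊤) → Module.Finite k (divisorH1 E) →
      (Module.finrank k (C.sections (E + Finsupp.single x 1) ⊤) : ℤ) -
        Module.finrank k (divisorH1 (E + Finsupp.single x 1)) -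
          Divisor.degree (E + Finsupp.single x 1) =
      Module.finrank k (C.sections E ⊤) - Module.finrank k (divisorH1 E) - E.degree) := by
  obtain ⟨hle, q, hq, hqE⟩ := boundedAdeles_add_single E x
  obtain ⟨h₁, h₂, h₃⟩ := finite_and_finrank_of_le C.diagonal hle q hq hqE
  rw [comap_diagonal_boundedAdeles, comap_diagonal_boundedAdeles] at h₁ h₃
  refine ⟨h₁, h₂, fun f₁ f₂ ↦ ?_⟩
  have := h₃ (h₁.mp f₁) f₂
  rw [finrank_gradedPiece] at this
  rw [degree_add, degree_single]
  simp only [divisorH1]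
  lia

/-- Properties of divisors which are insensitive to adding a point hold for all divisors or
none. -/
theorem divisor_iff_of_add_single {P : C.Divisor → Prop}
    (h : ∀ E x, P E ↔ P (E + Finsupp.single x 1)) (E E' : C.Divisor) : P E ↔ P E' := by
  have key : ∀ E' : C.Divisor, ∀ E, P E ↔ P (E + E') := by
    intro E'
    induction E' using Finsupp.induction_linear with
    | zero => simp
    | add f g hf hg => intro E; rw [hf, hg, add_assoc]
    | single x n =>
      induction n using Int.induction_on with
      | zero => simp
      | succ i ih => intro E; rw [ih, h _ x, add_assoc, ← Finsupp.single_add]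
      | pred i ih => intro E; rw [ih, h (E + Finsupp.single x (-(i : ℤ) - 1)) x, add_assoc,
          ← Finsupp.single_add, sub_add_cancel]
  rw [key (E' - E) E, add_sub_cancel]

/-- The group `H¹(C, 𝒪(E))` is finite-dimensional, as it vanishes for some divisor. -/
theorem finite_divisorH1 (x₀ : C.PrimeDivisor) (E : C.Divisor) : Module.Finite k (divisorH1 E) := by
  obtain ⟨E₀, h⟩ := exists_forall_sub_mem x₀
  refine (divisor_iff_of_add_single (fun E x ↦ (cohomology_add_single E x).2.1) E₀ E).mp ?_
  have : boundedAdeles E₀ ⊔ LinearMap.range C.diagonal = ⊤ := by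
    rw [eq_top_iff]
    intro α _
    obtain ⟨g, hg⟩ := h α.1 (mem_adeles.mp α.2)
    rw [← sub_add_cancel α (C.diagonal g)]
    exact Submodule.add_mem_sup (mem_boundedAdeles.mpr hg) ⟨g, rfl⟩
  have : Subsingleton (divisorH1 E₀) := Submodule.Quotient.subsingleton_iff.mpr this
  infer_instance

theorem finite_sections_of_finite (h : Module.Finite k (C.sections 0 ⊤)) (E : C.Divisor) :
    Module.Finite k (C.sections E ⊤) :=
  (divisor_iff_of_add_single (fun E x ↦ (cohomology_add_single E x).1) 0 E).mp h

/-- The Riemann–Roch theorem without duality: `χ(𝒪(E)) - deg E` does not depend on `E`. -/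
theorem euler_eq (x₀ : C.PrimeDivisor) (h : Module.Finite k (C.sections 0 ⊤)) (E : C.Divisor) :
    (Module.finrank k (C.sections E ⊤) : ℤ) - Module.finrank k (divisorH1 E) - E.degree =
      Module.finrank k (C.sections 0 ⊤) - C.genus := by
  refine (divisor_iff_of_add_single (P := fun E : C.Divisor ↦
    (Module.finrank k (C.sections E ⊤) : ℤ) - Module.finrank k (divisorH1 E) - E.degree =
      Module.finrank k (C.sections 0 ⊤) - C.genus) (fun E x ↦ ?_) 0 E).mp ?_
  · rw [(cohomology_add_single E x).2.2 (finite_sections_of_finite h E) (finite_divisorH1 x₀ E)]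
  · rw [genus_eq, degree_zero, sub_zero]

end SmoothProjectiveCurve

/-! ### Riemann's inequality and the dimension of the Hitchin base -/

namespace SmoothProjectiveCurve

variable {k : Type u} [Field k] {C : SmoothProjectiveCurve k}

theorem exists_algebraMap_stalk_eq {U : C.scheme.Opens} {f : C.FunctionField}
    (hf : f ∈ C.sections 0 U) {y : C.scheme} (hy : y ∈ U) :
    ∃ a : C.scheme.presheaf.stalk y,
      algebraMap (C.scheme.presheaf.stalk y) C.FunctionField a = f := by
  by_cases h : Order.coheight y = 1
  · obtain ⟨x, rfl⟩ : ∃ x : C.PrimeDivisor, x.1 = y := ⟨⟨y, h⟩, rfl⟩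
    have := (mem_sections_iff.mp hf) x hy
    rw [Finsupp.coe_zero, Pi.zero_apply, neg_zero] at this
    exact mem_vanishing_zero_iff.mp this
  have h0 : Order.coheight y = 0 := by
    have := C.coheight_le_one y
    by_contra h'
    exact h (le_antisymm this (Order.one_le_iff_pos.mpr (pos_iff_ne_zero.mpr h')))
  have hle : y ≤ genericPoint C.scheme :=
    Scheme.le_iff_specializes.mpr ((genericPoint_spec C.scheme).specializes trivial)
  have : y = genericPoint C.scheme := ((Scheme.le_iff_specializes.mp
    (Order.coheight_eq_zero.mp h0 hle)).antisymm (Scheme.le_iff_specializes.mp hle)).eq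
  subst this
  refine ⟨f, ?_⟩
  exact ConcreteCategory.congr_hom (C.scheme.presheaf.stalkSpecializes_refl _) f

/-- A rational function without poles on `U` is a section of the structure sheaf on `U`. -/
theorem exists_germHom_eq {U : C.scheme.Opens} (hη : genericPoint C.scheme ∈ U)
    {f : C.FunctionField} (hf : f ∈ C.sections 0 U) : ∃ s, germHom U hη s = f := by
  have key : ∀ y : U, ∃ (V : C.scheme.Opens) (hV : genericPoint C.scheme ∈ V) (_ : y.1 ∈ V)
      (_ : V ≤ U) (s : Γ(C.scheme, V)), germHom V hV s = f := by
    rintro ⟨y, hy⟩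
    obtain ⟨a, rfl⟩ := exists_algebraMap_stalk_eq hf hy
    obtain ⟨V, hyV, s, rfl⟩ := C.scheme.presheaf.exists_germ_eq a
    have hW : y ∈ V ⊓ U := ⟨hyV, hy⟩
    refine ⟨V ⊓ U, genericPoint_mem (by intro h; rw [h] at hW; exact hW), hW, inf_le_right,
      C.scheme.presheaf.map (homOfLE inf_le_left).op s, ?_⟩
    have : Nonempty (V : C.scheme.Opens) := ⟨⟨y, hyV⟩⟩
    have e := Scheme.algebraMap_germ_eq_germToFunctionField C.scheme hyV s
    refine Eq.trans ?_ e.symm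
    exact C.scheme.presheaf.germ_res_apply (homOfLE inf_le_left) _ _ s
  choose V hV hyV hVU s hs using key
  obtain ⟨t, ht, -⟩ := C.scheme.sheaf.existsUnique_gluing' V U (fun y ↦ homOfLE (hVU y))
    (fun y hy ↦ TopologicalSpace.Opens.mem_iSup.mpr ⟨⟨y, hy⟩, hyV ⟨y, hy⟩⟩) s fun y z ↦ by
      refine germHom_injective (V y ⊓ V z) ⟨hV y, hV z⟩ ?_
      have h₁ : germHom (V y ⊓ V z) ⟨hV y, hV z⟩
          (C.scheme.presheaf.map (homOfLE inf_le_left).op (s y)) = germHom (V y) (hV y) (s y) :=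
        C.scheme.presheaf.germ_res_apply (homOfLE inf_le_left) _ _ _
      have h₂ : germHom (V y ⊓ V z) ⟨hV y, hV z⟩
          (C.scheme.presheaf.map (homOfLE inf_le_right).op (s z)) = germHom (V z) (hV z) (s z) :=
        C.scheme.presheaf.germ_res_apply (homOfLE inf_le_right) _ _ _
      rw [hs] at h₁ h₂
      exact h₁.trans h₂.symm
  refine ⟨t, ?_⟩
  have := ht ⟨_, hη⟩
  rw [← hs ⟨_, hη⟩, ← this]
  exact (C.scheme.presheaf.germ_res_apply (homOfLE (hVU ⟨_, hη⟩)) _ (hV ⟨_, hη⟩) t).symm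

/-- The space `H⁰(C, 𝒪)` is finite-dimensional, as the curve is proper. -/
theorem finite_sections_zero : Module.Finite k (C.sections 0 ⊤) := by
  have h : Module.Finite k Γ(C.scheme, ⊤) := by
    have h₁ : (algebraMap k Γ(C.scheme, ⊤)).Finite := by
      rw [algebraMap_sections]
      have e : C.π.appLE ⊤ ⊤ le_top = C.π.appTop := C.π.appLE_eq_app
      rw [e]
      refine (finite_appTop_of_universallyClosed k C.π).comp (RingHom.Finite.of_surjective _ ?_)
      exact (Scheme.ΓSpecIso (.of k)).symm.commRingCatIsoToRingEquiv.surjective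
    exact h₁
  let φ : Γ(C.scheme, ⊤) →ₗ[k] C.FunctionField :=
    { toFun := germHom ⊤ trivial
      map_add' := map_add _
      map_smul' c s := by
        rw [Algebra.smul_def, map_mul, RingHom.id_apply, Algebra.smul_def, algebraMap_functionField]
        rfl }
  have : C.sections 0 ⊤ ≤ LinearMap.range φ := fun f hf ↦
    exists_germHom_eq (U := ⊤) trivial hf
  have hfin : Module.Finite k (LinearMap.range φ) := inferInstance
  exact Submodule.finiteDimensional_of_le this

theorem finite_sections (E : C.Divisor) : Module.Finite k (C.sections E ⊤) :=
  finite_sections_of_finite finite_sections_zero E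

instance (D : C.Divisor) (r : ℕ) : Module.Finite k (HitchinBase D r) :=
  have (i : Fin r) := finite_sections (((i : ℤ) + 1) • D)
  inferInstance

theorem one_le_finrank_sections_zero : 1 ≤ Module.finrank k (C.sections 0 ⊤) := by
  have := finite_sections_zero (C := C)
  refine Module.finrank_pos_iff_exists_ne_zero.mpr ⟨⟨1, one_mem_sections ⊤⟩, fun h ↦ ?_⟩
  exact one_ne_zero (congrArg Subtype.val h)

/-- Riemann's inequality. -/
theorem degree_add_one_sub_genus_le (x₀ : C.PrimeDivisor) (E : C.Divisor) :
    E.degree + 1 - C.genus ≤ Module.finrank k (C.sections E ⊤) := by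
  have h := euler_eq x₀ finite_sections_zero E
  have := one_le_finrank_sections_zero (C := C)
  lia

/-- The dimension of `H⁰(C, 𝒪(iD))`. -/
noncomputable abbrev h0 (D : C.Divisor) (i : ℕ) : ℕ := Module.finrank k (C.sections ((i : ℤ) • D) ⊤)

theorem exists_primeDivisor_of_degree_pos {D : C.Divisor} (h : 0 < D.degree) :
    Nonempty C.PrimeDivisor := by
  by_contra hne
  rw [not_nonempty_iff] at hne
  rw [Subsingleton.elim D 0, degree_zero] at h
  exact h.false

/-- As `deg D > 0` and `deg D ≥ 2g - 1`, also `deg D ≥ g`. -/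
theorem one_le_h0 {D : C.Divisor} (hD : 2 * (C.genus : ℤ) - 2 < D.degree) (hD0 : 0 < D.degree) :
    1 ≤ h0 D 1 := by
  obtain ⟨x₀⟩ := exists_primeDivisor_of_degree_pos hD0
  have := degree_add_one_sub_genus_le x₀ (((1 : ℕ) : ℤ) • D)
  rw [degree_zsmul] at this
  simp only [h0]
  lia

theorem two_le_h0 {D : C.Divisor} (hD : 2 * (C.genus : ℤ) - 2 < D.degree) (hD0 : 0 < D.degree) :
    2 ≤ h0 D 2 := by
  obtain ⟨x₀⟩ := exists_primeDivisor_of_degree_pos hD0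
  have := degree_add_one_sub_genus_le x₀ (((2 : ℕ) : ℤ) • D)
  rw [degree_zsmul] at this
  simp only [h0]
  lia

/-- Multiplication by a nonzero section of `𝒪(D)` embeds `H⁰(C, 𝒪(iD))` in `H⁰(C, 𝒪((i + 1)D))`. -/
theorem h0_mono {D : C.Divisor} (hD : 2 * (C.genus : ℤ) - 2 < D.degree) (hD0 : 0 < D.degree) :
    Monotone (h0 D) := by
  refine monotone_nat_of_le_succ fun i ↦ ?_
  have := finite_sections (((i + 1 : ℕ) : ℤ) • D)
  have h1 := one_le_h0 hD hD0
  have := finite_sections (((1 : ℕ) : ℤ) • D)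
  obtain ⟨⟨s, hs⟩, hs0⟩ := Module.finrank_pos_iff_exists_ne_zero.mp (Nat.lt_of_succ_le h1)
  have hs0 : s ≠ 0 := fun h ↦ hs0 (Subtype.ext h)
  let φ : C.sections ((i : ℤ) • D) ⊤ →ₗ[k] C.sections (((i + 1 : ℕ) : ℤ) • D) ⊤ :=
    ((LinearMap.mulLeft k s).restrict fun f hf ↦ by
      have := mul_mem_sections hs hf
      rw [← add_smul] at this
      rwa [← Nat.cast_add, add_comm 1 i] at this)
  refine LinearMap.finrank_le_finrank_of_injective (f := φ) fun f g h ↦ ?_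
  have : s * f = s * g := congrArg Subtype.val h
  exact Subtype.ext (mul_left_cancel₀ hs0 this)

theorem finrank_hitchinBase (D : C.Divisor) (r : ℕ) :
    Module.finrank k (HitchinBase D r) = ∑ i ∈ Finset.range r, h0 D (i + 1) := by
  have (i : Fin r) := finite_sections (((i : ℤ) + 1) • D)
  rw [Module.finrank_pi_fintype, Finset.sum_range]
  refine Finset.sum_congr rfl fun i _ ↦ ?_
  simp only [h0]
  push_cast
  rfl

/-- The polynomials `Q²R` with `Q` of positive degree depend on at least two parameters less than
the general polynomial of the same degree. -/
theorem finrank_hitchinBase_add_two_le {D : C.Divisor} (hD : 2 * (C.genus : ℤ) - 2 < D.degree)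
    (hD0 : 0 < D.degree) {r m : ℕ} (hm : 1 ≤ m) (hmr : 2 * m ≤ r) :
    Module.finrank k (HitchinBase D m) + Module.finrank k (HitchinBase D (r - 2 * m)) + 2 ≤
      Module.finrank k (HitchinBase D r) := by
  obtain ⟨l, rfl⟩ := Nat.exists_eq_add_of_le hmr
  rw [Nat.add_sub_cancel_left, finrank_hitchinBase, finrank_hitchinBase, finrank_hitchinBase,
    add_comm (2 * m) l, Finset.sum_range_add, two_mul, Finset.sum_range_add _ m m]
  have hmono := h0_mono hD hD0
  have h₁ : ∑ i ∈ Finset.range m, h0 D (i + 1) ≤ ∑ i ∈ Finset.range m, h0 D (l + i + 1) :=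
    Finset.sum_le_sum fun i _ ↦ hmono (by lia)
  have h₂ : 2 ≤ ∑ i ∈ Finset.range m, h0 D (l + (m + i) + 1) := by
    refine (two_le_h0 hD hD0).trans ((hmono (by lia : 2 ≤ l + (m + 0) + 1)).trans ?_)
    exact Finset.single_le_sum (f := fun i ↦ h0 D (l + (m + i) + 1)) (fun _ _ ↦ Nat.zero_le _)
      (Finset.mem_range.mpr hm)
  simp only [add_assoc] at *
  lia

end SmoothProjectiveCurve

/-! ### Base change of the curve and integral closure -/

section BaseChange

/-- `S ⊗ M⁻¹A` is the localization of `S ⊗ A` at the image of `M`. -/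
theorem isLocalization_tensorProduct_map {k : Type*} [CommRing k] (S : Type*) {A B : Type*}
    [CommRing S] [CommRing A] [CommRing B] [Algebra k S] [Algebra k A] [Algebra k B] [Algebra A B]
    [IsScalarTower k A B] (M : Submonoid A) [IsLocalization M B] :
    letI := (Algebra.TensorProduct.map (AlgHom.id S S)
      (IsScalarTower.toAlgHom k A B)).toRingHom.toAlgebra
    IsLocalization (M.map (Algebra.TensorProduct.includeRight (R := k) (A := S) (B := A)))
      (S ⊗[k] B) := by
  let _ := (Algebra.TensorProduct.map (AlgHom.id S S)
      (IsScalarTower.toAlgHom k A B)).toRingHom.toAlgebra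
  have : IsScalarTower S (S ⊗[k] A) (S ⊗[k] B) :=
    .of_algebraMap_eq' (Algebra.TensorProduct.map (AlgHom.id S S)
      (IsScalarTower.toAlgHom k A B)).comp_algebraMap.symm
  refine IsLocalization.tensorProduct_tensorProduct_right k S M B ?_
  ext a
  change Algebra.TensorProduct.map (AlgHom.id S S) (IsScalarTower.toAlgHom k A B) (1 ⊗ₜ a) = _
  simp

theorem includeRight_injective_of_field {k : Type*} [Field k] (S A : Type*) [CommRing S]
    [CommRing A] [Algebra k S] [Algebra k A] [Nontrivial S] :
    Function.Injective (Algebra.TensorProduct.includeRight : A →ₐ[k] S ⊗[k] A) :=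
  Algebra.TensorProduct.includeRight_injective (algebraMap k S).injective

theorem map_includeRight_le_nonZeroDivisors {k : Type*} [Field k] (S : Type*) {A : Type*}
    [CommRing S] [CommRing A] [Algebra k S] [Algebra k A] [IsDomain (S ⊗[k] A)] [Nontrivial S]
    {M : Submonoid A} (hM : 0 ∉ M) :
    M.map (Algebra.TensorProduct.includeRight (R := k) (A := S) (B := A)) ≤
      nonZeroDivisors (S ⊗[k] A) := by
  rintro _ ⟨a, ha, rfl⟩
  refine mem_nonZeroDivisors_of_ne_zero fun h ↦ hM ?_
  have h : (Algebra.TensorProduct.includeRight : A →ₐ[k] S ⊗[k] A) a = 0 := h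
  rw [map_eq_zero_iff _ (includeRight_injective_of_field S A)] at h
  rwa [← h]

theorem isDomain_tensorProduct_of_isLocalization {k : Type*} [Field k] (S : Type*) {A B : Type*}
    [CommRing S] [CommRing A] [CommRing B] [Algebra k S] [Algebra k A] [Algebra k B] [Algebra A B]
    [IsScalarTower k A B] (M : Submonoid A) [IsLocalization M B] [IsDomain (S ⊗[k] A)]
    [Nontrivial S] (hM : 0 ∉ M) : IsDomain (S ⊗[k] B) := by
  let _ := (Algebra.TensorProduct.map (AlgHom.id S S)
      (IsScalarTower.toAlgHom k A B)).toRingHom.toAlgebra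
  have := isLocalization_tensorProduct_map (k := k) S (B := B) M
  exact IsLocalization.isDomain_of_le_nonZeroDivisors _
    (map_includeRight_le_nonZeroDivisors (k := k) (A := A) S hM)

theorem isIntegrallyClosed_tensorProduct_of_isLocalization {k : Type*} [Field k] (S : Type*)
    {A B : Type*} [CommRing S] [CommRing A] [CommRing B] [Algebra k S] [Algebra k A] [Algebra k B]
    [Algebra A B] [IsScalarTower k A B] (M : Submonoid A) [IsLocalization M B]
    [IsDomain (S ⊗[k] A)] [IsIntegrallyClosed (S ⊗[k] A)] [Nontrivial S] (hM : 0 ∉ M) :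
    IsIntegrallyClosed (S ⊗[k] B) := by
  let _ := (Algebra.TensorProduct.map (AlgHom.id S S)
      (IsScalarTower.toAlgHom k A B)).toRingHom.toAlgebra
  have := isLocalization_tensorProduct_map (k := k) S (B := B) M
  exact isIntegrallyClosed_of_isLocalization _ _
    (map_includeRight_le_nonZeroDivisors (k := k) (A := A) S hM)

theorem isIntegrallyClosed_of_isPrincipal_maximalIdeal {B : Type*} [CommRing B] [IsDomain B]
    [IsNoetherianRing B] (h : ∀ (q : Ideal B) [q.IsPrime],
      (IsLocalRing.maximalIdeal (Localization.AtPrime q)).IsPrincipal) : IsIntegrallyClosed B := by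
  refine IsIntegrallyClosed.of_localization_maximal fun p _ _ ↦ ?_
  have : IsNoetherianRing (Localization.AtPrime p) :=
    IsLocalization.isNoetherianRing p.primeCompl _ inferInstance
  by_cases hf : IsField (Localization.AtPrime p)
  · exact hf.toField.instIsIntegrallyClosed
  have := ((IsDiscreteValuationRing.TFAE _ hf).out 4 2).mp (h p)
  exact this.toIsDedekindRing.toIsIntegralClosure

/-- The isomorphism `(S ⊗ₖ B) ⊗ₛ T ≃ T ⊗ₖ B`. -/
noncomputable def tensorProductTensorProductEquiv (k S T B : Type*) [CommRing k] [CommRing S]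
    [CommRing T] [CommRing B] [Algebra k S] [Algebra k T] [Algebra k B] [Algebra S T]
    [IsScalarTower k S T] : (S ⊗[k] B) ⊗[S] T ≃ₐ[S] T ⊗[k] B :=
  (Algebra.TensorProduct.comm S _ _).trans
    ((Algebra.TensorProduct.cancelBaseChange k S S T B))

theorem tensorProductTensorProductEquiv_tmul {k S T B : Type*} [CommRing k] [CommRing S]
    [CommRing T] [CommRing B] [Algebra k S] [Algebra k T] [Algebra k B] [Algebra S T]
    [IsScalarTower k S T] (s : S) (b : B) (t : T) :
    tensorProductTensorProductEquiv k S T B ((s ⊗ₜ b) ⊗ₜ t) = (s • t) ⊗ₜ b := by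
  simp [tensorProductTensorProductEquiv]

/-- Integral closure commutes with the base change to a localization of a smooth `k`-algebra. -/
theorem exists_of_isIntegral_tensorProduct {k : Type*} [Field k] {S T A B : Type*} [CommRing S]
    [CommRing T] [CommRing A] [CommRing B] [Algebra k S] [Algebra k T] [Algebra k A] [Algebra k B]
    [Algebra A B] [IsScalarTower k A B] (M : Submonoid A) [IsLocalization M B] [Algebra S T]
    [IsScalarTower k S T] [Algebra.Smooth k A] {w : T ⊗[k] B}
    (hw : (Algebra.TensorProduct.map (IsScalarTower.toAlgHom k S T) (AlgHom.id k B)).IsIntegralElem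
      w) :
    ∃ w' : integralClosure S T ⊗[k] B,
      Algebra.TensorProduct.map ((integralClosure S T).val.restrictScalars k) (AlgHom.id k B) w' =
        w := by
  let _ := (Algebra.TensorProduct.map (AlgHom.id S S)
      (IsScalarTower.toAlgHom k A B)).toRingHom.toAlgebra
  have : IsScalarTower S (S ⊗[k] A) (S ⊗[k] B) :=
    .of_algebraMap_eq' (Algebra.TensorProduct.map (AlgHom.id S S)
      (IsScalarTower.toAlgHom k A B)).comp_algebraMap.symm
  have := isLocalization_tensorProduct_map (k := k) S (B := B) M
  have hbij : Function.Bijective (TensorProduct.toIntegralClosure S (S ⊗[k] B) T) :=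
    TensorProduct.toIntegralClosure_bijective_of_tower (S := S ⊗[k] A)
      TensorProduct.toIntegralClosure_bijective_of_smooth
      (TensorProduct.toIntegralClosure_bijective_of_isLocalization
        (M.map (Algebra.TensorProduct.includeRight (R := k) (A := S) (B := A))))
  let e := tensorProductTensorProductEquiv k S T B
  have he : ∀ x : S ⊗[k] B, e (algebraMap (S ⊗[k] B) ((S ⊗[k] B) ⊗[S] T) x) =
      Algebra.TensorProduct.map (IsScalarTower.toAlgHom k S T) (AlgHom.id k B) x := fun x ↦ by
    induction x with
    | zero => simp
    | add x y hx hy => rw [map_add, map_add, hx, hy, map_add]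
    | tmul s b =>
      refine (tensorProductTensorProductEquiv_tmul s b (1 : T)).trans ?_
      simp [Algebra.smul_def]
  have hint : IsIntegral (S ⊗[k] B) (e.symm w) := by
    obtain ⟨p, hp, hpw⟩ := hw
    refine ⟨p, hp, e.injective ?_⟩
    rw [map_zero, ← hpw]
    refine (hom_eval₂ p _ (RingHomClass.toRingHom e) _).trans ?_
    exact congrArg₂ (fun f x ↦ p.eval₂ f x) (RingHom.ext he) (e.apply_symm_apply w)
  have key : ∀ y : (S ⊗[k] B) ⊗[S] integralClosure S T,
      Algebra.TensorProduct.map ((integralClosure S T).val.restrictScalars k) (AlgHom.id k B)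
        (tensorProductTensorProductEquiv k S (integralClosure S T) B y) =
      e (TensorProduct.toIntegralClosure S (S ⊗[k] B) T y) := fun y ↦ by
    induction y with
    | zero => simp
    | add x y hx hy => simp only [map_add, Subalgebra.coe_add, hx, hy]
    | tmul x t =>
      induction x with
      | zero => simp
      | add x y hx hy => simp only [TensorProduct.add_tmul, map_add, Subalgebra.coe_add, hx, hy]
      | tmul s b =>
        rw [tensorProductTensorProductEquiv_tmul]
        exact (tensorProductTensorProductEquiv_tmul s b (t : T)).symm
  obtain ⟨y, hy⟩ := hbij.2 ⟨e.symm w, hint⟩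
  refine ⟨_, (key y).trans ?_⟩
  rw [hy]
  exact e.apply_symm_apply w

end BaseChange

namespace SmoothProjectiveCurve

variable {k : Type u} [Field k] {C : SmoothProjectiveCurve k}

theorem fromSpec_comp_π {V : C.scheme.Opens} (hV : IsAffineOpen V) :
    hV.fromSpec ≫ C.π = Spec.map (CommRingCat.ofHom (algebraMap k Γ(C.scheme, V))) := by
  rw [← IsAffineOpen.SpecMap_appLE_fromSpec C.π (isAffineOpen_top _) hV le_top,
    IsAffineOpen.fromSpec_top, Scheme.isoSpec_Spec_inv, ← Spec.map_comp]
  rfl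

/-- The base change to `F` of a nonempty affine open subset of the curve is integral, as it is open
in the base change of a geometrically integral curve. -/
theorem isDomain_tensorProduct_sections (F : Type u) [Field F] [Algebra k F] {V : C.scheme.Opens}
    (hV : IsAffineOpen V) [Nonempty V] : IsDomain (F ⊗[k] Γ(C.scheme, V)) := by
  have h := pullback_of_geometrically'
    (GeometricallyIntegral.geometrically_isIntegral (f := C.π)) F
    (Spec.map (CommRingCat.ofHom (algebraMap k F)))
  have := h
  let g := pullback.map (Spec.map (CommRingCat.ofHom (algebraMap k F)))
    (Spec.map (CommRingCat.ofHom (algebraMap k Γ(C.scheme, V))))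
    (Spec.map (CommRingCat.ofHom (algebraMap k F))) C.π (𝟙 _) hV.fromSpec (𝟙 _) (by simp)
    (by rw [fromSpec_comp_π]; simp)
  let e := pullbackSpecIso k F Γ(C.scheme, V)
  have hg : IsOpenImmersion (e.inv ≫ g) := inferInstance
  have : Nontrivial (F ⊗[k] Γ(C.scheme, V)) := inferInstance
  have : IsIntegral (Spec (.of (F ⊗[k] Γ(C.scheme, V)))) :=
    isIntegral_of_isOpenImmersion (e.inv ≫ g)
  exact (affine_isIntegral_iff _).mp this

/-- The stalk at a point as a localization of the functions on an affine neighbourhood. -/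
theorem exists_isLocalization_stalk (y : C.scheme) {V : C.scheme.Opens} (hV : IsAffineOpen V)
    (hy : y ∈ V) : ∃ (M : Submonoid Γ(C.scheme, V)) (_ : Algebra Γ(C.scheme, V)
      (C.scheme.presheaf.stalk y)), 0 ∉ M ∧
      IsScalarTower k Γ(C.scheme, V) (C.scheme.presheaf.stalk y) ∧
      IsLocalization M (C.scheme.presheaf.stalk y) := by
  let _ := TopCat.Presheaf.algebra_section_stalk C.scheme.presheaf (U := V) ⟨y, hy⟩
  refine ⟨(hV.primeIdealOf ⟨y, hy⟩).asIdeal.primeCompl, inferInstance, fun h ↦ h (zero_mem _),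
    .of_algebraMap_eq fun c ↦ (germ_algebraMap y hy c).symm, hV.isLocalization_stalk ⟨y, hy⟩⟩

/-- The function field as a localization of the functions on an affine open. -/
theorem exists_isLocalization_functionField {V : C.scheme.Opens} (hV : IsAffineOpen V)
    (hη : genericPoint C.scheme ∈ V) : ∃ (M : Submonoid Γ(C.scheme, V)) (_ : Algebra Γ(C.scheme, V)
      C.FunctionField), 0 ∉ M ∧ IsScalarTower k Γ(C.scheme, V) C.FunctionField ∧
      IsLocalization M C.FunctionField := by
  have : Nonempty V := ⟨⟨_, hη⟩⟩
  let _ : Algebra Γ(C.scheme, V) C.FunctionField := (germHom V hη).toAlgebra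
  refine ⟨nonZeroDivisors _, inferInstance, zero_notMem_nonZeroDivisors,
    .of_algebraMap_eq fun c ↦ ?_, functionField_isFractionRing_of_isAffineOpen C.scheme V hV⟩
  rw [algebraMap_functionField]
  exact (germ_algebraMap (C := C) (U := ⊤) _ trivial c).trans (germ_algebraMap _ hη c).symm

section Field

variable (F : Type u) [Field F] [Algebra k F]

/-- The curve over an extension `F` of `k` is normal, being smooth of dimension one. -/
theorem exists_isDomain_isIntegrallyClosed (y : C.scheme) :
    ∃ V : C.scheme.Opens, IsAffineOpen V ∧ y ∈ V ∧
      IsDomain (F ⊗[k] Γ(C.scheme, V)) ∧ IsIntegrallyClosed (F ⊗[k] Γ(C.scheme, V)) := by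
  obtain ⟨V, hV, hy, _⟩ := exists_isStandardSmooth y
  have : Nonempty V := ⟨⟨y, hy⟩⟩
  have := isDomain_tensorProduct_sections F hV
  have : Algebra.IsStandardSmooth F (F ⊗[k] Γ(C.scheme, V)) :=
    Algebra.IsStandardSmoothOfRelativeDimension.isStandardSmooth 1
  have : IsNoetherianRing (F ⊗[k] Γ(C.scheme, V)) :=
    Algebra.FiniteType.isNoetherianRing F _
  exact ⟨V, hV, hy, inferInstance, isIntegrallyClosed_of_isPrincipal_maximalIdeal fun q _ ↦
      isPrincipal_maximalIdeal_of_smooth (k := F) q⟩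

theorem isDomain_and_isIntegrallyClosed_stalk (y : C.scheme) :
    IsDomain (F ⊗[k] C.scheme.presheaf.stalk y) ∧
      IsIntegrallyClosed (F ⊗[k] C.scheme.presheaf.stalk y) := by
  obtain ⟨V, hV, hy, h⟩ := exists_isDomain_isIntegrallyClosed F y
  obtain ⟨M, _, hM, _, _⟩ := exists_isLocalization_stalk y hV hy
  obtain ⟨_, _⟩ := h
  exact ⟨isDomain_tensorProduct_of_isLocalization F M hM,
    isIntegrallyClosed_tensorProduct_of_isLocalization F M hM⟩

theorem isDomain_and_isIntegrallyClosed_functionField :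
    IsDomain (F ⊗[k] C.FunctionField) ∧ IsIntegrallyClosed (F ⊗[k] C.FunctionField) := by
  obtain ⟨V, hV, hy, h⟩ := exists_isDomain_isIntegrallyClosed F (genericPoint C.scheme)
  obtain ⟨M, _, hM, _, _⟩ := exists_isLocalization_functionField hV hy
  obtain ⟨_, _⟩ := h
  exact ⟨isDomain_tensorProduct_of_isLocalization F M hM,
    isIntegrallyClosed_tensorProduct_of_isLocalization F M hM⟩

end Field

/-- The ring `T ⊗ K(C)` is a domain if `T` is, as `C` is geometrically integral. -/
instance (T : Type u) [CommRing T] [IsDomain T] [Algebra k T] :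
    IsDomain (C.RelFunctionField T) := by
  have h : IsDomain (FractionRing T ⊗[k] C.FunctionField) :=
    (isDomain_and_isIntegrallyClosed_functionField (FractionRing T)).1
  have hinj : Function.Injective (Algebra.TensorProduct.map
      (IsScalarTower.toAlgHom k T (FractionRing T)) (AlgHom.id k C.FunctionField)) :=
    Module.Flat.rTensor_preserves_injective_linearMap (M := C.FunctionField)
      (IsScalarTower.toAlgHom k T (FractionRing T)).toLinearMap (IsFractionRing.injective _ _)
  exact hinj.isDomain (Algebra.TensorProduct.map
      (IsScalarTower.toAlgHom k T (FractionRing T)) (AlgHom.id k C.FunctionField)).toRingHom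

/-- The elements of `T ⊗ K(C)` which are integral over `S ⊗ K(C)` come from `T' ⊗ K(C)`, for `T'`
the integral closure of `S` in `T`. -/
theorem exists_of_isIntegral_relFunctionField {S T : Type u} [CommRing S]
    [CommRing T] [Algebra k S] [Algebra k T] [Algebra S T] [IsScalarTower k S T]
    {w : T ⊗[k] C.FunctionField}
    (hw : (Algebra.TensorProduct.map (IsScalarTower.toAlgHom k S T)
      (AlgHom.id k C.FunctionField)).IsIntegralElem w) :
    ∃ w' : integralClosure S T ⊗[k] C.FunctionField,
      Algebra.TensorProduct.map ((integralClosure S T).val.restrictScalars k)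
        (AlgHom.id k C.FunctionField) w' = w := by
  obtain ⟨V, hV, hy, _⟩ := exists_isStandardSmooth (genericPoint C.scheme)
  obtain ⟨M, _, -, _, _⟩ := exists_isLocalization_functionField hV hy
  have : Algebra.IsStandardSmooth k Γ(C.scheme, V) :=
    Algebra.IsStandardSmoothOfRelativeDimension.isStandardSmooth 1
  exact exists_of_isIntegral_tensorProduct M hw

end SmoothProjectiveCurve

/-! ### Coordinates in `S ⊗ K(C)` -/

namespace SmoothProjectiveCurve

variable {k : Type u} [Field k] {C : SmoothProjectiveCurve k}

section Slices

variable {S : Type u} [CommRing S] [Algebra k S]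

/-- The map `S ⊗ K(C) → K(C)` induced by a linear form on `S`. -/
noncomputable def slice (l : S →ₗ[k] k) : C.RelFunctionField S →+ C.FunctionField :=
  (TensorProduct.lid k C.FunctionField ∘ₗ l.rTensor C.FunctionField).toAddMonoidHom

theorem slice_tmul (l : S →ₗ[k] k) (s : S) (f : C.FunctionField) :
    slice l (s ⊗ₜ[k] f : S ⊗[k] C.FunctionField) = l s • f := by
  change TensorProduct.lid k C.FunctionField (l.rTensor C.FunctionField (s ⊗ₜ f)) = _
  simp

theorem tmul_eq_smul_relMap (s : S) (f : C.FunctionField) :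
    (s ⊗ₜ[k] f : S ⊗[k] C.FunctionField) = s • relMap S f := by
  change s ⊗ₜ[k] f = s • ((1 : S) ⊗ₜ[k] f)
  rw [TensorProduct.smul_tmul', smul_eq_mul, mul_one]

theorem relFunctionField_induction {P : C.RelFunctionField S → Prop} (w : C.RelFunctionField S)
    (smul : ∀ (s : S) (f : C.FunctionField), P (s • relMap S f))
    (add : ∀ x y, P x → P y → P (x + y)) : P w := by
  induction w using TensorProduct.induction_on with
  | zero => exact (zero_smul S (relMap S (0 : C.FunctionField))) ▸ smul 0 0
  | add x y hx hy => exact add x y hx hy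
  | tmul s f => exact tmul_eq_smul_relMap s f ▸ smul s f

theorem slice_smul_relMap (l : S →ₗ[k] k) (s : S) (f : C.FunctionField) :
    slice l (s • relMap S f) = l s • f := by
  rw [← tmul_eq_smul_relMap, slice_tmul]

theorem slice_relMap_mul (l : S →ₗ[k] k) (g : C.FunctionField) (w : C.RelFunctionField S) :
    slice l (relMap S g * w) = g * slice l w := by
  induction w using relFunctionField_induction with
  | add x y hx hy => rw [mul_add, map_add, map_add, mul_add, hx, hy]
  | smul s f =>
    rw [mul_smul_comm, ← map_mul, slice_smul_relMap, slice_smul_relMap, mul_smul_comm]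

/-- An element of `S ⊗ K(C)` is in the span of a subspace of `K(C)` if and only if its images under
the linear forms on `S` are in the subspace. -/
theorem mem_span_relMap_iff {N : Submodule k C.FunctionField} {w : C.RelFunctionField S} :
    w ∈ Submodule.span S (relMap S '' (N : Set C.FunctionField)) ↔
      ∀ l : S →ₗ[k] k, slice l w ∈ N := by
  constructor
  · intro hw l
    have key : ∀ s : S, slice l (s • w) ∈ N := by
      induction hw using Submodule.span_induction with
      | mem w hw =>
        obtain ⟨f, hf, rfl⟩ := hw
        intro s
        rw [← tmul_eq_smul_relMap, slice_tmul]
        exact N.smul_mem _ hf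
      | zero => intro s; rw [smul_zero, map_zero]; exact zero_mem _
      | add x y _ _ hx hy => intro s; rw [smul_add, map_add]; exact add_mem (hx s) (hy s)
      | smul t x _ hx => intro s; rw [smul_smul]; exact hx _
    simpa using key 1
  · intro h
    -- the coordinates in a basis of `S` are the images under the coordinate forms
    let ε := Module.Basis.ofVectorSpace k S
    obtain ⟨c, hc⟩ := TensorProduct.eq_repr_basis_left ε w
    have hc' : (c.sum fun i m ↦ ε i • relMap S m) = w := by
      rw [← hc]
      exact Finset.sum_congr rfl fun i _ ↦ (tmul_eq_smul_relMap _ _).symm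
    have hcoord : ∀ j, slice (ε.coord j) w = c j := fun j ↦ by
      classical
      rw [← hc', Finsupp.sum, map_sum]
      simp_rw [slice_smul_relMap, Module.Basis.coord_apply, ε.repr_self, Finsupp.single_apply,
        ite_smul, one_smul, zero_smul]
      rw [Finset.sum_ite_eq']
      split_ifs with hj
      exacts [rfl, (Finsupp.notMem_support_iff.mp hj).symm]
    rw [← hc']
    exact Submodule.sum_mem _ fun i _ ↦ Submodule.smul_mem _ _
      (Submodule.subset_span ⟨c i, (hcoord i) ▸ h _, rfl⟩)

theorem mem_relSections_iff {D : C.Divisor} {U : C.scheme.Opens} {w : C.RelFunctionField S} :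
    w ∈ relSections S D U ↔ ∀ l : S →ₗ[k] k, slice l w ∈ C.sections D U :=
  mem_span_relMap_iff

end Slices

variable {D : C.Divisor} {r : ℕ} {S : Type u} [CommRing S] [Algebra k S]

theorem exists_baseChange_eq {U : C.scheme.Opens} {w : C.RelFunctionField S}
    (hw : w ∈ relSections S D U) : ∃ z : S ⊗[k] C.sections D U,
      ((C.sections D U).subtype.baseChange S z : C.RelFunctionField S) = w := by
  induction hw using Submodule.span_induction with
  | mem w hw =>
    obtain ⟨f, hf, rfl⟩ := hw
    exact ⟨1 ⊗ₜ ⟨f, hf⟩, rfl⟩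
  | zero => exact ⟨0, map_zero _⟩
  | add x y _ _ hx hy =>
    obtain ⟨a, rfl⟩ := hx
    obtain ⟨b, rfl⟩ := hy
    exact ⟨a + b, map_add _ _ _⟩
  | smul s x _ hx =>
    obtain ⟨a, rfl⟩ := hx
    exact ⟨s • a, map_smul _ _ _⟩

section Coordinates

variable {E : Fin r → C.Divisor} {U : C.scheme.Opens}

/-- The components in `S ⊗ K(C)` of an element of `S ⊗ ∏ᵢ Γ(U, 𝒪(Eᵢ))`. -/
noncomputable def relCoord (z : S ⊗[k] ∀ i, C.sections (E i) U) (i : Fin r) :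
    C.RelFunctionField S :=
  ((C.sections (E i) U).subtype ∘ₗ LinearMap.proj i).baseChange S z

theorem relCoord_add (z w : S ⊗[k] ∀ i, C.sections (E i) U) (i : Fin r) :
    relCoord (z + w) i = relCoord z i + relCoord w i := map_add _ _ _

theorem relCoord_smul (s : S) (z : S ⊗[k] ∀ i, C.sections (E i) U) (i : Fin r) :
    relCoord (s • z) i = s • relCoord z i := map_smul _ _ _

theorem relCoord_tmul (s : S) (f : ∀ i, C.sections (E i) U) (i : Fin r) :
    relCoord (s ⊗ₜ[k] f) i = s • relMap S (f i : C.FunctionField) :=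
  tmul_eq_smul_relMap s (f i : C.FunctionField)

theorem relCoord_mem (z : S ⊗[k] ∀ i, C.sections (E i) U) (i : Fin r) :
    relCoord z i ∈ relSections S (E i) U := by
  induction z using TensorProduct.induction_on with
  | zero =>
    have : relCoord (0 : S ⊗[k] ∀ i, C.sections (E i) U) i = 0 := map_zero _
    rw [this]; exact zero_mem _
  | add x y hx hy => rw [relCoord_add]; exact add_mem hx hy
  | tmul s f => rw [relCoord_tmul]; exact Submodule.smul_mem _ s (relMap_mem (f i).2)

theorem relCoord_injective {z z' : S ⊗[k] ∀ i, C.sections (E i) U}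
    (h : ∀ i, relCoord z i = relCoord z' i) : z = z' := by
  classical
  have h' : ∀ i, (LinearMap.proj i).baseChange S z = (LinearMap.proj i).baseChange S z' :=
    fun i ↦ by
    have hinj : Function.Injective ((C.sections (E i) U).subtype.baseChange S) :=
      Module.Flat.lTensor_preserves_injective_linearMap (M := S)
        (C.sections (E i) U).subtype Subtype.val_injective
    refine hinj ?_
    have := h i
    unfold relCoord at this
    rw [LinearMap.baseChange_comp] at this
    exact this
  have key : ∀ z : S ⊗[k] ∀ i, C.sections (E i) U, z = ∑ i, (LinearMap.single k
      (fun i : Fin r ↦ C.sections (E i) U) i).baseChange S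
        ((LinearMap.proj i).baseChange S z) := fun z ↦ by
    induction z using TensorProduct.induction_on with
    | zero => simp
    | add x y hx hy => simp only [map_add, Finset.sum_add_distrib, ← hx, ← hy]
    | tmul s f =>
      simp only [LinearMap.baseChange_tmul, ← TensorProduct.tmul_sum]
      congr 1
      exact (LinearMap.sum_single_apply _ f).symm
  rw [key z, key z']
  exact Finset.sum_congr rfl fun i _ ↦ by rw [h' i]

theorem exists_relCoord_eq (c : Fin r → C.RelFunctionField S)
    (hc : ∀ i : Fin r, c i ∈ relSections S (E i) U) :
    ∃ z : S ⊗[k] ∀ i, C.sections (E i) U, ∀ i, relCoord z i = c i := by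
  classical
  choose z hz using fun i ↦ exists_baseChange_eq (hc i)
  refine ⟨∑ j, (LinearMap.single k (fun i : Fin r ↦ C.sections (E i) U) j).baseChange S
    (z j), fun i ↦ ?_⟩
  rw [← hz i]
  unfold relCoord
  rw [map_sum, Finset.sum_eq_single i]
  · rw [← LinearMap.comp_apply, ← LinearMap.baseChange_comp, LinearMap.comp_assoc,
      LinearMap.proj_comp_single_same]
    rfl
  · intro j _ hj
    rw [← LinearMap.comp_apply, ← LinearMap.baseChange_comp, LinearMap.comp_assoc,
      LinearMap.proj_comp_single_ne _ _ _ _ hj.symm]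
    simp
  · simp

end Coordinates

theorem charCoeff_eq_relCoord (b : S ⊗[k] HitchinBase D r) (i : Fin r) :
    charCoeff b i = relCoord b i := rfl

theorem natDegree_sum_lt_and (b : S ⊗[k] HitchinBase D r) :
    (∑ i : Fin r, Polynomial.C (charCoeff b i) * X ^ (r - (i + 1 : ℕ)) :
      (C.RelFunctionField S)[X]).degree < r := by
  refine (degree_sum_le _ _).trans_lt ((Finset.sup_lt_iff (WithBot.bot_lt_coe r)).mpr fun i _ ↦ ?_)
  refine (degree_C_mul_X_pow_le _ _).trans_lt ?_
  have := i.2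
  exact Nat.cast_lt.mpr (by lia)

theorem monic_charPoly (b : S ⊗[k] HitchinBase D r) : (charPoly b).Monic :=
  monic_X_pow_add (natDegree_sum_lt_and b)

theorem natDegree_charPoly [Nontrivial S] (b : S ⊗[k] HitchinBase D r) :
    (charPoly b).natDegree = r := by
  have : Nontrivial (C.RelFunctionField S) :=
    inferInstanceAs (Nontrivial (S ⊗[k] C.FunctionField))
  rw [charPoly, add_comm]
  exact natDegree_eq_of_degree_eq_some (by
    rw [degree_add_eq_right_of_degree_lt] <;> rw [degree_X_pow]; exact natDegree_sum_lt_and b)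

theorem coeff_charPoly (b : S ⊗[k] HitchinBase D r) (i : Fin r) :
    (charPoly b).coeff (r - (i + 1)) = charCoeff b i := by
  have hi := i.2
  rw [charPoly, coeff_add, coeff_X_pow, if_neg (by lia), zero_add, finsetSum_coeff,
    Finset.sum_eq_single i]
  · rw [coeff_C_mul_X_pow, if_pos rfl]
  · intro j _ hj
    have hj' := j.2
    rw [coeff_C_mul_X_pow, if_neg]
    intro h
    exact hj (Fin.ext (by lia))
  · simp

theorem charPoly_injective : Function.Injective
    (charPoly : S ⊗[k] HitchinBase D r → (C.RelFunctionField S)[X]) := fun b b' h ↦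
  relCoord_injective fun i ↦ by
    rw [← charCoeff_eq_relCoord, ← charCoeff_eq_relCoord, ← coeff_charPoly, ← coeff_charPoly, h]

/-- The `S`-valued points of the Hitchin base correspond to the monic polynomials of degree `r`
which are sections of `π^* 𝒪(rD)`. -/
theorem exists_charPoly_eq {Q : (C.RelFunctionField S)[X]} (hQ : Q.Monic) (hr : Q.natDegree = r)
    (hD : Q ∈ totSections S D r ⊤) : ∃ b : S ⊗[k] HitchinBase D r, charPoly b = Q := by
  obtain ⟨b, hb⟩ := exists_relCoord_eq (E := fun i : Fin r ↦ ((i : ℤ) + 1) • D) (U := ⊤)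
      (fun i : Fin r ↦ Q.coeff (r - (i + 1))) fun i ↦ by
    have := hD (r - (i + 1))
    have hi := i.2
    rwa [Nat.cast_sub (by lia), sub_sub_cancel, Nat.cast_add, Nat.cast_one] at this
  refine ⟨b, ?_⟩
  ext n
  rcases lt_trichotomy n r with h | rfl | h
  · have : n = r - ((⟨r - 1 - n, by lia⟩ : Fin r) + 1 : ℕ) := by simp only; lia
    rw [this, coeff_charPoly, charCoeff_eq_relCoord, hb]
  · have h₁ : (charPoly b).coeff n = 1 := by
      rw [charPoly, coeff_add, coeff_X_pow, if_pos rfl,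
        coeff_eq_zero_of_degree_lt (natDegree_sum_lt_and b), add_zero]
    rw [h₁, ← hr]
    exact hQ.symm
  · rw [coeff_eq_zero_of_natDegree_lt (hr.trans_lt h), charPoly, coeff_add, coeff_X_pow,
      if_neg h.ne', coeff_eq_zero_of_degree_lt
        ((natDegree_sum_lt_and b).trans (by exact_mod_cast h)), add_zero]

end SmoothProjectiveCurve

/-! ### Square factors of characteristic polynomials -/

/-- An element of a localization of an integrally closed domain which is integral over the domain is
in the domain. -/
theorem exists_algebraMap_eq_of_isLocalization {R B : Type*} [CommRing R] [IsDomain R]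
    [IsIntegrallyClosed R] [CommRing B] [Algebra R B] {M : Submonoid R} [IsLocalization M B]
    (hM : M ≤ nonZeroDivisors R) {w : B} (hw : IsIntegral R w) : ∃ a, algebraMap R B a = w := by
  let φ : B →+* FractionRing R := IsLocalization.lift (M := M) (g := algebraMap R (FractionRing R))
    fun y ↦ IsLocalization.map_units (M := nonZeroDivisors R) _ ⟨y, hM y.2⟩
  have hφ : ∀ a, φ (algebraMap R B a) = algebraMap R (FractionRing R) a :=
    fun a ↦ IsLocalization.lift_eq _ a
  have hinj : Function.Injective φ := by
    refine IsLocalization.injective_of_map_algebraMap_zero (R := R) (S := B) (M := M) φ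
      fun x hx ↦ ?_
    rw [hφ, map_eq_zero_iff _ (IsFractionRing.injective R (FractionRing R))] at hx
    rw [hx, map_zero]
  obtain ⟨p, hp, hpw⟩ := hw
  have : IsIntegral R (φ w) := by
    refine ⟨p, hp, ?_⟩
    have := congrArg φ hpw
    rw [hom_eval₂, map_zero] at this
    rw [← this]
    congr 1
    exact RingHom.ext fun a ↦ (hφ a).symm
  obtain ⟨a, ha⟩ := IsIntegrallyClosed.algebraMap_eq_of_integral this
  exact ⟨a, hinj ((hφ a).trans ha)⟩

namespace SmoothProjectiveCurve

variable {k : Type u} [Field k] {C : SmoothProjectiveCurve k}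

section Field

variable {F : Type u} [Field F] [Algebra k F]

variable (F) in
/-- The inclusion of `F ⊗ 𝒪ₓ` in `F ⊗ K(C)`. -/
noncomputable def relStalk (y : C.scheme) :
    F ⊗[k] C.scheme.presheaf.stalk y →ₐ[F] F ⊗[k] C.FunctionField :=
  Algebra.TensorProduct.map (AlgHom.id F F)
    (IsScalarTower.toAlgHom k (C.scheme.presheaf.stalk y) C.FunctionField)

theorem mem_range_relStalk_iff {x : C.PrimeDivisor} {w : C.RelFunctionField F} :
    w ∈ Set.range (relStalk F x.1) ↔ ∀ l : F →ₗ[k] k, slice l w ∈ C.vanishing x 0 := by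
  rw [← mem_span_relMap_iff]
  constructor
  · rintro ⟨z, rfl⟩
    induction z with
    | zero => rw [map_zero]; exact zero_mem _
    | add x y hx hy => rw [map_add]; exact add_mem hx hy
    | tmul s a =>
      have : relStalk F x.1 (s ⊗ₜ a) =
          s • relMap F (algebraMap (C.scheme.presheaf.stalk x.1) C.FunctionField a) :=
        (Algebra.TensorProduct.map_tmul _ _ _ _).trans (tmul_eq_smul_relMap _ _)
      rw [this]
      exact Submodule.smul_mem _ _
        (Submodule.subset_span ⟨_, mem_vanishing_zero_iff.mpr ⟨a, rfl⟩, rfl⟩)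
  · intro hw
    have : Submodule.span F (relMap F '' (C.vanishing x 0 : Set C.FunctionField)) ≤
        LinearMap.range (relStalk F x.1).toLinearMap := by
      refine Submodule.span_le.mpr ?_
      rintro _ ⟨f, hf, rfl⟩
      obtain ⟨a, rfl⟩ := mem_vanishing_zero_iff.mp hf
      exact ⟨1 ⊗ₜ a, Algebra.TensorProduct.map_tmul _ _ _ _⟩
    exact this hw

/-- A monic divisor of a monic polynomial with coefficients in `F ⊗ 𝒪_y` has coefficients in
`F ⊗ 𝒪_y`. -/
theorem coeff_mem_range_relStalk (y : C.scheme) {P Q : (F ⊗[k] C.FunctionField)[X]}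
    (hP : P.Monic) (hQ : Q.Monic) (hQP : Q ∣ P) (h : ∀ n, P.coeff n ∈ Set.range (relStalk F y))
    (n : ℕ) : Q.coeff n ∈ Set.range (relStalk F y) := by
  let _ : Algebra (F ⊗[k] C.scheme.presheaf.stalk y) (F ⊗[k] C.FunctionField) :=
    (relStalk F y).toRingHom.toAlgebra
  obtain ⟨_, _⟩ := isDomain_and_isIntegrallyClosed_stalk (C := C) F y
  have : IsLocalization ((nonZeroDivisors (C.scheme.presheaf.stalk y)).map
      (Algebra.TensorProduct.includeRight (R := k) (A := F) (B := C.scheme.presheaf.stalk y)))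
      (F ⊗[k] C.FunctionField) := isLocalization_tensorProduct_map F _
  obtain ⟨P', rfl, -, hP'⟩ := lifts_and_natDegree_eq_and_monic
    (f := algebraMap (F ⊗[k] C.scheme.presheaf.stalk y) (F ⊗[k] C.FunctionField))
    ((lifts_iff_coeff_lifts P).mpr h) hP
  exact exists_algebraMap_eq_of_isLocalization
    (map_includeRight_le_nonZeroDivisors (k := k) F zero_notMem_nonZeroDivisors)
    (isIntegral_coeff_of_dvd P' Q hP' hQ hQP n)

variable {D : C.Divisor} {r : ℕ}

theorem mem_vanishing_of_mem_relSections {U : C.scheme.Opens} {x : C.PrimeDivisor} (hx : x.1 ∈ U)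
    {w : C.RelFunctionField F} (hw : w ∈ relSections F D U) (l : F →ₗ[k] k) :
    slice l w ∈ C.vanishing x (-D x) :=
  mem_sections_iff.mp (mem_relSections_iff.mp hw l) x hx

/-- A monic divisor of a section of `π^* 𝒪(rD)` over an extension of `k` is a section of
`π^* 𝒪(mD)`, as follows from Gauss's lemma at each point of the curve. -/
theorem mem_totSections_of_dvd {P Q : (C.RelFunctionField F)[X]} (hP : P.Monic)
    (hPD : P ∈ totSections F D P.natDegree ⊤) (hQ : Q.Monic) (hQP : Q ∣ P) :
    Q ∈ totSections F D Q.natDegree ⊤ := by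
  intro n
  by_cases hn : Q.natDegree < n
  · rw [coeff_eq_zero_of_natDegree_lt hn]; exact zero_mem _
  rw [mem_relSections_iff]
  intro l
  rw [mem_sections_iff]
  intro x _
  -- scaling the roots by a local equation `f` of `D` at `x` makes the coefficients regular at `x`
  obtain ⟨f, hf0, hf⟩ := exists_ord_eq x (D x)
  have hpow : ∀ j : ℕ, f ^ j ≠ 0 := fun j ↦ pow_ne_zero j hf0
  have key : ∀ (R : (C.RelFunctionField F)[X]) (j : ℕ) (l : F →ₗ[k] k), j ≤ R.natDegree →
      (slice l ((R.scaleRoots (relMap F f)).coeff j) ∈ C.vanishing x 0 ↔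
      slice l (R.coeff j) ∈ C.vanishing x (-(((R.natDegree - j : ℤ) • D) x))) := by
    intro R j l hj
    rw [coeff_scaleRoots, mul_comm, ← map_pow, slice_relMap_mul, mul_mem_vanishing_iff (hpow _),
      ord_pow hf0, hf, zero_sub, Finsupp.smul_apply, smul_eq_mul, Nat.cast_sub hj]
  have hcoeff : ∀ (j : ℕ) (l : F →ₗ[k] k),
      slice l ((P.scaleRoots (relMap F f)).coeff j) ∈ C.vanishing x 0 := by
    intro j l
    by_cases hj : P.natDegree < j
    · rw [coeff_scaleRoots, coeff_eq_zero_of_natDegree_lt hj, zero_mul, map_zero]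
      exact zero_mem _
    rw [key P j l (not_lt.mp hj)]
    exact mem_vanishing_of_mem_relSections (U := ⊤) trivial (hPD j) l
  rw [← key Q n l (not_lt.mp hn)]
  exact mem_range_relStalk_iff.mp (coeff_mem_range_relStalk x.1 ((monic_scaleRoots_iff _).mpr hP)
    ((monic_scaleRoots_iff _).mpr hQ) (scaleRoots_dvd Q P hQP)
    (fun j ↦ mem_range_relStalk_iff.mpr (hcoeff j)) n) l

theorem exists_charPoly_eq_of_dvd (b : F ⊗[k] HitchinBase D r) {Q : (C.RelFunctionField F)[X]}
    (hQ : Q.Monic) (hQP : Q ∣ charPoly b) {m : ℕ} (hm : Q.natDegree = m) :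
    ∃ q : F ⊗[k] HitchinBase D m, charPoly q = Q := by
  refine exists_charPoly_eq hQ hm (hm ▸ mem_totSections_of_dvd (monic_charPoly b) ?_ hQ hQP)
  rw [natDegree_charPoly]
  exact charPoly_mem b ⊤

/-- A non-squarefree characteristic polynomial is divisible by the square of a characteristic
polynomial. -/
theorem exists_charPoly_eq_sq_mul (b : F ⊗[k] HitchinBase D r)
    (h : ¬ Squarefree ((charPoly b).map
      (algebraMap (C.RelFunctionField F) (FractionRing (C.RelFunctionField F))))) :
    ∃ (m : ℕ) (q : F ⊗[k] HitchinBase D m) (c : F ⊗[k] HitchinBase D (r - 2 * m)), 1 ≤ m ∧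
      2 * m ≤ r ∧ charPoly b = charPoly q ^ 2 * charPoly c := by
  set φ := algebraMap (C.RelFunctionField F) (FractionRing (C.RelFunctionField F)) with hφ
  have hinj : Function.Injective φ := IsFractionRing.injective _ _
  have : IsIntegrallyClosed (C.RelFunctionField F) :=
    (isDomain_and_isIntegrallyClosed_functionField F).2
  simp only [Squarefree, not_forall] at h
  obtain ⟨Q, hQP, hQ⟩ := h
  have hP0 := ((monic_charPoly b).map φ).ne_zero
  have hQ0 : Q ≠ 0 := by rintro rfl; rw [zero_mul, zero_dvd_iff] at hQP; exact hP0 hQP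
  -- by Gauss's lemma, the square factor is defined over `F ⊗ K(C)` up to a constant
  obtain ⟨Q', hQ'⟩ := IsIntegrallyClosed.eq_map_mul_C_of_dvd (FractionRing (C.RelFunctionField F))
    (monic_charPoly b) ((dvd_mul_right Q Q).trans hQP)
  have hlc : Q.leadingCoeff ≠ 0 := leadingCoeff_ne_zero.mpr hQ0
  have hQ'm : Q'.Monic := by
    have := congrArg leadingCoeff hQ'
    rw [leadingCoeff_mul, leadingCoeff_C, leadingCoeff_map_of_injective hinj] at this
    exact hinj (by rw [map_one]; exact mul_right_cancel₀ hlc (this.trans (one_mul _).symm))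
  have hdvd : Q' ^ 2 ∣ charPoly b := by
    rw [← map_dvd_map φ hinj (hQ'm.pow 2), Polynomial.map_pow]
    have : Q'.map φ ^ 2 ∣ Q * Q := by
      rw [← hQ', sq]
      exact mul_dvd_mul (dvd_mul_right _ _) (dvd_mul_right _ _)
    exact this.trans hQP
  obtain ⟨R, hR⟩ := hdvd
  have hRm : R.Monic := (hQ'm.pow 2).of_mul_monic_left (hR ▸ monic_charPoly b)
  have hdeg : r = 2 * Q'.natDegree + R.natDegree := by
    rw [← natDegree_charPoly b, hR, (hQ'm.pow 2).natDegree_mul hRm, hQ'm.natDegree_pow]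
  obtain ⟨q, hq⟩ := exists_charPoly_eq_of_dvd b hQ'm
    ((dvd_pow_self Q' two_ne_zero).trans ⟨R, hR⟩) rfl
  obtain ⟨c, hc⟩ := exists_charPoly_eq_of_dvd b hRm ⟨_, hR.trans (mul_comm _ _)⟩
    (by lia : R.natDegree = r - 2 * Q'.natDegree)
  refine ⟨Q'.natDegree, q, c, Nat.one_le_iff_ne_zero.mpr fun h0 ↦ hQ ?_, by lia, by rw [hq, hc, hR]⟩
  rw [← hQ', hQ'm.natDegree_eq_zero.mp h0, Polynomial.map_one, one_mul]
  exact isUnit_C.mpr hlc.isUnit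

end Field

end SmoothProjectiveCurve

/-! ### Reducedness of the affine pieces of the spectral curve -/

namespace SmoothProjectiveCurve

variable {k : Type u} [Field k] {C : SmoothProjectiveCurve k}

section Division

variable {S : Type u} [CommRing S] [Algebra k S] {D : C.Divisor}

/-- The quotient and the remainder of the division of sections of powers of `π^* 𝒪(D)` are sections
of powers of `π^* 𝒪(D)`. -/
theorem divByMonic_modByMonic_mem_totSections {r : ℕ} {m : ℤ} {U : C.scheme.Opens}
    {P p : (C.RelFunctionField S)[X]} (hP : P.Monic) (hr : P.natDegree = r)
    (hPD : P ∈ totSections S D r U) (hp : p ∈ totSections S D m U) :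
    p /ₘ P ∈ totSections S D (m - r) U ∧ p %ₘ P ∈ totSections S D m U := by
  nontriviality C.RelFunctionField S
  suffices h : ∃ q ∈ totSections S D (m - r) U, ∃ t ∈ totSections S D m U,
      t + P * q = p ∧ t.degree < P.degree by
    obtain ⟨q, hq, t, ht, he, hd⟩ := h
    obtain ⟨rfl, rfl⟩ := div_modByMonic_unique q t hP ⟨he, hd⟩
    exact ⟨hq, ht⟩
  obtain ⟨n, hn⟩ : ∃ n, p.natDegree < n := ⟨_, Nat.lt_succ_self _⟩
  induction n generalizing p with
  | zero => exact absurd hn (Nat.not_lt_zero _)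
  | succ n ih =>
    by_cases hpP : p.degree < P.degree
    · exact ⟨0, zero_mem _, p, hp, by simp, hpP⟩
    have hle : P.natDegree ≤ p.natDegree := natDegree_le_natDegree (not_lt.mp hpP)
    have hp0 : p ≠ 0 := by
      rintro rfl
      exact hpP (by
        rw [Polynomial.degree_zero]; exact bot_lt_iff_ne_bot.mpr (degree_ne_bot.mpr hP.ne_zero))
    set c : (C.RelFunctionField S)[X] :=
      Polynomial.C p.leadingCoeff * X ^ (p.natDegree - r) with hc
    have hcD : c ∈ totSections S D (m - r) U := by
      refine C_mul_X_pow_mem_totSections ?_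
      have := hp p.natDegree
      rwa [Nat.cast_sub (hr ▸ hle), sub_sub_sub_cancel_right]
    by_cases hpc : p - P * c = 0
    · exact ⟨c, hcD, 0, zero_mem _, by rw [zero_add]; exact (sub_eq_zero.mp hpc).symm, by
        rw [Polynomial.degree_zero]; exact bot_lt_iff_ne_bot.mpr (degree_ne_bot.mpr hP.ne_zero)⟩
    have hdeg : (p - P * c).natDegree < p.natDegree := by
      refine natDegree_lt_natDegree hpc ?_
      rw [hc, ← hr]
      exact div_wf_lemma ⟨not_lt.mp hpP, hp0⟩ hP
    obtain ⟨q, hq, t, ht, he, hd⟩ := ih (p := p - P * c) (sub_mem hp (by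
      have := mul_mem_totSections hPD hcD
      rwa [add_sub_cancel] at this)) (by lia)
    refine ⟨q + c, add_mem hq hcD, t, ht, ?_, hd⟩
    rw [mul_add, ← add_assoc, he, sub_add_cancel]

variable {r : ℕ} (b : S ⊗[k] HitchinBase D r)

/-- A multiple of the monic polynomial `P_b` is automatically its product with a section of
`π^* 𝒪(-rD)`. -/
theorem mem_spectralIdeal_iff_dvd {U : C.scheme.Opens} (hU : U ≠ ⊥) [Nontrivial S]
    {p : totAlgebra S D U} :
    p ∈ spectralIdeal b U ↔ charPoly b ∣ (p : (C.RelFunctionField S)[X]) := by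
  refine ⟨fun h ↦ ?_, fun h _ ↦ ?_⟩
  · obtain ⟨q, -, hq⟩ := h hU
    exact ⟨q, hq⟩
  · refine ⟨(p : (C.RelFunctionField S)[X]) /ₘ charPoly b, ?_, ?_⟩
    · have := (divByMonic_modByMonic_mem_totSections (monic_charPoly b) (natDegree_charPoly b)
        (charPoly_mem b U) (mem_totAlgebra.mp p.2)).1
      rwa [zero_sub] at this
    · have := modByMonic_add_div (p : (C.RelFunctionField S)[X]) (charPoly b)
      rw [(modByMonic_eq_zero_iff_dvd (monic_charPoly b)).mpr h, zero_add] at this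
      exact this.symm

theorem spectralMk_eq_zero_iff {U : C.scheme.Opens} (hU : U ≠ ⊥) [Nontrivial S]
    {p : totAlgebra S D U} :
    spectralMk b U p = 0 ↔ charPoly b ∣ (p : (C.RelFunctionField S)[X]) :=
  Ideal.Quotient.eq_zero_iff_mem.trans (mem_spectralIdeal_iff_dvd b hU)

end Division

section Reduced

variable {F : Type u} [Field F] [Algebra k F] {D : C.Divisor} {r : ℕ}
  (b : F ⊗[k] HitchinBase D r)

/-- If `P_b` is squarefree over the fraction field of `F ⊗ K(C)`, it divides a function as soon as
it divides a power of it. -/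
theorem exists_charPoly_eq_of_not_isReduced {U : C.scheme.Opens} (hU : U ≠ ⊥)
    (h : ¬ IsReduced (spectralAlgebra b U)) :
    ∃ (m : ℕ) (q : F ⊗[k] HitchinBase D m) (c : F ⊗[k] HitchinBase D (r - 2 * m)), 1 ≤ m ∧
      2 * m ≤ r ∧ charPoly b = charPoly q ^ 2 * charPoly c := by
  refine exists_charPoly_eq_sq_mul b fun hs ↦ h ⟨fun z hz ↦ ?_⟩
  obtain ⟨p, rfl⟩ := spectralMk_surjective b U z
  obtain ⟨n, hn⟩ := hz
  rw [← map_pow, spectralMk_eq_zero_iff b hU] at hn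
  rw [spectralMk_eq_zero_iff b hU]
  have hinj : Function.Injective
      (algebraMap (C.RelFunctionField F) (FractionRing (C.RelFunctionField F))) :=
    IsFractionRing.injective _ _
  rw [← map_dvd_map _ hinj (monic_charPoly b)] at hn ⊢
  refine hs.isRadical n _ ?_
  rwa [Subalgebra.coe_pow, Polynomial.map_pow] at hn

/-- A divisor is trivial on some nonempty affine open subset. -/
theorem exists_open_forall_eq_zero (D : C.Divisor) : ∃ U : C.scheme.Opens, IsAffineOpen U ∧ U ≠ ⊥ ∧
    ∀ x : C.PrimeDivisor, x.1 ∈ U → D x = 0 := by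
  have hcl : IsClosed (⋃ x ∈ D.support, ({x.1} : Set C.scheme)) :=
    D.support.finite_toSet.isClosed_biUnion fun x _ ↦ isClosed_primeDivisor x
  have hη : genericPoint C.scheme ∈ (⋃ x ∈ D.support, ({x.1} : Set C.scheme))ᶜ := by
    simp only [Set.mem_compl_iff, Set.mem_iUnion, Set.mem_singleton_iff, not_exists]
    intro x _ h
    have : IsMax x.1 := by
      rw [← h]
      exact fun y _ ↦
        Scheme.le_iff_specializes.mpr ((genericPoint_spec C.scheme).specializes trivial)
    have h0 := Order.coheight_eq_zero.mpr this
    rw [x.2] at h0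
    exact one_ne_zero h0
  obtain ⟨_, ⟨U, hU, rfl⟩, hηU, hUc⟩ :=
    C.scheme.isBasis_affineOpens.exists_subset_of_mem_open hη hcl.isOpen_compl
  refine ⟨U, hU, by rintro rfl; exact hηU, fun x hx ↦ ?_⟩
  by_contra hD
  exact hUc hx (Set.mem_biUnion (Finset.mem_coe.mpr (Finsupp.mem_support_iff.mpr hD)) rfl)

theorem totSections_eq_of_forall {U : C.scheme.Opens} (hU : ∀ x : C.PrimeDivisor, x.1 ∈ U → D x = 0)
    (l m : ℤ) : totSections F D l U = totSections F D m U := by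
  have : ∀ i j : ℤ, C.sections (i • D) U = C.sections (j • D) U := fun i j ↦ by
    ext f
    rw [mem_sections_iff, mem_sections_iff]
    refine forall₂_congr fun x hx ↦ ?_
    rw [Finsupp.smul_apply, Finsupp.smul_apply, hU x hx, smul_zero, smul_zero]
  ext p
  refine forall_congr' fun n ↦ ?_
  rw [relSections, relSections, this]

/-- Where `D` is trivial, `QR` is a nilpotent function on the spectral curve `Q²R = 0`. -/
theorem not_isReduced_spectralAlgebra {U : C.scheme.Opens} (hU : U ≠ ⊥)
    (hUD : ∀ x : C.PrimeDivisor, x.1 ∈ U → D x = 0) {m l : ℕ} {q : F ⊗[k] HitchinBase D m}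
    {c : F ⊗[k] HitchinBase D l} (hm : 1 ≤ m) (h : charPoly b = charPoly q ^ 2 * charPoly c) :
    ¬ IsReduced (spectralAlgebra b U) := by
  intro hred
  have hmem : charPoly q * charPoly c ∈ totAlgebra F D U := by
    rw [mem_totAlgebra, totSections_eq_of_forall hUD 0 (m + l)]
    exact mul_mem_totSections (charPoly_mem q U) (charPoly_mem c U)
  have hz : spectralMk b U ⟨_, hmem⟩ ^ 2 = 0 := by
    rw [← map_pow, spectralMk_eq_zero_iff b hU, h]
    exact ⟨charPoly c, by rw [Subalgebra.coe_pow]; ring⟩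
  have := pow_eq_zero_iff two_ne_zero |>.mp hz
  rw [spectralMk_eq_zero_iff b hU] at this
  have hqc := (monic_charPoly q).mul (monic_charPoly c)
  have hle := natDegree_le_of_dvd this hqc.ne_zero
  rw [h, ((monic_charPoly q).pow 2).natDegree_mul (monic_charPoly c),
    (monic_charPoly q).natDegree_pow, (monic_charPoly q).natDegree_mul (monic_charPoly c),
    natDegree_charPoly, natDegree_charPoly] at hle
  lia

end Reduced

end SmoothProjectiveCurve

/-! ### Base change of the spectral curve -/

namespace SmoothProjectiveCurve

variable {k : Type u} [Field k] {C : SmoothProjectiveCurve k}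

instance (S : Type u) [CommRing S] [Algebra k S] [Nontrivial S] :
    Nontrivial (C.RelFunctionField S) :=
  inferInstanceAs (Nontrivial (S ⊗[k] C.FunctionField))

section LowDegree

variable {S : Type u} [CommRing S] [Algebra k S] {D : C.Divisor} {r : ℕ} {U : C.scheme.Opens}

/-- The function on `Tot(𝒪(D))` of degree less than `r` in `t` with the given coefficients. -/
noncomputable def lowDegree :
    (S ⊗[k] ∀ n : Fin r, C.sections ((0 - (n : ℤ)) • D) U) →ₗ[S] totAlgebra S D U where
  toFun z := ⟨∑ n : Fin r, Polynomial.C (relCoord z n) * X ^ (n : ℕ), mem_totAlgebra.mpr <|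
    Submodule.sum_mem _ fun n _ ↦ C_mul_X_pow_mem_totSections (relCoord_mem z n)⟩
  map_add' z w := Subtype.ext <| by
    simp only [relCoord_add, map_add, add_mul, Finset.sum_add_distrib, Subalgebra.coe_add]
  map_smul' s z := Subtype.ext <| by
    simp only [relCoord_smul, RingHom.id_apply, Subalgebra.coe_smul, Finset.smul_sum,
      smul_mul_assoc, ← smul_C]

theorem coe_lowDegree (z : S ⊗[k] ∀ n : Fin r, C.sections ((0 - (n : ℤ)) • D) U) :
    (lowDegree z : (C.RelFunctionField S)[X]) =
      ∑ n : Fin r, Polynomial.C (relCoord z n) * X ^ (n : ℕ) := rfl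

theorem coeff_lowDegree (z : S ⊗[k] ∀ n : Fin r, C.sections ((0 - (n : ℤ)) • D) U) (n : Fin r) :
    (lowDegree z : (C.RelFunctionField S)[X]).coeff n = relCoord z n := by
  rw [coe_lowDegree, finsetSum_coeff, Finset.sum_eq_single n]
  · rw [coeff_C_mul_X_pow, if_pos rfl]
  · intro j _ hj
    rw [coeff_C_mul_X_pow, if_neg fun h ↦ hj (Fin.ext h.symm)]
  · simp

theorem degree_lowDegree_lt (z : S ⊗[k] ∀ n : Fin r, C.sections ((0 - (n : ℤ)) • D) U) :
    (lowDegree z : (C.RelFunctionField S)[X]).degree < r := by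
  rw [coe_lowDegree]
  exact (degree_sum_le _ _).trans_lt ((Finset.sup_lt_iff (WithBot.bot_lt_coe r)).mpr fun i _ ↦
    (degree_C_mul_X_pow_le _ _).trans_lt (Nat.cast_lt.mpr i.2))

/-- The functions on the spectral curve are represented uniquely by functions on `Tot(𝒪(D))` of
degree less than `r` in `t`. -/
theorem bijective_spectralMk_lowDegree [Nontrivial S] (b : S ⊗[k] HitchinBase D r) (hU : U ≠ ⊥) :
    Function.Bijective ((spectralMk b U).toLinearMap ∘ₗ lowDegree (r := r)) := by
  have hdeg : (charPoly b).degree = r := by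
    rw [degree_eq_natDegree (monic_charPoly b).ne_zero, natDegree_charPoly]
  constructor
  · rw [injective_iff_map_eq_zero]
    intro z hz
    have h := (spectralMk_eq_zero_iff b hU).mp hz
    have h0 : (lowDegree z : (C.RelFunctionField S)[X]) = 0 := by
      rw [← (modByMonic_eq_zero_iff_dvd (monic_charPoly b)).mpr h, eq_comm,
        modByMonic_eq_self_iff (monic_charPoly b), hdeg]
      exact degree_lowDegree_lt z
    refine relCoord_injective fun n ↦ ?_
    rw [← coeff_lowDegree, h0, ← coeff_lowDegree, map_zero]
    rfl
  · intro w
    obtain ⟨p, rfl⟩ := spectralMk_surjective b U w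
    have hm := (divByMonic_modByMonic_mem_totSections (monic_charPoly b) (natDegree_charPoly b)
      (charPoly_mem b U) (mem_totAlgebra.mp p.2)).2
    obtain ⟨z, hz⟩ := exists_relCoord_eq (E := fun n : Fin r ↦ (0 - (n : ℤ)) • D) (U := U)
      (fun n : Fin r ↦ ((p : (C.RelFunctionField S)[X]) %ₘ charPoly b).coeff n) fun n ↦ hm n
    have hzp : (lowDegree z : (C.RelFunctionField S)[X]) = p %ₘ charPoly b := by
      ext n
      by_cases hn : n < r
      · rw [← hz ⟨n, hn⟩, ← coeff_lowDegree]
      · rw [coeff_eq_zero_of_degree_lt ((degree_lowDegree_lt z).trans_le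
            (by exact_mod_cast not_lt.mp hn)),
          coeff_eq_zero_of_degree_lt ((degree_modByMonic_lt _ (monic_charPoly b)).trans_le
            (by rw [hdeg]; exact_mod_cast not_lt.mp hn))]
    refine ⟨z, ?_⟩
    change spectralMk b U (lowDegree z) = spectralMk b U p
    rw [← sub_eq_zero, ← map_sub, spectralMk_eq_zero_iff b hU, Subalgebra.coe_sub, hzp]
    refine ⟨-(p /ₘ charPoly b), ?_⟩
    nth_rewrite 2 [← modByMonic_add_div (p : (C.RelFunctionField S)[X]) (charPoly b)]
    ring

end LowDegree

section BaseChange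

variable {S : Type u} [CommRing S] [Algebra k S] {D : C.Divisor} {r : ℕ}
  {S' : Type u} [CommRing S'] [Algebra k S'] (h : S →ₐ[k] S')

/-- The change of the base of `S ⊗ K(C)` along a ring homomorphism. -/
noncomputable def relChange : C.RelFunctionField S →+* C.RelFunctionField S' :=
  (Algebra.TensorProduct.map h (AlgHom.id k C.FunctionField)).toRingHom

theorem relChange_smul_relMap (s : S) (f : C.FunctionField) :
    relChange h (s • relMap S f) = h s • relMap S' f := by
  rw [← tmul_eq_smul_relMap, ← tmul_eq_smul_relMap]
  exact Algebra.TensorProduct.map_tmul _ _ _ _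

theorem relChange_relMap (f : C.FunctionField) : relChange h (relMap S f) = relMap S' f := by
  simpa using relChange_smul_relMap h 1 f

theorem relChange_smul (s : S) (w : C.RelFunctionField S) :
    relChange h (s • w) = h s • relChange h w := by
  induction w using relFunctionField_induction with
  | add x y hx hy => rw [smul_add, map_add, map_add, smul_add, hx, hy]
  | smul t f => rw [smul_smul, relChange_smul_relMap, relChange_smul_relMap, map_mul, smul_smul]

theorem relChange_mem {E : C.Divisor} {U : C.scheme.Opens} {w : C.RelFunctionField S}
    (hw : w ∈ relSections S E U) : relChange h w ∈ relSections S' E U := by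
  induction hw using Submodule.span_induction with
  | mem w hw =>
    obtain ⟨f, hf, rfl⟩ := hw
    rw [relChange_relMap]
    exact relMap_mem hf
  | zero => rw [map_zero]; exact zero_mem _
  | add x y _ _ hx hy => rw [map_add]; exact add_mem hx hy
  | smul s x _ hx => rw [relChange_smul]; exact Submodule.smul_mem _ _ hx

theorem map_relChange_mem {m : ℤ} {U : C.scheme.Opens} {p : (C.RelFunctionField S)[X]}
    (hp : p ∈ totSections S D m U) : p.map (relChange h) ∈ totSections S' D m U := fun n ↦ by
  rw [coeff_map]; exact relChange_mem h (hp n)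

theorem relCoord_rTensor {E : Fin r → C.Divisor} {U : C.scheme.Opens}
    (z : S ⊗[k] ∀ i, C.sections (E i) U) (i : Fin r) :
    relCoord (h.toLinearMap.rTensor _ z) i = relChange h (relCoord z i) := by
  induction z using TensorProduct.induction_on with
  | zero =>
    have h₀ : relCoord (0 : S ⊗[k] ∀ i, C.sections (E i) U) i = 0 := map_zero _
    have h₁ : relCoord (0 : S' ⊗[k] ∀ i, C.sections (E i) U) i = 0 := map_zero _
    rw [map_zero, h₀, h₁, map_zero]
  | add x y hx hy => rw [map_add, relCoord_add, relCoord_add, map_add, hx, hy]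
  | tmul s f =>
    rw [LinearMap.rTensor_tmul, relCoord_tmul, relCoord_tmul, relChange_smul_relMap]
    rfl

/-- The image of a point of the Hitchin base under a ring homomorphism. -/
noncomputable def pointChange (b : S ⊗[k] HitchinBase D r) : S' ⊗[k] HitchinBase D r :=
  h.toLinearMap.rTensor _ b

theorem charPoly_pointChange (b : S ⊗[k] HitchinBase D r) :
    charPoly (pointChange h b) = (charPoly b).map (relChange h) := by
  simp only [charPoly, Polynomial.map_add, Polynomial.map_pow, map_X, Polynomial.map_sum,
    Polynomial.map_mul, map_C, charCoeff_eq_relCoord]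
  congr 1
  exact Finset.sum_congr rfl fun i _ ↦ by rw [pointChange, relCoord_rTensor]

/-- The base change of functions on `Tot(𝒪(D))`. -/
noncomputable def totChange (D : C.Divisor) (U : C.scheme.Opens) :
    totAlgebra S D U →+* totAlgebra S' D U :=
  ((mapRingHom (relChange h)).comp (totAlgebra S D U).val.toRingHom).codRestrict
    (totAlgebra S' D U) fun p ↦ mem_totAlgebra.mpr (map_relChange_mem h (mem_totAlgebra.mp p.2))

theorem coe_totChange {U : C.scheme.Opens} (p : totAlgebra S D U) :
    (totChange h D U p : (C.RelFunctionField S')[X]) = (p : (C.RelFunctionField S)[X]).map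
      (relChange h) := rfl

/-- The base change of functions on a spectral curve. -/
noncomputable def spectralChange (b : S ⊗[k] HitchinBase D r) (U : C.scheme.Opens) :
    spectralAlgebra b U →+* spectralAlgebra (pointChange h b) U :=
  Ideal.quotientMap (spectralIdeal (pointChange h b) U) (totChange h D U) fun p hp ↦
    Ideal.mem_comap.mpr <| (mem_spectralIdeal _).mpr fun hU ↦ by
      obtain ⟨q, hq, e⟩ := (mem_spectralIdeal b).mp hp hU
      exact ⟨_, map_relChange_mem h hq, by
        rw [coe_totChange, e, Polynomial.map_mul, charPoly_pointChange]⟩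

theorem spectralChange_mk (b : S ⊗[k] HitchinBase D r) (U : C.scheme.Opens)
    (p : totAlgebra S D U) :
    spectralChange h b U (spectralMk b U p) = spectralMk (pointChange h b) U (totChange h D U p) :=
  Ideal.quotientMap_mk

theorem totChange_smul {U : C.scheme.Opens} (s : S) (p : totAlgebra S D U) :
    totChange h D U (s • p) = h s • totChange h D U p := by
  refine Subtype.ext ?_
  rw [coe_totChange, Subalgebra.coe_smul, Subalgebra.coe_smul, coe_totChange]
  ext n
  rw [coeff_map, coeff_smul, coeff_smul, coeff_map, relChange_smul]

theorem spectralChange_smul (b : S ⊗[k] HitchinBase D r) (U : C.scheme.Opens) (s : S)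
    (z : spectralAlgebra b U) : spectralChange h b U (s • z) = h s • spectralChange h b U z := by
  obtain ⟨p, rfl⟩ := spectralMk_surjective b U z
  rw [← map_smul, spectralChange_mk, spectralChange_mk, ← map_smul, totChange_smul]

theorem totChange_lowDegree {U : C.scheme.Opens}
    (z : S ⊗[k] ∀ n : Fin r, C.sections ((0 - (n : ℤ)) • D) U) :
    totChange h D U (lowDegree z) = lowDegree (h.toLinearMap.rTensor _ z) := by
  refine Subtype.ext ?_
  rw [coe_totChange, coe_lowDegree, coe_lowDegree]
  simp only [Polynomial.map_pow, map_X, Polynomial.map_sum, Polynomial.map_mul, map_C,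
    relCoord_rTensor]

/-- The formation of the functions on the spectral curve over an affine open set commutes with base
change, as both sides are the base change of the vector space of functions of degree less than `r`
in `t`. -/
theorem exists_ringEquiv_spectralAlgebra [Nontrivial S] [Nontrivial S'] [Algebra S S']
    [IsScalarTower k S S']
    (b : S ⊗[k] HitchinBase D r) {U : C.scheme.Opens} (hU : U ≠ ⊥) :
    Nonempty (S' ⊗[S] spectralAlgebra b U ≃+*
      spectralAlgebra (pointChange (IsScalarTower.toAlgHom k S S') b) U) := by
  set h := IsScalarTower.toAlgHom k S S' with hh
  set M' := spectralAlgebra (pointChange h b) U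
  let _ : Algebra S M' := ((algebraMap S' M').comp (algebraMap S S')).toAlgebra
  have : IsScalarTower S S' M' := .of_algebraMap_eq' rfl
  let ch : spectralAlgebra b U →ₐ[S] M' :=
    { spectralChange h b U with
      commutes' := fun s ↦ by
        change spectralChange h b U (algebraMap S _ s) = algebraMap S' M' (algebraMap S S' s)
        rw [Algebra.algebraMap_eq_smul_one, spectralChange_smul, map_one,
          Algebra.algebraMap_eq_smul_one]
        rfl }
  let N := ∀ n : Fin r, C.sections ((0 - (n : ℤ)) • D) U
  let Ψ : S' ⊗[S] spectralAlgebra b U →ₐ[S'] M' :=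
    Algebra.TensorProduct.lift (Algebra.ofId S' M') ch fun _ _ ↦ Commute.all _ _
  let Θ : (S ⊗[k] N) ≃ₗ[S] spectralAlgebra b U :=
    LinearEquiv.ofBijective _ (bijective_spectralMk_lowDegree b hU)
  let Θ' : (S' ⊗[k] N) ≃ₗ[S'] M' :=
    LinearEquiv.ofBijective _ (bijective_spectralMk_lowDegree (pointChange h b) hU)
  let e₁ : S' ⊗[S] (S ⊗[k] N) ≃ₗ[S'] S' ⊗[S] spectralAlgebra b U := Θ.baseChange S S' _ _
  let e₂ : S' ⊗[S] (S ⊗[k] N) ≃ₗ[S'] S' ⊗[k] N :=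
    AlgebraTensorModule.cancelBaseChange k S S' S' N
  have key : Ψ.toLinearMap ∘ₗ e₁.toLinearMap = Θ'.toLinearMap ∘ₗ e₂.toLinearMap := by
    ext z
    have hz : e₂ (1 ⊗ₜ z) = h.toLinearMap.rTensor N z := by
      induction z using TensorProduct.induction_on with
      | zero => rw [TensorProduct.tmul_zero, map_zero, map_zero]
      | add x y hx hy => rw [TensorProduct.tmul_add, map_add, map_add, hx, hy]
      | tmul s f =>
        rw [AlgebraTensorModule.cancelBaseChange_tmul, Algebra.smul_def, mul_one]
        rfl
    change Ψ (1 ⊗ₜ Θ z) = Θ' (e₂ (1 ⊗ₜ z))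
    rw [hz, Algebra.TensorProduct.lift_tmul, map_one, one_mul]
    exact (spectralChange_mk h b U _).trans (congrArg _ (totChange_lowDegree h z))
  refine ⟨(AlgEquiv.ofBijective Ψ ?_).toRingEquiv⟩
  have : Ψ.toLinearMap = Θ'.toLinearMap ∘ₗ e₂.toLinearMap ∘ₗ e₁.symm.toLinearMap := by
    rw [← LinearMap.comp_assoc, ← key, LinearMap.comp_assoc]
    ext x
    simp
  have h2 : ⇑Ψ = Θ' ∘ e₂ ∘ e₁.symm := congrArg DFunLike.coe this
  rw [h2]
  exact Θ'.bijective.comp (e₂.bijective.comp e₁.symm.bijective)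

end BaseChange

end SmoothProjectiveCurve

/-! ### Geometric fibres of the universal spectral curve -/

/-- The fibre of a scheme over an affine base is geometrically reduced if and only if the base
changes to fields along ring homomorphisms with kernel the given prime ideal are reduced. -/
theorem geometricallyReduced_fiberToSpecResidueField_iff {S : Type u} [CommRing S] {X : Scheme.{u}}
    (f : X ⟶ Spec (.of S)) (s : Spec (.of S)) :
    GeometricallyReduced (f.fiberToSpecResidueField s) ↔
      ∀ (F : Type u) [Field F] [Algebra S F], RingHom.ker (algebraMap S F) = s.asIdeal →
        AlgebraicGeometry.IsReduced
          (pullback f (Spec.map (CommRingCat.ofHom (algebraMap S F)))) := by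
  rw [GeometricallyReduced.eq_geometrically,
    geometrically_iff_of_isClosedUnderIsomorphisms]
  constructor
  · intro h F _ _ hF
    obtain ⟨⟨x, ψ⟩, hψ⟩ := (Scheme.SpecToEquivOfField F (Spec (.of S))).symm.surjective
      (Spec.map (CommRingCat.ofHom (algebraMap S F)))
    replace hψ : Spec.map ψ ≫ (Spec (.of S)).fromSpecResidueField x =
      Spec.map (CommRingCat.ofHom (algebraMap S F)) := hψ
    have hx : x = s := by
      have h₁ := congrArg (fun g : Spec (.of F) ⟶ Spec (.of S) ↦ g (⊥ : PrimeSpectrum F)) hψ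
      have h₂ := Scheme.fromSpecResidueField_apply x (Spec.map ψ (⊥ : PrimeSpectrum F))
      exact h₂.symm.trans (h₁.trans (PrimeSpectrum.ext hF))
    subst hx
    rw [← hψ]
    have : AlgebraicGeometry.IsReduced (pullback (pullback.snd f
      ((Spec (.of S)).fromSpecResidueField x)) (Spec.map ψ)) := h F (Spec.map ψ)
    exact (isReduced_of_isOpenImmersion
      (pullbackLeftPullbackSndIso f ((Spec (.of S)).fromSpecResidueField x) (Spec.map ψ)).inv)
  · intro h F _ y
    obtain ⟨φ, hφ⟩ := Spec.map_surjective (y ≫ (Spec (.of S)).fromSpecResidueField s)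
    let _ : Algebra S F := φ.hom.toAlgebra
    have hk : RingHom.ker (algebraMap S F) = s.asIdeal := by
      have h₁ := congrArg (fun g : Spec (.of F) ⟶ Spec (.of S) ↦ g (⊥ : PrimeSpectrum F)) hφ
      have h₂ := Scheme.fromSpecResidueField_apply s (y (⊥ : PrimeSpectrum F))
      exact congrArg PrimeSpectrum.asIdeal (h₁.trans h₂)
    have h₂ := h F hk
    have h₃ : Spec.map (CommRingCat.ofHom (algebraMap S F)) =
        y ≫ (Spec (.of S)).fromSpecResidueField s := hφ
    rw [h₃] at h₂
    let ε : pullback (f.fiberToSpecResidueField s) y ≅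
        pullback f (y ≫ (Spec (.of S)).fromSpecResidueField s) :=
      pullbackLeftPullbackSndIso f ((Spec (.of S)).fromSpecResidueField s) y
    exact isReduced_of_isOpenImmersion ε.hom

theorem ι_descGlued {X : Scheme.{u}} {𝒰 : X.OpenCover} [Category 𝒰.I₀]
    [𝒰.LocallyDirected] [Small.{u} 𝒰.I₀] [Quiver.IsThin 𝒰.I₀] (d : 𝒰.RelativeGluingData)
    (c : Cocone d.functor) (i : 𝒰.I₀) : d.cover.f i ≫ descGlued d c = c.ι.app i :=
  colimit.ι_desc _ _

namespace SmoothProjectiveCurve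

variable {k : Type u} [Field k] {C : SmoothProjectiveCurve k}
  {S : Type u} [CommRing S] [Algebra k S] {D : C.Divisor} {r : ℕ}

theorem ι_spectralCurveToBase (b : S ⊗[k] HitchinBase D r)
    (U : (Scheme.AffineZariskiSite.directedCover C.scheme).I₀) :
    (spectralGluing b).cover.f U ≫ spectralCurveToBase b =
      Spec.map (CommRingCat.ofHom
        (algebraMap S (spectralAlgebra b (Scheme.AffineZariskiSite.toOpens U)))) :=
  ι_descGlued _ _ U

/-- Reducedness of a base change of the spectral curve can be checked on its affine pieces. -/
theorem isReduced_pullback_spectralCurveToBase_iff (b : S ⊗[k] HitchinBase D r)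
    (F : Type u) [CommRing F] [Algebra S F] :
    AlgebraicGeometry.IsReduced
        (pullback (spectralCurveToBase b) (Spec.map (CommRingCat.ofHom (algebraMap S F)))) ↔
      ∀ U : C.scheme.Opens, IsAffineOpen U →
        _root_.IsReduced (F ⊗[S] spectralAlgebra b U) := by
  refine (IsReduced.iff_of_openCover _
    (Scheme.Pullback.openCoverOfLeft (spectralGluing b).cover (spectralCurveToBase b) _)).trans ?_
  have key : ∀ U : C.scheme.AffineZariskiSite,
      AlgebraicGeometry.IsReduced (pullback (Spec.map (CommRingCat.ofHom
        (algebraMap S (spectralAlgebra b U.toOpens)))) (Spec.map (CommRingCat.ofHom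
        (algebraMap S F)))) ↔ _root_.IsReduced (F ⊗[S] spectralAlgebra b U.toOpens) := fun U ↦ by
    let e := pullbackSpecIso S (spectralAlgebra b U.toOpens) F
    have h₁ : AlgebraicGeometry.IsReduced (pullback (Spec.map (CommRingCat.ofHom
        (algebraMap S (spectralAlgebra b U.toOpens)))) (Spec.map (CommRingCat.ofHom
        (algebraMap S F)))) ↔
        AlgebraicGeometry.IsReduced (Spec (.of (spectralAlgebra b U.toOpens ⊗[S] F))) :=
      ⟨fun _ ↦ isReduced_of_isOpenImmersion e.inv, fun _ ↦ isReduced_of_isOpenImmersion e.hom⟩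
    rw [h₁, affine_isReduced_iff]
    let e' := Algebra.TensorProduct.comm S (spectralAlgebra b U.toOpens) F
    exact ⟨fun _ ↦ isReduced_of_injective e'.symm e'.symm.injective,
      fun _ ↦ isReduced_of_injective e' e'.injective⟩
  have hcongr : ∀ {X Y Z : Scheme.{u}} {g g' : X ⟶ Z} (l : Y ⟶ Z), g = g' →
      (AlgebraicGeometry.IsReduced (pullback g l) ↔
        AlgebraicGeometry.IsReduced (pullback g' l)) := by
    rintro X Y Z g _ l rfl
    rfl
  have hpiece : ∀ U : C.scheme.AffineZariskiSite, AlgebraicGeometry.IsReduced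
      ((Scheme.Pullback.openCoverOfLeft (spectralGluing b).cover (spectralCurveToBase b)
        (Spec.map (CommRingCat.ofHom (algebraMap S F)))).X U) ↔
      _root_.IsReduced (F ⊗[S] spectralAlgebra b U.toOpens) :=
    fun U ↦ (hcongr _ (ι_spectralCurveToBase b U)).trans (key U)
  exact ⟨fun h U hU ↦ (hpiece ⟨U, hU⟩).mp (h ⟨U, hU⟩), fun h U ↦ (hpiece U).mpr (h _ U.2)⟩

/-- A point of the Hitchin base is in the non-reduced locus if and only if its characteristic
polynomial has a square factor, of positive degree, over an extension of its residue field. -/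
theorem mem_nonReducedLocus_iff {N : ℕ} (e : Module.Basis (Fin N) k (HitchinBase D r))
    (s : (Spec (.of (MvPolynomial (Fin N) k)) : Scheme.{u})) :
    s ∈ nonReducedLocus e ↔ ∃ (F : Type u) (_ : Field F) (_ : Algebra k F)
      (h : MvPolynomial (Fin N) k →ₐ[k] F), RingHom.ker h = s.asIdeal ∧
      ∃ (m : ℕ) (q : F ⊗[k] HitchinBase D m) (c : F ⊗[k] HitchinBase D (r - 2 * m)), 1 ≤ m ∧
        2 * m ≤ r ∧
        charPoly (pointChange h (universalPoint e)) = charPoly q ^ 2 * charPoly c := by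
  have hdef : s ∈ nonReducedLocus e ↔
    ¬ GeometricallyReduced ((universalSpectralCurve e).fiberToSpecResidueField s) := Iff.rfl
  rw [hdef, geometricallyReduced_fiberToSpecResidueField_iff]
  simp only [universalSpectralCurve, isReduced_pullback_spectralCurveToBase_iff]
  have hequiv : ∀ (F : Type u) [Field F] [Algebra k F] [Algebra (MvPolynomial (Fin N) k) F]
      [IsScalarTower k (MvPolynomial (Fin N) k) F] (U : C.scheme.Opens), U ≠ ⊥ →
      (_root_.IsReduced (F ⊗[MvPolynomial (Fin N) k] spectralAlgebra (universalPoint e) U) ↔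
        _root_.IsReduced (spectralAlgebra (pointChange (IsScalarTower.toAlgHom k
          (MvPolynomial (Fin N) k) F) (universalPoint e)) U)) := by
    intro F _ _ _ _ U hU
    obtain ⟨ε⟩ := exists_ringEquiv_spectralAlgebra (S' := F) (universalPoint e) hU
    exact ⟨fun _ ↦ isReduced_of_injective ε.symm ε.symm.injective,
      fun _ ↦ isReduced_of_injective ε ε.injective⟩
  constructor
  · intro hs
    push Not at hs
    obtain ⟨F, _, _, hF, U, hU, hred⟩ := hs
    let _ : Algebra k F := Algebra.compHom F (algebraMap k (MvPolynomial (Fin N) k))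
    have : IsScalarTower k (MvPolynomial (Fin N) k) F := .of_algebraMap_eq' rfl
    -- over the empty set the ring of functions is zero, hence reduced
    have hU0 : U ≠ ⊥ := by
      rintro rfl
      have := subsingleton_spectralAlgebra (universalPoint e)
      exact hred inferInstance
    rw [hequiv F U hU0] at hred
    exact ⟨F, _, _, IsScalarTower.toAlgHom k (MvPolynomial (Fin N) k) F, hF,
      exists_charPoly_eq_of_not_isReduced _ hU0 hred⟩
  · rintro ⟨F, _, _, h, hF, m, q, c, hm, -, hqc⟩ hall
    let _ : Algebra (MvPolynomial (Fin N) k) F := h.toRingHom.toAlgebra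
    have : IsScalarTower k (MvPolynomial (Fin N) k) F :=
      .of_algebraMap_eq' h.comp_algebraMap.symm
    obtain ⟨U, hU, hU0, hUD⟩ := exists_open_forall_eq_zero D
    exact not_isReduced_spectralAlgebra _ hU0 hUD hm hqc
      ((hequiv F U hU0).mp (hall F hF U hU))

end SmoothProjectiveCurve

/-! ### Codimension and integrality of the space of factorizations -/

/-- If the kernel of a homomorphism from a polynomial ring to a domain has height at most one, the
images of all the variables but one are algebraically independent. Indeed the kernel consists of the
multiples of some polynomial, and the omitted variable can be one which occurs in it. -/
theorem MvPolynomial.exists_algebraicIndependent_of_height_lt_two {k A σ : Type*}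
    [Field k] [Nonempty σ] [CommRing A] [IsDomain A] [Algebra k A] (φ : MvPolynomial σ k →ₐ[k] A)
    (h : (RingHom.ker φ).height < 2) :
    ∃ i : σ, AlgebraicIndependent k fun j : {j // j ≠ i} ↦ φ (X j.1) := by
  have hp : (RingHom.ker φ).IsPrime := RingHom.ker_isPrime φ
  obtain ⟨f, hf, hfφ⟩ : ∃ f : MvPolynomial σ k, (∃ i, f = 0 ∨ f.degreeOf i ≠ 0) ∧
      ∀ g, φ g = 0 → f ∣ g := by
    by_cases h0 : RingHom.ker φ = ⊥
    · refine ⟨0, ⟨Classical.arbitrary σ, Or.inl rfl⟩, fun g hg ↦ ?_⟩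
      rw [← RingHom.mem_ker, h0, Ideal.mem_bot] at hg
      rw [hg]
    obtain ⟨f, hfp, hf⟩ := hp.exists_mem_prime_of_ne_bot h0
    have hfprime : (Ideal.span {f}).IsPrime := (Ideal.span_singleton_prime hf.ne_zero).mpr hf
    refine ⟨f, ?_, fun g hg ↦ ?_⟩
    · by_contra hcon
      push Not at hcon
      have hv : f.vars = ∅ := by
        ext i
        simp [MvPolynomial.mem_vars_iff_degreeOf_ne_zero, (hcon i).2]
      rw [MvPolynomial.vars_eq_empty_iff_eq_C] at hv
      refine hf.not_isUnit ?_
      rw [hv]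
      refine IsUnit.map MvPolynomial.C (isUnit_iff_ne_zero.mpr fun hc ↦ hf.ne_zero ?_)
      rw [hv, hc, map_zero]
    · have hle : Ideal.span {f} ≤ RingHom.ker φ := (Ideal.span_singleton_le_iff_mem _).mpr hfp
      rcases hle.lt_or_eq with hlt | heq
      · have h₁ := Ideal.height_add_one_le_of_lt_of_isPrime hlt
        have h₂ := Ideal.height_add_one_le_of_lt_of_isPrime (I := ⊥) (J := Ideal.span {f})
          (bot_lt_iff_ne_bot.mpr fun hb ↦ hf.ne_zero (Ideal.span_singleton_eq_bot.mp hb))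
        have h₃ : (1 : ℕ∞) + 1 ≤ (Ideal.span {f}).height + 1 := by
          gcongr
          exact le_trans (by simp) h₂
        rw [one_add_one_eq_two] at h₃
        exact absurd (h₃.trans h₁) (not_le.mpr h)
      · rw [← Ideal.mem_span_singleton, heq]
        exact hg
  obtain ⟨i, hi⟩ := hf
  refine ⟨i, ?_⟩
  rw [algebraicIndependent_iff]
  intro g hg
  have hg' : φ (rename Subtype.val g) = 0 := by
    have : φ.comp (rename Subtype.val) =
        MvPolynomial.aeval fun j : {j // j ≠ i} ↦ φ (MvPolynomial.X j.1) := by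
      ext j
      simp
    exact (DFunLike.congr_fun this g).trans hg
  obtain ⟨c, hc⟩ := hfφ _ hg'
  by_contra hg0
  have hr0 : rename (Subtype.val : {j // j ≠ i} → σ) g ≠ 0 := fun h ↦
    hg0 (rename_injective _ Subtype.val_injective (h.trans (map_zero _).symm))
  have hdeg : (rename (Subtype.val : {j // j ≠ i} → σ) g).degreeOf i = 0 := by
    by_contra hne
    rw [← ne_eq, ← MvPolynomial.mem_vars_iff_degreeOf_ne_zero] at hne
    classical
    have := vars_rename _ _ hne
    simp at this
  have hf0 : f ≠ 0 := by rintro rfl; rw [zero_mul] at hc; exact hr0 hc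
  rw [hc, degreeOf_mul_eq hf0 (by rintro rfl; rw [mul_zero] at hc; exact hr0 hc)] at hdeg
  exact (hi.resolve_left hf0) (by lia)

/-- Otherwise the transcendence degree of the target would be at least that of the source minus
one. -/
theorem MvPolynomial.two_le_height_ker {k : Type u} {σ τ : Type} [Fintype σ] [Fintype τ]
    [Field k] (φ : MvPolynomial σ k →ₐ[k] MvPolynomial τ k)
    (h : Fintype.card τ + 2 ≤ Fintype.card σ) : 2 ≤ (RingHom.ker φ).height := by
  classical
  by_contra hcon
  have : Nonempty σ := Fintype.card_pos_iff.mp (by lia)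
  obtain ⟨i, hi⟩ := MvPolynomial.exists_algebraicIndependent_of_height_lt_two φ
    (not_le.mp hcon)
  have := hi.lift_cardinalMk_le_trdeg
  rw [MvPolynomial.trdeg_of_isDomain] at this
  simp only [ne_eq, Cardinal.mk_fintype, Fintype.card_subtype_compl, Fintype.card_unique,
    Cardinal.lift_natCast, Nat.cast_le] at this
  lia

namespace SmoothProjectiveCurve

variable {k : Type u} [Field k] {C : SmoothProjectiveCurve k} {D : C.Divisor} {r : ℕ}

section Points

variable {V : Type u} [AddCommGroup V] [Module k V] {ι : Type} [Fintype ι]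
  (e : Module.Basis ι k V) {S : Type u} [CommRing S] [Algebra k S]

/-- The `S`-valued point of `V` with the given coordinates in the basis `e`. -/
noncomputable def pointOfCoord (c : ι → S) : S ⊗[k] V :=
  ∑ j, c j ⊗ₜ[k] e j

theorem pointOfCoord_injective : Function.Injective (pointOfCoord e (S := S)) := by
  intro c c' h
  have key : ∀ c : ι → S, pointOfCoord e c = ∑ j, c j • Algebra.TensorProduct.basis S e j :=
    fun c ↦ Finset.sum_congr rfl fun j _ ↦ by
      rw [Algebra.TensorProduct.basis_apply, TensorProduct.smul_tmul', smul_eq_mul, mul_one]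
  funext j
  have h₁ := congrArg (fun z ↦ (Algebra.TensorProduct.basis S e).repr z j) h
  simpa only [key, Module.Basis.repr_sum_self] using h₁

theorem exists_pointOfCoord_eq (z : S ⊗[k] V) : ∃ c : ι → S, pointOfCoord e c = z := by
  refine ⟨(Algebra.TensorProduct.basis S e).repr z, ?_⟩
  nth_rewrite 2 [← (Algebra.TensorProduct.basis S e).sum_repr z]
  exact Finset.sum_congr rfl fun j _ ↦ by
    rw [Algebra.TensorProduct.basis_apply, TensorProduct.smul_tmul', smul_eq_mul, mul_one]

end Points

variable {S S' S'' : Type u} [CommRing S] [Algebra k S] [CommRing S'] [Algebra k S']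
  [CommRing S''] [Algebra k S'']

theorem pointChange_pointOfCoord {ι : Type} [Fintype ι]
    (e : Module.Basis ι k (HitchinBase D r)) (h : S →ₐ[k] S') (c : ι → S) :
    pointChange h (pointOfCoord e c) = pointOfCoord e fun j ↦ h (c j) := by
  rw [pointChange, pointOfCoord, map_sum]
  rfl

theorem pointChange_pointChange (h : S →ₐ[k] S') (h' : S' →ₐ[k] S'')
    (b : S ⊗[k] HitchinBase D r) :
    pointChange h' (pointChange h b) = pointChange (h'.comp h) b :=
  (LinearMap.rTensor_comp_apply _ h'.toLinearMap h.toLinearMap b).symm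

theorem charPoly_pointChange_eq (h : S →ₐ[k] S') {m l : ℕ} {b : S ⊗[k] HitchinBase D r}
    {q : S ⊗[k] HitchinBase D m} {c : S ⊗[k] HitchinBase D l}
    (hb : charPoly b = charPoly q ^ 2 * charPoly c) :
    charPoly (pointChange h b) =
      charPoly (pointChange h q) ^ 2 * charPoly (pointChange h c) := by
  rw [charPoly_pointChange, charPoly_pointChange, charPoly_pointChange, hb, Polynomial.map_mul,
    Polynomial.map_pow]

theorem exists_charPoly_eq_of_sq_mul [Nontrivial S] {m : ℕ} (hm : 2 * m ≤ r)
    (q : S ⊗[k] HitchinBase D m) (c : S ⊗[k] HitchinBase D (r - 2 * m)) :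
    ∃ b : S ⊗[k] HitchinBase D r, charPoly b = charPoly q ^ 2 * charPoly c := by
  refine exists_charPoly_eq (((monic_charPoly q).pow 2).mul (monic_charPoly c)) ?_ ?_
  · rw [((monic_charPoly q).pow 2).natDegree_mul (monic_charPoly c),
      (monic_charPoly q).natDegree_pow, natDegree_charPoly, natDegree_charPoly]
    lia
  · have := mul_mem_totSections (mul_mem_totSections (charPoly_mem q ⊤) (charPoly_mem q ⊤))
      (charPoly_mem c ⊤)
    have hr : (m : ℤ) + m + (r - 2 * m : ℕ) = r := by lia
    rwa [hr, ← sq] at this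

/-- If the characteristic polynomial of an `S'`-valued point has coefficients which are integral
over `S ⊗ K(C)`, the coordinates of the point are integral over `S`: the coefficients lie in `A ⊗
K(C)`, for `A` the integral closure of `S` in `S'`, and so do the coordinates, on which the linear
forms vanishing on `A` vanish. -/
theorem isIntegral_of_charCoeff [Algebra S S'] [IsScalarTower k S S'] {ι : Type} [Fintype ι]
    (e : Module.Basis ι k (HitchinBase D r)) (c : ι → S')
    (hc : ∀ i, (relChange (C := C) (IsScalarTower.toAlgHom k S S')).IsIntegralElem
      (charCoeff (pointOfCoord e c) i)) (j : ι) : IsIntegral S (c j) := by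
  let A := (integralClosure S S').restrictScalars k
  change c j ∈ A.toSubmodule
  by_contra hj
  obtain ⟨l, hl, hA⟩ := Submodule.exists_le_ker_of_notMem hj
  refine hl ?_
  have hslice : ∀ i, slice l (charCoeff (pointOfCoord e c) i) = 0 := fun i ↦ by
    obtain ⟨w, hw⟩ := exists_of_isIntegral_relFunctionField (hc i)
    rw [← hw]
    clear hw
    induction w using TensorProduct.induction_on with
    | zero => rw [map_zero]; exact map_zero _
    | add x y hx hy =>
      rw [map_add]
      exact (map_add (slice l) _ _).trans (by rw [hx, hy, add_zero])
    | tmul s f =>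
      have hs : l s = 0 := hA s.2
      exact (slice_tmul l _ _).trans ((congrArg (· • f) hs).trans (zero_smul k f))
  have hcoord : ∀ i, slice l (charCoeff (pointOfCoord e c) i) =
      ((∑ j, l (c j) • e j : HitchinBase D r) i : C.FunctionField) := fun i ↦ by
    have : charCoeff (pointOfCoord e c) i =
        ∑ j, c j • relMap S' (e j i : C.FunctionField) := by
      rw [charCoeff_eq_relCoord, pointOfCoord, relCoord, map_sum]
      exact Finset.sum_congr rfl fun j _ ↦ relCoord_tmul _ _ _
    rw [this, map_sum, Finset.sum_apply, AddSubmonoidClass.coe_finsetSum]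
    exact Finset.sum_congr rfl fun j _ ↦ slice_smul_relMap _ _ _
  have hsum : ∑ j, l (c j) • e j = 0 := by
    funext i
    exact Subtype.ext ((hcoord i).symm.trans (hslice i))
  exact Fintype.linearIndependent_iff.mp e.linearIndependent _ hsum j

end SmoothProjectiveCurve

/-! ### The non-reduced locus -/

namespace SmoothProjectiveCurve

variable {k : Type u} [Field k] {C : SmoothProjectiveCurve k} {D : C.Divisor} {r : ℕ}

section SquareMap

variable {N m M L : ℕ} (e : Module.Basis (Fin N) k (HitchinBase D r))
  (ε : Module.Basis (Fin M) k (HitchinBase D m))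
  (δ : Module.Basis (Fin L) k (HitchinBase D (r - 2 * m)))

/-- The property of `φ` to be the ring homomorphism corresponding to the morphism `(Q, R) ↦ Q²R`
from the space of pairs of characteristic polynomials of degrees `m` and `r - 2m`, with coordinates
in the bases `ε` and `δ`, to the Hitchin base with its coordinates in the basis `e`. -/
def IsSquareMap (φ : MvPolynomial (Fin N) k →ₐ[k] MvPolynomial (Fin M ⊕ Fin L) k) : Prop :=
  charPoly (pointChange φ (universalPoint e)) =
    charPoly (pointOfCoord ε fun j ↦ MvPolynomial.X (Sum.inl j)) ^ 2 *
      charPoly (pointOfCoord δ fun j ↦ MvPolynomial.X (Sum.inr j))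

theorem pointChange_universalPoint {S : Type u} [CommRing S] [Algebra k S]
    (h : MvPolynomial (Fin N) k →ₐ[k] S) :
    pointChange h (universalPoint e) = pointOfCoord e fun j ↦ h (MvPolynomial.X j) :=
  pointChange_pointOfCoord e h MvPolynomial.X

theorem exists_pointChange_universalPoint_eq {S : Type u} [CommRing S] [Algebra k S]
    (b : S ⊗[k] HitchinBase D r) :
    ∃ h : MvPolynomial (Fin N) k →ₐ[k] S, pointChange h (universalPoint e) = b := by
  obtain ⟨c, rfl⟩ := exists_pointOfCoord_eq e b
  refine ⟨MvPolynomial.aeval c, ?_⟩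
  simp only [pointChange_universalPoint, MvPolynomial.aeval_X]

theorem exists_isSquareMap (hm : 2 * m ≤ r) : ∃ φ, IsSquareMap e ε δ φ := by
  obtain ⟨b, hb⟩ := exists_charPoly_eq_of_sq_mul hm
    (pointOfCoord ε fun j ↦ (MvPolynomial.X (Sum.inl j) : MvPolynomial (Fin M ⊕ Fin L) k))
    (pointOfCoord δ fun j ↦ MvPolynomial.X (Sum.inr j))
  obtain ⟨φ, rfl⟩ := exists_pointChange_universalPoint_eq e b
  exact ⟨φ, hb⟩

variable {e ε δ} {φ : MvPolynomial (Fin N) k →ₐ[k] MvPolynomial (Fin M ⊕ Fin L) k}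

/-- The morphism `(Q, R) ↦ Q²R` is integral, because the coefficients of a monic factor of a monic
polynomial are integral over the ring generated by those of the polynomial. -/
theorem IsSquareMap.isIntegral (h : IsSquareMap e ε δ φ) : φ.toRingHom.IsIntegral := by
  let _ : Algebra (MvPolynomial (Fin N) k) (MvPolynomial (Fin M ⊕ Fin L) k) :=
    φ.toRingHom.toAlgebra
  have : IsScalarTower k (MvPolynomial (Fin N) k) (MvPolynomial (Fin M ⊕ Fin L) k) :=
    .of_algebraMap_eq' φ.comp_algebraMap.symm
  let _ : Algebra (C.RelFunctionField (MvPolynomial (Fin N) k))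
    (C.RelFunctionField (MvPolynomial (Fin M ⊕ Fin L) k)) := (relChange φ).toAlgebra
  have hint : ∀ Q : (C.RelFunctionField (MvPolynomial (Fin M ⊕ Fin L) k))[X], Q.Monic →
      Q ∣ charPoly (pointChange φ (universalPoint e)) →
        ∀ n, (relChange φ).IsIntegralElem (Q.coeff n) := fun Q hQ hdvd n ↦ by
    rw [charPoly_pointChange] at hdvd
    exact isIntegral_coeff_of_dvd (charPoly (universalPoint e)) Q (monic_charPoly _) hQ hdvd n
  have hX : ∀ j, IsIntegral (MvPolynomial (Fin N) k)
      (MvPolynomial.X j : MvPolynomial (Fin M ⊕ Fin L) k) := by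
    rintro (j | j)
    · refine isIntegral_of_charCoeff ε
        (fun j ↦ (MvPolynomial.X (Sum.inl j) : MvPolynomial (Fin M ⊕ Fin L) k)) (fun i ↦ ?_) j
      rw [← coeff_charPoly]
      exact hint _ (monic_charPoly _)
        (h ▸ (dvd_pow_self _ two_ne_zero).mul_right _) _
    · refine isIntegral_of_charCoeff δ
        (fun j ↦ (MvPolynomial.X (Sum.inr j) : MvPolynomial (Fin M ⊕ Fin L) k)) (fun i ↦ ?_) j
      rw [← coeff_charPoly]
      exact hint _ (monic_charPoly _) (h ▸ dvd_mul_left _ _) _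
  intro p
  change IsIntegral (MvPolynomial (Fin N) k) p
  induction p using MvPolynomial.induction_on with
  | C a =>
    have : MvPolynomial.C a = algebraMap (MvPolynomial (Fin N) k)
        (MvPolynomial (Fin M ⊕ Fin L) k) (MvPolynomial.C a) := (φ.commutes a).symm
    rw [this]
    exact isIntegral_algebraMap
  | add p q hp hq => exact hp.add hq
  | mul_X p j hp => exact hp.mul (hX j)

/-- The image of `(Q, R) ↦ Q²R` consists of the points whose characteristic polynomial is of the
form `Q²R` over an extension of the residue field. -/
theorem IsSquareMap.mem_range_comap_iff (h : IsSquareMap e ε δ φ)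
    (s : PrimeSpectrum (MvPolynomial (Fin N) k)) :
    s ∈ Set.range (PrimeSpectrum.comap φ.toRingHom) ↔
      ∃ (F : Type u) (_ : Field F) (_ : Algebra k F)
      (g : MvPolynomial (Fin N) k →ₐ[k] F), RingHom.ker g = s.asIdeal ∧
      ∃ (q : F ⊗[k] HitchinBase D m) (c : F ⊗[k] HitchinBase D (r - 2 * m)),
        charPoly (pointChange g (universalPoint e)) = charPoly q ^ 2 * charPoly c := by
  constructor
  · rintro ⟨P, rfl⟩
    let g : MvPolynomial (Fin M ⊕ Fin L) k →ₐ[k] P.asIdeal.ResidueField :=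
      IsScalarTower.toAlgHom k _ _
    refine ⟨P.asIdeal.ResidueField, inferInstance, inferInstance, g.comp φ, ?_, _, _, by
      rw [← pointChange_pointChange]; exact charPoly_pointChange_eq g h⟩
    ext x
    exact Ideal.algebraMap_residueField_eq_zero
  · rintro ⟨F, _, _, g, hg, q, c, hqc⟩
    obtain ⟨y, rfl⟩ := exists_pointOfCoord_eq ε q
    obtain ⟨z, rfl⟩ := exists_pointOfCoord_eq δ c
    let g' : MvPolynomial (Fin M ⊕ Fin L) k →ₐ[k] F := MvPolynomial.aeval (Sum.elim y z)
    have h' := charPoly_pointChange_eq g' h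
    simp only [pointChange_pointOfCoord, pointChange_pointChange, g', MvPolynomial.aeval_X,
      Sum.elim_inl, Sum.elim_inr] at h'
    rw [← hqc] at h'
    replace h' := charPoly_injective h'
    rw [pointChange_universalPoint, pointChange_universalPoint] at h'
    have hg' : g'.comp φ = g := MvPolynomial.algHom_ext fun j ↦
      congrFun (pointOfCoord_injective e h') j
    refine ⟨⟨RingHom.ker g', RingHom.ker_isPrime g'⟩, PrimeSpectrum.ext ?_⟩
    rw [← hg, ← hg']
    rfl

end SquareMap

/-- The non-reduced locus is the union of the images of the morphisms `(Q, R) ↦ Q²R`. -/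
theorem exists_nonReducedLocus_eq {N : ℕ} (e : Module.Basis (Fin N) k (HitchinBase D r)) :
    ∃ φ : ∀ m, MvPolynomial (Fin N) k →ₐ[k]
        MvPolynomial (Fin (Module.finrank k (HitchinBase D m)) ⊕
          Fin (Module.finrank k (HitchinBase D (r - 2 * m)))) k,
      (∀ m, 2 * m ≤ r → (φ m).toRingHom.IsIntegral) ∧
      nonReducedLocus e =
        ⋃ m ∈ {m : ℕ | 1 ≤ m ∧ 2 * m ≤ r}, Set.range (PrimeSpectrum.comap (φ m).toRingHom) := by
  have hφ : ∀ m, ∃ φ, 2 * m ≤ r → IsSquareMap e (Module.finBasis k (HitchinBase D m))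
      (Module.finBasis k (HitchinBase D (r - 2 * m))) φ := fun m ↦ by
    by_cases hm : 2 * m ≤ r
    · obtain ⟨φ, hφ⟩ := exists_isSquareMap e (Module.finBasis k (HitchinBase D m))
        (Module.finBasis k (HitchinBase D (r - 2 * m))) hm
      exact ⟨φ, fun _ ↦ hφ⟩
    · exact ⟨MvPolynomial.aeval 0, fun h ↦ absurd h hm⟩
  choose φ hφ using hφ
  refine ⟨φ, fun m hm ↦ (hφ m hm).isIntegral, ?_⟩
  ext s
  refine (mem_nonReducedLocus_iff e s).trans (Iff.trans ?_ Set.mem_iUnion₂.symm)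
  constructor
  · rintro ⟨F, _, _, g, hg, m, q, c, hm, hmr, hqc⟩
    exact ⟨m, ⟨hm, hmr⟩, ((hφ m hmr).mem_range_comap_iff s).mpr ⟨F, _, _, g, hg, q, c, hqc⟩⟩
  · rintro ⟨m, ⟨hm, hmr⟩, hs⟩
    obtain ⟨F, _, _, g, hg, q, c, hqc⟩ := ((hφ m hmr).mem_range_comap_iff s).mp hs
    exact ⟨F, _, _, g, hg, m, q, c, hm, hmr, hqc⟩

end SmoothProjectiveCurve

theorem mainTheorem9 {k : Type u} [Field k] (C : SmoothProjectiveCurve k) (D : C.Divisor) (r : ℕ)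
    (hr : 1 ≤ r) (hD : 2 * (C.genus : ℤ) - 2 < D.degree) (hD0 : 0 < D.degree) :
    Module.Finite k (SmoothProjectiveCurve.HitchinBase D r) ∧
    ∀ (N : ℕ) (e : Module.Basis (Fin N) k (SmoothProjectiveCurve.HitchinBase D r)),
      IsClosed (SmoothProjectiveCurve.nonReducedLocus e) ∧
      2 ≤ schemeCodimension (SmoothProjectiveCurve.nonReducedLocus e) := by
  refine ⟨inferInstance, fun N e ↦ ?_⟩
  obtain ⟨φ, hφ, hV⟩ := SmoothProjectiveCurve.exists_nonReducedLocus_eq e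
  rw [hV]
  constructor
  · have hfin : {m : ℕ | 1 ≤ m ∧ 2 * m ≤ r}.Finite :=
      (Set.finite_Iic r).subset fun m hm ↦ by have := hm.2; simp only [Set.mem_Iic]; lia
    refine hfin.isClosed_biUnion fun m hm ↦ ?_
    exact (PrimeSpectrum.isClosedMap_comap_of_isIntegral _ (hφ m hm.2)).isClosed_range
  · refine le_iInf₂ fun s hs ↦ ?_
    obtain ⟨m, ⟨hm, hmr⟩, P, hP⟩ := Set.mem_iUnion₂.mp hs
    rw [← idealHeight_eq_coheight]
    have hle : RingHom.ker (φ m) ≤ s.asIdeal := by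
      rw [← hP]
      exact Ideal.comap_mono bot_le
    refine le_trans ?_ (Ideal.height_mono hle)
    refine MvPolynomial.two_le_height_ker (φ m) ?_
    have := SmoothProjectiveCurve.finrank_hitchinBase_add_two_le hD hD0 hm hmr
    rw [Module.finrank_eq_card_basis e] at this
    rwa [Fintype.card_sum, Fintype.card_fin, Fintype.card_fin]
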